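/- **Proposition 3.1 (differential Fay identity).** Let $\mathbf t=(t_1,t_3,t_5,\dots)$, let $\mathcal R=\mathbb C[[t_1,t_3,t_5,\dots]]$, and let $k\in\mathbb C$ be a constant. Let $$w(\mathbf t,z)=1+\sum_{n\ge1}w_n(\mathbf t)z^{-n},\qquad \tilde w(\mathbf t,z)=1+\sum_{n\ge1}\tilde w_n(\mathbf t)z^{-n},\qquad w_n,\tilde w_n\in\mathcal R,$$ satisfy the bilinear identity $$\mathrm{res}\Big(w(\mathbf s,z)\,\tilde w(\mathbf t,z)\,\exp\sum_{n\ge1}(s_{2n-1}-t_{2n-1})z^{2n-1}\Big)=0,$$ where $\mathrm{res}$ is the coefficient of $z^{-1}$ and $\mathbf s,\mathbf t$ are independent. Put $\phi=-w_1$ and define $\theta$ by $w_2=-\theta+\frac12(\phi_{t_1}+\phi^2)$; assume $\theta=k\,\phi_{t_1}$. For indeterminates $\lambda,\mu$ write $f_{2[\lambda]}(\mathbf t)=f(t_1+2\lambda,\,t_3+\tfrac23\lambda^3,\,t_5+\tfrac25\lambda^5,\dots)$, and $$F(\lambda)=1-\tfrac{\lambda}{2}\,(\phi_{2[\lambda]}-\phi),$$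 with powers $F(\lambda)^\alpha$ given by the binomial series. (1) There is an invertible $\tau\in\mathcal R$ with $\phi=2(\ln\tau)_{t_1}=2\tau_{t_1}/\tau$ such that $$\frac{\lambda+\mu}{\lambda-\mu}\,\tau_{2[\lambda]}\tau_{2[\mu]}\Big(\lambda\,F_{2[\lambda]}(\mu)^{k+\frac12}F(\mu)^{-k+\frac12}-\mu\,F_{2[\mu]}(\lambda)^{k+\frac12}F(\lambda)^{-k+\frac12}\Big)$$ $$=(\lambda+\mu)\,\tau\,\tau_{2[\lambda]+2[\mu]}-\lambda\mu\Big((\tau_{2[\lambda]+2[\mu]})_{t_1}\tau-\tau_{2[\lambda]+2[\mu]}\,\tau_{t_1}\Big).\qquad(*)$$ (2) (BKP) Let $k=\pm\frac12$. As an expression in an invertible $\tau\in\mathcal R$ (with $\phi:=2\tau_{t_1}/\tau$ in $F$), the difference of the two sides of $(*)$, multiplied by $\lambda-\mu$, is bilinear in $\tau$, i.e. equal to $B(\tau,\tau)$ for a $\mathbb C$-bilinear map $B$; and for every invertible $\tau$, $(*)$ is equivalent to $$(\lambda^{-1}+\mu^{-1})\big(\tau_{2[\lambda]+2[\mu]}\tau-\tau_{2[\lambda]}\tau_{2[\mu]}\big)=(\tau_{2[\lambda]+2[\mu]})_{t_1}\tau-\tau_{2[\lambda]+2[\mu]}\tau_{t_1}+\frac{\lambda+\mu}{\lambda-\mu}\Big((\tau_{2[\lambda]})_{t_1}\tau_{2[\mu]}-\tau_{2[\lambda]}(\tau_{2[\mu]})_{t_1}\Big).$$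 (3) (CKP) For $k=0$ the difference of the two sides of $(*)$, multiplied by $\lambda-\mu$, is not bilinear in $\tau$: no $\mathbb C$-bilinear map $B$ satisfies that it equals $B(\tau,\tau)$ for all invertible $\tau\in\mathcal R$. -/

import Mathlib

open scoped BigOperators

noncomputable section

namespace OddKP

/-- Functions of the odd times `t₁, t₃, t₅, …`, as formal power series over `ℂ`.
The variable with index `n` is the time `t_{2n+1}`. -/
abbrev TimeSeries := MvPowerSeries ℕ ℂ

/-- Functions of two independent sets of odd times: `Sum.inl n` is `s_{2n+1}` and
`Sum.inr n` is `t_{2n+1}`. -/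
abbrev PairSeries := MvPowerSeries (ℕ ⊕ ℕ) ℂ

/-- Functions of the odd times and of two indeterminates: `Sum.inl n` is `t_{2n+1}`,
`Sum.inr 0` is `λ` and `Sum.inr 1` is `μ`. -/
abbrev MiwaSeries := MvPowerSeries (ℕ ⊕ Fin 2) ℂ

/-! ### The bilinear identity -/

/-- `f(t) ↦ f(s)`. -/
def atS (f : TimeSeries) : PairSeries := MvPowerSeries.rename Function.Embedding.inl f

/-- `f(t) ↦ f(t)`, as a function of `(s, t)`. -/
def atT (f : TimeSeries) : PairSeries := MvPowerSeries.rename Function.Embedding.inr f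

/-- The phase `ξ(s - t, z) = ∑_{n ≥ 0} (s_{2n+1} - t_{2n+1}) z^{2n+1}`, as a series in `z`. -/
def phase : PowerSeries PairSeries :=
  PowerSeries.mk fun m =>
    if Odd m then MvPowerSeries.X (Sum.inl (m / 2)) - MvPowerSeries.X (Sum.inr (m / 2)) else 0

/-- `exp (ξ(s - t, z))`, as a series in `z`. -/
def expPhase : PowerSeries PairSeries :=
  PowerSeries.subst phase (PowerSeries.exp ℂ)

/-- Coefficient of `z^{-n}` in `w(s,z) w̃(t,z)`, for `w(t,z) = ∑_{n ≥ 0} w_n(t) z^{-n}` and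
`w̃(t,z) = ∑_{n ≥ 0} w̃_n(t) z^{-n}`. -/
def waveProd (w wt : ℕ → TimeSeries) (n : ℕ) : PairSeries :=
  ∑ p ∈ Finset.HasAntidiagonal.antidiagonal n, atS (w p.1) * atT (wt p.2)

/-- `res (w(s,z) w̃(t,z) exp (ξ(s - t, z)))`, i.e. the coefficient of `z^{-1}`,
`∑_{m ≥ 0} [z^m] exp (ξ(s - t, z)) · [z^{-m-1}] w(s,z) w̃(t,z)`. This infinite sum is taken
coefficientwise; for each monomial in `(s, t)` it has only finitely many non-zero terms, see
`bilinearResidue_finite`. -/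
def bilinearResidue (w wt : ℕ → TimeSeries) : PairSeries := fun e =>
  ∑ᶠ m : ℕ, MvPowerSeries.coeff e (PowerSeries.coeff m expPhase * waveProd w wt (m + 1))

/-- The bilinear identity `res (ψ(s,z) ψ̃(t,z)) = 0` for `ψ = w e^{ξ(t,z)}`,
`ψ̃ = w̃ e^{-ξ(t,z)}`. -/
def BilinearIdentity (w wt : ℕ → TimeSeries) : Prop := bilinearResidue w wt = 0

/-- `φ = -w₁`. -/
def phi (w : ℕ → TimeSeries) : TimeSeries := - w 1

/-- `θ`, defined by `w₂ = -θ + (φ_{t₁} + φ²) / 2`. -/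
def theta (w : ℕ → TimeSeries) : TimeSeries :=
  MvPowerSeries.C (1 / 2 : ℂ) * (MvPowerSeries.pderiv ℂ 0 (phi w) + phi w ^ 2) - w 2

/-! ### Miwa shifts -/

/-- The argument of a Miwa shift: `t_{2n+1} + ∑_{i ∈ L} 2 λ_i^{2n+1} / (2n+1)`, where
`λ_0 = λ`, `λ_1 = μ`. -/
def miwaArg (L : Finset (Fin 2)) (n : ℕ) : MiwaSeries :=
  MvPowerSeries.X (Sum.inl n) +
    ∑ i ∈ L, MvPowerSeries.C (2 / (2 * n + 1) : ℂ) * MvPowerSeries.X (Sum.inr i) ^ (2 * n + 1)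

/-- The Miwa shift `f(t) ↦ f(t + ∑_{i ∈ L} 2[λ_i])`. So `L = ∅, {0}, {1}, {0, 1}` give
`f, f_{2[λ]}, f_{2[μ]}, f_{2[λ]+2[μ]}`. -/
def shift (L : Finset (Fin 2)) (f : TimeSeries) : MiwaSeries :=
  MvPowerSeries.subst (miwaArg L) f

/-- The `t₁`-derivative of a series in the times and `λ, μ`. -/
def dOne (f : MiwaSeries) : MiwaSeries := MvPowerSeries.pderiv ℂ (Sum.inl 0) f

/-- The indeterminate `λ`. -/
def lam : MiwaSeries := MvPowerSeries.X (Sum.inr 0)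

/-- The indeterminate `μ`. -/
def mu : MiwaSeries := MvPowerSeries.X (Sum.inr 1)

/-- `F(λ_i)`, Miwa shifted by `L`:
`1 - (λ_i / 2) (φ_{2[λ_i] + L} - φ_L)`, for `i ∉ L`. So `F L i` is
`F(μ)` for `L = ∅`, `i = 1` and `F_{2[λ]}(μ)` for `L = {0}`, `i = 1`. -/
def F (φ : TimeSeries) (L : Finset (Fin 2)) (i : Fin 2) : MiwaSeries :=
  1 - MvPowerSeries.C (1 / 2 : ℂ) * MvPowerSeries.X (Sum.inr i) *
    (shift (insert i L) φ - shift L φ)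

/-- The power `f ^ α = ∑_n (α choose n) (f - 1)^n` of a series with constant coefficient `1`. -/
def power (f : MiwaSeries) (α : ℂ) : MiwaSeries :=
  PowerSeries.subst (f - 1) (PowerSeries.binomialSeries ℂ α)

/-! ### The differential Fay identity -/

/-- `φ = 2 (ln τ)_{t₁} = 2 τ_{t₁} / τ`, for invertible `τ`. -/
def phiOfTau (τ : TimeSeries) : TimeSeries :=
  MvPowerSeries.C (2 : ℂ) * MvPowerSeries.pderiv ℂ 0 τ * τ⁻¹

/-- Left hand side of the differential Fay identity, multiplied by `λ - μ`. -/
def fayLHS (k : ℂ) (τ : TimeSeries) : MiwaSeries :=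
  (lam + mu) * shift {0} τ * shift {1} τ *
    (lam * power (F (phiOfTau τ) {0} 1) (k + 1 / 2) * power (F (phiOfTau τ) ∅ 1) (-k + 1 / 2)
      - mu * power (F (phiOfTau τ) {1} 0) (k + 1 / 2) * power (F (phiOfTau τ) ∅ 0) (-k + 1 / 2))

/-- Right hand side of the differential Fay identity, multiplied by `λ - μ`. -/
def fayRHS (τ : TimeSeries) : MiwaSeries :=
  (lam - mu) * ((lam + mu) * shift ∅ τ * shift {0, 1} τ
    - lam * mu * (dOne (shift {0, 1} τ) * shift ∅ τ - shift {0, 1} τ * dOne (shift ∅ τ)))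

/-- The differential Fay identity. Since power series form a domain, clearing the denominator
`λ - μ` gives an equivalent identity. -/
def DifferentialFay (k : ℂ) (τ : TimeSeries) : Prop := fayLHS k τ = fayRHS τ

/-- The BKP differential Fay identity in Hirota form, multiplied by `λ μ (λ - μ)`. -/
def BKPFay (τ : TimeSeries) : Prop :=
  (lam - mu) * (lam + mu) * (shift {0, 1} τ * shift ∅ τ - shift {0} τ * shift {1} τ) =
    lam * mu * (lam - mu) *
        (dOne (shift {0, 1} τ) * shift ∅ τ - shift {0, 1} τ * dOne (shift ∅ τ))
      + lam * mu * (lam + mu) *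
        (dOne (shift {0} τ) * shift {1} τ - shift {0} τ * dOne (shift {1} τ))

/-- An expression in an invertible `τ` is bilinear in `τ` if it is `B(τ, τ)` for a `ℂ`-bilinear
map `B`. -/
def IsBilinearIn (E : TimeSeries → MiwaSeries) : Prop :=
  ∃ B : TimeSeries →ₗ[ℂ] TimeSeries →ₗ[ℂ] MiwaSeries, ∀ τ, IsUnit τ → E τ = B τ τ

/-! ### The substitutions and sums above are legitimate -/

theorem hasSubst_phase : PowerSeries.HasSubst phase :=
  PowerSeries.HasSubst.of_constantCoeff_zero' (by
    rw [← PowerSeries.coeff_zero_eq_constantCoeff_apply]; simp [phase])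

theorem hasSubst_miwaArg (L : Finset (Fin 2)) : MvPowerSeries.HasSubst (miwaArg L) where
  const_coeff n := by
    have : MvPowerSeries.constantCoeff (miwaArg L n) = 0 := by simp [miwaArg]
    rw [this]; exact IsNilpotent.zero
  coeff_zero d := by
    classical
    refine ((Finset.range (d.degree + 1)).finite_toSet.union
      (d.support.finite_toSet.preimage (Sum.inl_injective.injOn))).subset ?_
    intro n hn
    by_contra hcon
    simp only [Set.mem_union, Finset.mem_coe, Finset.mem_range, Set.mem_preimage, not_or,
      Finsupp.mem_support_iff, not_not, not_lt] at hcon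
    apply hn
    have h1 : d ≠ Finsupp.single (Sum.inl n) 1 := by
      rintro rfl; simp at hcon
    have h2 : ∀ i : Fin 2, d ≠ Finsupp.single (Sum.inr i) (2 * n + 1) := by
      rintro i rfl
      simp only [Finsupp.degree_single] at hcon
      omega
    simp only [miwaArg, map_add, map_sum, MvPowerSeries.coeff_X, if_neg h1, zero_add,
      MvPowerSeries.coeff_C_mul, MvPowerSeries.coeff_X_pow, if_neg (h2 _), mul_zero,
      Finset.sum_const_zero]

theorem hasSubst_F_sub_one (φ : TimeSeries) (L : Finset (Fin 2)) (i : Fin 2) :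
    PowerSeries.HasSubst (F φ L i - 1) :=
  PowerSeries.HasSubst.of_constantCoeff_zero (by simp [F])

theorem coeff_coeff_phase_pow (k m : ℕ) (e : ℕ ⊕ ℕ →₀ ℕ)
    (h : Finsupp.weight (Sum.elim (fun n => 2 * n + 1) (fun n => 2 * n + 1)) e < m) :
    MvPowerSeries.coeff e (PowerSeries.coeff m (phase ^ k)) = 0 := by
  classical
  induction k generalizing m e with
  | zero =>
    rw [pow_zero, PowerSeries.coeff_one, if_neg (by omega), map_zero]
  | succ k ih =>
    rw [pow_succ, PowerSeries.coeff_mul, map_sum]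
    refine Finset.sum_eq_zero fun p hp => ?_
    rw [MvPowerSeries.coeff_mul]
    refine Finset.sum_eq_zero fun q hq => ?_
    rw [Finset.HasAntidiagonal.mem_antidiagonal] at hp hq
    rw [← hq, map_add] at h
    by_cases h1 : Finsupp.weight (Sum.elim (fun n => 2 * n + 1) (fun n => 2 * n + 1)) q.1 < p.1
    · rw [ih _ _ h1, zero_mul]
    · have h2 : Finsupp.weight (Sum.elim (fun n => 2 * n + 1) (fun n => 2 * n + 1)) q.2 < p.2 := by
        omega
      have : MvPowerSeries.coeff q.2 (PowerSeries.coeff p.2 phase) = 0 := by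
        rw [phase, PowerSeries.coeff_mk]
        split_ifs with hodd
        · have hm := Nat.two_mul_div_two_add_one_of_odd hodd
          rw [map_sub, MvPowerSeries.coeff_X, MvPowerSeries.coeff_X, if_neg, if_neg, sub_zero]
          · intro hc
            rw [hc, Finsupp.weight_single] at h2
            simp at h2
            omega
          · intro hc
            rw [hc, Finsupp.weight_single] at h2
            simp at h2
            omega
        · simp
      rw [this, mul_zero]

theorem coeff_coeff_expPhase (m : ℕ) (e : ℕ ⊕ ℕ →₀ ℕ)
    (h : Finsupp.weight (Sum.elim (fun n => 2 * n + 1) (fun n => 2 * n + 1)) e < m) :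
    MvPowerSeries.coeff e (PowerSeries.coeff m expPhase) = 0 := by
  rw [expPhase, PowerSeries.coeff_subst' hasSubst_phase]
  refine finsum_induction (fun f : PairSeries => MvPowerSeries.coeff e f = 0) (map_zero _)
    (fun x y hx hy => by rw [map_add, hx, hy, add_zero]) fun d => ?_
  rw [MvPowerSeries.coeff_smul, coeff_coeff_phase_pow d m e h, mul_zero]

/-- For each monomial, only finitely many terms contribute to `bilinearResidue`. -/
theorem bilinearResidue_finite (w wt : ℕ → TimeSeries) (e : ℕ ⊕ ℕ →₀ ℕ) :
    (Function.support fun m : ℕ =>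
      MvPowerSeries.coeff e (PowerSeries.coeff m expPhase * waveProd w wt (m + 1))).Finite := by
  classical
  refine (Finset.range (Finsupp.weight
    (Sum.elim (fun n => 2 * n + 1) (fun n => 2 * n + 1)) e + 1)).finite_toSet.subset ?_
  intro m hm
  by_contra hcon
  simp only [Finset.mem_coe, Finset.mem_range, not_lt] at hcon
  apply hm
  show MvPowerSeries.coeff e (PowerSeries.coeff m expPhase * waveProd w wt (m + 1)) = 0
  rw [MvPowerSeries.coeff_mul]
  refine Finset.sum_eq_zero fun q hq => ?_
  rw [Finset.HasAntidiagonal.mem_antidiagonal] at hq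
  rw [← hq, map_add] at hcon
  rw [coeff_coeff_expPhase m q.1 (by omega), zero_mul]

end OddKP

end

open scoped BigOperators

noncomputable section

namespace OddKP

open MvPowerSeries Finsupp Filter

/-! The bilinear identity and its `s₁`-derivative are evaluated at `s = t`, `s = t + 2[λ]` and `s =
t + 2[λ] + 2[μ]`. There `exp ξ(s - t, z)` becomes a product of factors `(1 + λz)/(1 - λz)`, and
partial fractions turn the residue into values of `w`, `w̃` at `z = 1/λ`, `1/μ`. One shift gives
`w_{2[λ]}(1/λ) w̃(1/λ) = F(λ)` and, through `θ = k φ_{t₁}`, the logarithmic `t₁`-derivatives of both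
factors. Two shifts give relations between `W = w_{2[λ]+2[μ]}(1/λ) w̃(1/λ)` and the analogous
product `U` at `1/μ`.

The heart is `wave_mul_pow`: `W P = U Q` with `P = F_{2[λ]}(μ)^{k+1/2} F(μ)^{-k+1/2}` and `Q`
obtained by exchanging `λ` and `μ`. Elimination yields two homogeneous linear relations for `W` and
`U` (`first_relation`, `second_relation`). For `k = ±1/2` one of them is the claim; for `k = 0`
their product is its square. For every other `k`, compatibility with the logarithmic derivative of
`W/U` is so restrictive that `F(λ)` cannot depend on `t₁` (`dTime_F_eq_zero`), and then both
relations simplify and combine to the claim.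

Consequently `w̃(1/λ) F(λ)^{k-1/2}` is a multiplicative cocycle for Miwa shifts (`dualTau_cocycle`).
The coefficients of its logarithm form a closed one-form (`tauForm_closed`); the exponential of a
primitive is `τ`, and `τ_{2[λ]}` is `τ` times the cocycle up to a factor depending on `λ` alone.
Inserting this into the first two-shift relation gives the Fay identity.

For `k = ±1/2` the exponents are `0` and `1`, and the factors `τ_{2[λ]} τ_{2[μ]}` clear the
denominators of what remains. For `k = 0`, the family `τ = 1 + a t₁` at `t = 0`, `μ = -λ` produces a
square root of `(1 - 4a²λ²)(1 + 4a⁴λ⁴)`, which is not quadratic in `a`.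

Identities between substitutions and derivations are checked on polynomials only: each coefficient
involved depends on finitely many coefficients of the argument (`FinDet`). -/

/-! ### Finitely determined maps -/

section FinDet

variable {σ τ υ : Type*}

/-- Every coefficient of `Φ f` depends on finitely many coefficients of `f`. -/
def FinDet (Φ : MvPowerSeries σ ℂ → MvPowerSeries τ ℂ) : Prop :=
  ∀ e, ∃ S : Finset (σ →₀ ℕ), ∀ f g, (∀ d ∈ S, coeff d f = coeff d g) →
    coeff e (Φ f) = coeff e (Φ g)

theorem FinDet.id : FinDet (fun f : MvPowerSeries σ ℂ => f) :=
  fun e => ⟨{e}, fun f g h => h e (by simp)⟩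

theorem FinDet.const (a : MvPowerSeries τ ℂ) : FinDet (fun _ : MvPowerSeries σ ℂ => a) :=
  fun _ => ⟨∅, fun _ _ _ => rfl⟩

theorem FinDet.comp {Ψ : MvPowerSeries τ ℂ → MvPowerSeries υ ℂ}
    {Φ : MvPowerSeries σ ℂ → MvPowerSeries τ ℂ} (hΨ : FinDet Ψ) (hΦ : FinDet Φ) :
    FinDet (fun f => Ψ (Φ f)) := by
  classical
  intro e
  obtain ⟨S, hS⟩ := hΨ e
  choose T hT using hΦ
  exact ⟨S.biUnion T, fun f g h => hS _ _ fun d hd =>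
    hT d f g fun d' hd' => h d' (Finset.mem_biUnion.2 ⟨d, hd, hd'⟩)⟩

theorem FinDet.add {Φ Ψ : MvPowerSeries σ ℂ → MvPowerSeries τ ℂ} (hΦ : FinDet Φ)
    (hΨ : FinDet Ψ) : FinDet (fun f => Φ f + Ψ f) := by
  classical
  intro e
  obtain ⟨S, hS⟩ := hΦ e
  obtain ⟨T, hT⟩ := hΨ e
  refine ⟨S ∪ T, fun f g h => ?_⟩
  rw [map_add, map_add, hS f g fun d hd => h d (Finset.mem_union_left _ hd),
    hT f g fun d hd => h d (Finset.mem_union_right _ hd)]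

theorem FinDet.mul {Φ Ψ : MvPowerSeries σ ℂ → MvPowerSeries τ ℂ} (hΦ : FinDet Φ)
    (hΨ : FinDet Ψ) : FinDet (fun f => Φ f * Ψ f) := by
  classical
  intro e
  choose S hS using hΦ
  choose T hT using hΨ
  refine ⟨(Finset.HasAntidiagonal.antidiagonal e).biUnion fun p => S p.1 ∪ T p.2,
    fun f g h => ?_⟩
  rw [coeff_mul, coeff_mul]
  refine Finset.sum_congr rfl fun p hp => ?_
  rw [hS p.1 f g fun d hd => h d (Finset.mem_biUnion.2 ⟨p, hp, Finset.mem_union_left _ hd⟩),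
    hT p.2 f g fun d hd => h d (Finset.mem_biUnion.2 ⟨p, hp, Finset.mem_union_right _ hd⟩)]

theorem FinDet.neg {Φ : MvPowerSeries σ ℂ → MvPowerSeries τ ℂ} (hΦ : FinDet Φ) :
    FinDet (fun f => - Φ f) := by
  have := (FinDet.const (σ := σ) (-1 : MvPowerSeries τ ℂ)).mul hΦ
  simpa using this

theorem FinDet.sub {Φ Ψ : MvPowerSeries σ ℂ → MvPowerSeries τ ℂ} (hΦ : FinDet Φ)
    (hΨ : FinDet Ψ) : FinDet (fun f => Φ f - Ψ f) := by
  simpa [sub_eq_add_neg] using hΦ.add hΨ.neg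

theorem FinDet.sum {ι : Type*} (s : Finset ι)
    {Φ : ι → MvPowerSeries σ ℂ → MvPowerSeries τ ℂ} (hΦ : ∀ i, FinDet (Φ i)) :
    FinDet (fun f => ∑ i ∈ s, Φ i f) := by
  classical
  induction s using Finset.induction_on with
  | empty => simpa using FinDet.const (0 : MvPowerSeries τ ℂ)
  | insert a s ha ih => simpa [Finset.sum_insert ha] using (hΦ a).add ih

theorem FinDet.pderiv (i : σ) : FinDet (fun f : MvPowerSeries σ ℂ => MvPowerSeries.pderiv ℂ i f) :=
  fun e => ⟨{e + single i 1}, fun f g h => by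
    rw [coeff_pderiv, coeff_pderiv, h _ (by simp)]⟩

theorem FinDet.subst {a : σ → MvPowerSeries τ ℂ} (ha : HasSubst a) :
    FinDet (fun f : MvPowerSeries σ ℂ => MvPowerSeries.subst a f) := by
  intro e
  -- The series with all coefficients `1` detects every exponent whose image contributes to `e`, so
  -- one finite set serves all `f`.
  have h1 : (Function.support fun d : σ →₀ ℕ => coeff d (fun _ => (1 : ℂ) : MvPowerSeries σ ℂ) •
      coeff e (d.prod fun s e => a s ^ e)).Finite := coeff_subst_finite ha _ e
  refine ⟨h1.toFinset, fun f g h => ?_⟩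
  rw [coeff_subst ha, coeff_subst ha]
  refine finsum_congr fun d => ?_
  by_cases hd : d ∈ h1.toFinset
  · rw [h d hd]
  · rw [Set.Finite.mem_toFinset, Function.mem_support, not_not] at hd
    have hd' : coeff e (d.prod fun s e => a s ^ e) = 0 := by
      change (1 : ℂ) • _ = _ at hd
      simpa using hd
    rw [hd', smul_zero, smul_zero]

theorem FinDet.substAlgHom {a : σ → MvPowerSeries τ ℂ} (ha : HasSubst a) :
    FinDet (fun f : MvPowerSeries σ ℂ => MvPowerSeries.substAlgHom (R := ℂ) ha f) := by
  simpa using FinDet.subst ha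

/-- Density of polynomials: truncating `f` to the finitely many exponents seen by `Φ` and `Ψ`
changes neither coefficient. -/
theorem FinDet.coeff_eq {Φ Ψ : MvPowerSeries σ ℂ → MvPowerSeries τ ℂ} (hΦ : FinDet Φ)
    (hΨ : FinDet Ψ) (e : τ →₀ ℕ)
    (h : ∀ p : MvPolynomial σ ℂ, coeff e (Φ p) = coeff e (Ψ p)) (f : MvPowerSeries σ ℂ) :
    coeff e (Φ f) = coeff e (Ψ f) := by
  classical
  obtain ⟨S, hS⟩ := hΦ e
  obtain ⟨T, hT⟩ := hΨ e
  let p : MvPolynomial σ ℂ := ∑ d ∈ S ∪ T, MvPolynomial.monomial d (coeff d f)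
  have hp : ∀ d ∈ S ∪ T, coeff d f = coeff d (p : MvPowerSeries σ ℂ) := by
    intro d hd
    rw [MvPolynomial.coeff_coe, MvPolynomial.coeff_sum, Finset.sum_eq_single d]
    · simp
    · intro b _ hb
      rw [MvPolynomial.coeff_monomial, if_neg hb]
    · intro h; exact absurd hd h
  rw [hS f p fun d hd => hp d (Finset.mem_union_left _ hd),
    hT f p fun d hd => hp d (Finset.mem_union_right _ hd), h]

theorem FinDet.eq_of_polynomial {Φ Ψ : MvPowerSeries σ ℂ → MvPowerSeries τ ℂ} (hΦ : FinDet Φ)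
    (hΨ : FinDet Ψ) (h : ∀ p : MvPolynomial σ ℂ, Φ p = Ψ p) (f : MvPowerSeries σ ℂ) :
    Φ f = Ψ f := by
  ext e
  exact hΦ.coeff_eq hΨ e (fun p => by rw [h]) f

/-- Two additive maps intertwining a ring homomorphism by the Leibniz rule agree if they agree on
variables and constants. -/
theorem eq_of_leibniz {Φ Ψ : MvPowerSeries σ ℂ → MvPowerSeries τ ℂ}
    {ρ : MvPowerSeries σ ℂ → MvPowerSeries τ ℂ}
    (hΦ : FinDet Φ) (hΨ : FinDet Ψ)
    (hΦa : ∀ f g, Φ (f + g) = Φ f + Φ g) (hΨa : ∀ f g, Ψ (f + g) = Ψ f + Ψ g)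
    (hΦm : ∀ f g, Φ (f * g) = ρ f * Φ g + ρ g * Φ f)
    (hΨm : ∀ f g, Ψ (f * g) = ρ f * Ψ g + ρ g * Ψ f)
    (hC : ∀ r, Φ (C r) = Ψ (C r)) (hX : ∀ i, Φ (X i) = Ψ (X i)) (f : MvPowerSeries σ ℂ) :
    Φ f = Ψ f := by
  refine hΦ.eq_of_polynomial hΨ (fun p => ?_) f
  induction p using MvPolynomial.induction_on with
  | C a => simpa using hC a
  | add p q hp hq => simp only [MvPolynomial.coe_add, hΦa, hΨa, hp, hq]
  | mul_X p i hp => simp only [MvPolynomial.coe_mul, hΦm, hΨm, hp, MvPolynomial.coe_X, hX]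

theorem algHom_eq_of_X {Φ Ψ : MvPowerSeries σ ℂ →ₐ[ℂ] MvPowerSeries τ ℂ} (hΦ : FinDet Φ)
    (hΨ : FinDet Ψ) (hX : ∀ i, Φ (X i) = Ψ (X i)) (f : MvPowerSeries σ ℂ) : Φ f = Ψ f := by
  refine hΦ.eq_of_polynomial hΨ (fun p => ?_) f
  induction p using MvPolynomial.induction_on with
  | C a =>
    have : ((MvPolynomial.C a : MvPolynomial σ ℂ) : MvPowerSeries σ ℂ) =
        algebraMap ℂ (MvPowerSeries σ ℂ) a := by simp [MvPowerSeries.algebraMap_apply]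
    rw [this, AlgHom.commutes, AlgHom.commutes]
  | add p q hp hq => simp only [MvPolynomial.coe_add, map_add, hp, hq]
  | mul_X p i hp => simp only [MvPolynomial.coe_mul, map_mul, hp, MvPolynomial.coe_X, hX]

theorem algHom_C (Φ : MvPowerSeries σ ℂ →ₐ[ℂ] MvPowerSeries τ ℂ) (r : ℂ) : Φ (C r) = C r := by
  have := Φ.commutes r
  simpa [MvPowerSeries.algebraMap_apply] using this

end FinDet

/-! ### Chain rule -/

section Chain

variable {σ : Type*}

theorem hasSubst_sub_one {f : MvPowerSeries σ ℂ} (h : constantCoeff f = 1) :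
    PowerSeries.HasSubst (f - 1) :=
  PowerSeries.HasSubst.of_constantCoeff_zero (by simp [h])

/-- As functions of `f`, both sides are derivations along `f ↦ f(a)`, so constants and the single
variable suffice. `PowerSeries` is used as `MvPowerSeries Unit`. -/
theorem pderiv_powerSeries_subst {a : MvPowerSeries σ ℂ} (ha : PowerSeries.HasSubst a) (i : σ)
    (f : PowerSeries ℂ) :
    pderiv ℂ i (PowerSeries.subst a f) =
      PowerSeries.subst a (PowerSeries.derivative ℂ f) * pderiv ℂ i a := by
  have h1 : FinDet (fun f : MvPowerSeries Unit ℂ => (PowerSeries.subst a f : MvPowerSeries σ ℂ)) :=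
    FinDet.subst ha.const
  refine eq_of_leibniz (σ := Unit) (Φ := fun f => pderiv ℂ i (PowerSeries.subst a f))
    (Ψ := fun f => PowerSeries.subst a (PowerSeries.derivative ℂ f) * pderiv ℂ i a)
    (ρ := fun f => PowerSeries.subst a f)
    ((FinDet.pderiv i).comp h1) ((h1.comp (FinDet.pderiv ())).mul (FinDet.const _))
    ?_ ?_ ?_ ?_ ?_ ?_ f
  · intro f g
    rw [PowerSeries.subst_add ha, map_add]
  · intro f g
    rw [map_add, PowerSeries.subst_add ha, add_mul]
  · intro f g
    rw [PowerSeries.subst_mul ha, Derivation.leibniz, smul_eq_mul, smul_eq_mul]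
  · intro f g
    rw [Derivation.leibniz, PowerSeries.subst_add ha, smul_eq_mul, smul_eq_mul,
      PowerSeries.subst_mul ha, PowerSeries.subst_mul ha]
    ring
  · intro r
    have e1 : PowerSeries.subst a (MvPowerSeries.C r : MvPowerSeries Unit ℂ) =
      (MvPowerSeries.C r : MvPowerSeries σ ℂ) := PowerSeries.subst_C (a := a) r
    have e2 : PowerSeries.derivative ℂ (MvPowerSeries.C r : MvPowerSeries Unit ℂ) = 0 :=
      PowerSeries.derivative_C
    have e3 : PowerSeries.subst a (0 : PowerSeries ℂ) = 0 := by
      rw [← PowerSeries.coe_substAlgHom ha, map_zero]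
    simp only [e1, e2, e3, pderiv_C, zero_mul]
  · intro u
    have e1 : PowerSeries.subst a (MvPowerSeries.X u : MvPowerSeries Unit ℂ) = a :=
      PowerSeries.subst_X ha
    have e2 : PowerSeries.derivative ℂ (MvPowerSeries.X u : MvPowerSeries Unit ℂ) = 1 :=
      PowerSeries.derivative_X
    have e3 : PowerSeries.subst a (1 : PowerSeries ℂ) = 1 := by
      rw [← PowerSeries.coe_substAlgHom ha, map_one]
    simp only [e1, e2, e3, one_mul]

theorem constantCoeff_powerSeries_subst {a : MvPowerSeries σ ℂ} (ha : constantCoeff a = 0)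
    (f : PowerSeries ℂ) :
    constantCoeff (PowerSeries.subst a f) = PowerSeries.constantCoeff f := by
  have hs := PowerSeries.HasSubst.of_constantCoeff_zero ha
  have h := PowerSeries.constantCoeff_subst_eq_zero ha (f - PowerSeries.C (PowerSeries.constantCoeff f))
    (by simp)
  rw [PowerSeries.subst_sub hs, PowerSeries.subst_C, map_sub, sub_eq_zero] at h
  simpa using h

/-- The power `f ^ α` of a series with constant coefficient `1`. -/
def pow' (f : MvPowerSeries σ ℂ) (α : ℂ) : MvPowerSeries σ ℂ :=
  PowerSeries.subst (f - 1) (PowerSeries.binomialSeries ℂ α)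

/-- Coefficientwise this is `(m+1) (α choose m+1) = (α - m) (α choose m)`. It gives `f ^ α` the
logarithmic derivative `α f'/f`. -/
theorem one_add_X_mul_derivative_binomialSeries (α : ℂ) :
    (1 + PowerSeries.X) * PowerSeries.derivative ℂ (PowerSeries.binomialSeries ℂ α) =
      PowerSeries.C α * PowerSeries.binomialSeries ℂ α := by
  ext n
  have key : ∀ m : ℕ, Ring.choose α (m + 1) * (m + 1) = Ring.choose α m * (α - m) := by
    intro m
    have h1 := Ring.descPochhammer_eq_factorial_smul_choose α (m + 1)
    have h2 := Ring.descPochhammer_eq_factorial_smul_choose α m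
    rw [descPochhammer_succ_right, Polynomial.smeval_mul, h2, Nat.factorial_succ] at h1
    have h3 : (Nat.factorial m : ℂ) ≠ 0 := by exact_mod_cast Nat.factorial_ne_zero m
    apply mul_left_cancel₀ h3
    simp [Polynomial.smeval_sub, Polynomial.smeval_X, Polynomial.smeval_natCast] at h1
    linear_combination -h1
  rw [add_mul, one_mul, map_add, PowerSeries.coeff_derivative, PowerSeries.coeff_C_mul]
  cases n with
  | zero =>
    have := key 0
    simp at this ⊢
  | succ n =>
    rw [PowerSeries.coeff_succ_X_mul, PowerSeries.coeff_derivative]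
    have h1 := key (n + 1)
    have h2 := key n
    simp only [PowerSeries.binomialSeries_coeff, smul_eq_mul, mul_one]
    push_cast at *
    linear_combination h1

theorem log_derivative_eq :
    (1 + PowerSeries.X) * PowerSeries.derivative ℂ (PowerSeries.log ℂ) = 1 := by
  rw [PowerSeries.deriv_log]
  ext n
  rw [add_mul, one_mul, map_add]
  cases n with
  | zero => simp
  | succ n => 
    rw [PowerSeries.coeff_succ_X_mul]
    simp [pow_succ]

theorem pderiv_pow' {f : MvPowerSeries σ ℂ} (h : constantCoeff f = 1) (i : σ) (α : ℂ) :
    pderiv ℂ i (pow' f α) * f = C α * pderiv ℂ i f * pow' f α := by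
  have hs := hasSubst_sub_one h
  have := congrArg (PowerSeries.subst (f - 1)) (one_add_X_mul_derivative_binomialSeries α)
  rw [PowerSeries.subst_mul hs, PowerSeries.subst_mul hs, PowerSeries.subst_add hs,
    PowerSeries.subst_X hs, PowerSeries.subst_C, ← PowerSeries.coe_substAlgHom hs, map_one,
    PowerSeries.coe_substAlgHom hs] at this
  rw [pow', pderiv_powerSeries_subst hs, map_sub, pderiv_one]
  linear_combination (pderiv ℂ i f) * this

theorem constantCoeff_pow' {f : MvPowerSeries σ ℂ} (h : constantCoeff f = 1) (α : ℂ) :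
    constantCoeff (pow' f α) = 1 := by
  rw [pow', constantCoeff_powerSeries_subst (by simp [h])]
  simp

/-- The logarithm of a series with constant coefficient `1`. -/
def log' (f : MvPowerSeries σ ℂ) : MvPowerSeries σ ℂ :=
  PowerSeries.subst (f - 1) (PowerSeries.log ℂ)

theorem pderiv_log' {f : MvPowerSeries σ ℂ} (h : constantCoeff f = 1) (i : σ) :
    pderiv ℂ i (log' f) * f = pderiv ℂ i f := by
  have hs := hasSubst_sub_one h
  have := congrArg (PowerSeries.subst (f - 1)) log_derivative_eq
  rw [PowerSeries.subst_mul hs, PowerSeries.subst_add hs,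
    PowerSeries.subst_X hs, ← PowerSeries.coe_substAlgHom hs, map_one,
    PowerSeries.coe_substAlgHom hs] at this
  rw [log', pderiv_powerSeries_subst hs, map_sub, pderiv_one]
  linear_combination (pderiv ℂ i f) * this

theorem constantCoeff_log' {f : MvPowerSeries σ ℂ} (h : constantCoeff f = 1) :
    constantCoeff (log' f) = 0 := by
  rw [log', constantCoeff_powerSeries_subst (by simp [h])]
  simp

/-- The exponential of a series with constant coefficient `0`. -/
def exp' (f : MvPowerSeries σ ℂ) : MvPowerSeries σ ℂ :=
  PowerSeries.subst f (PowerSeries.exp ℂ)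

theorem pderiv_exp' {f : MvPowerSeries σ ℂ} (h : constantCoeff f = 0) (i : σ) :
    pderiv ℂ i (exp' f) = pderiv ℂ i f * exp' f := by
  rw [exp', pderiv_powerSeries_subst (PowerSeries.HasSubst.of_constantCoeff_zero h),
    PowerSeries.derivative_exp, mul_comm]

theorem constantCoeff_exp' {f : MvPowerSeries σ ℂ} (h : constantCoeff f = 0) :
    constantCoeff (exp' f) = 1 := by
  rw [exp', constantCoeff_powerSeries_subst h]
  simp

theorem ne_zero_of_constantCoeff_eq_one {f : MvPowerSeries σ ℂ} (h : constantCoeff f = 1) :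
    f ≠ 0 := by
  rintro rfl
  simp at h

/-- Series with equal logarithmic derivatives are proportional. -/
theorem eq_of_logDeriv {f g : MvPowerSeries σ ℂ} (hf : constantCoeff f = 1)
    (hg : constantCoeff g = 1) (h : ∀ i, pderiv ℂ i f * g = f * pderiv ℂ i g) : f = g := by
  have hgi : g * g⁻¹ = 1 := MvPowerSeries.mul_inv_cancel g (by simp [hg])
  have : f * g⁻¹ = 1 := by
    refine pderiv.ext (fun i => ?_) ?_
    · rw [Derivation.leibniz, smul_eq_mul, smul_eq_mul, pderiv_inv', pderiv_one]
      linear_combination g⁻¹ ^ 2 * h i - (g⁻¹ * pderiv ℂ i f) * hgi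
    · simp [hf, hg]
  linear_combination g * this - f * hgi

theorem pow'_add {f : MvPowerSeries σ ℂ} (h : constantCoeff f = 1) (α β : ℂ) :
    pow' f (α + β) = pow' f α * pow' f β := by
  rw [pow', PowerSeries.binomialSeries_add, PowerSeries.subst_mul (hasSubst_sub_one h)]
  rfl

/-- This and the next two laws compare logarithmic derivatives through `eq_of_logDeriv`, both sides
having constant term `1`. -/
theorem pow'_zero {f : MvPowerSeries σ ℂ} (h : constantCoeff f = 1) : pow' f 0 = 1 := by
  refine eq_of_logDeriv (constantCoeff_pow' h 0) (by simp) fun i => ?_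
  have := pderiv_pow' h i 0
  have hf := ne_zero_of_constantCoeff_eq_one h
  simp only [map_zero, zero_mul, mul_eq_zero, hf, or_false] at this
  rw [this, pderiv_one]; ring

theorem pow'_one {f : MvPowerSeries σ ℂ} (h : constantCoeff f = 1) : pow' f 1 = f := by
  refine eq_of_logDeriv (constantCoeff_pow' h 1) h fun i => ?_
  rw [pderiv_pow' h, map_one]; ring

theorem mul_pow' {f g : MvPowerSeries σ ℂ} (hf : constantCoeff f = 1)
    (hg : constantCoeff g = 1) (α : ℂ) : pow' (f * g) α = pow' f α * pow' g α := by
  have hfg : constantCoeff (f * g) = 1 := by simp [hf, hg]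
  refine eq_of_logDeriv (constantCoeff_pow' hfg α)
    (by rw [map_mul, constantCoeff_pow' hf, constantCoeff_pow' hg, one_mul]) fun i => ?_
  have h1 := pderiv_pow' hfg i α
  have h2 := pderiv_pow' hf i α
  have h3 := pderiv_pow' hg i α
  have hne := ne_zero_of_constantCoeff_eq_one hfg
  apply mul_right_cancel₀ hne
  simp only [Derivation.leibniz, smul_eq_mul] at *
  linear_combination (pow' f α * pow' g α) * h1 - pow' (f * g) α * pow' f α * f * h3
    - pow' (f * g) α * pow' g α * g * h2

theorem algHom_powerSeries_subst {τ : Type*} {a : σ → MvPowerSeries τ ℂ} (ha : HasSubst a)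
    {f : MvPowerSeries σ ℂ} (hf : PowerSeries.HasSubst f) (p : PowerSeries ℂ) :
    substAlgHom (R := ℂ) ha (PowerSeries.subst f p) =
      PowerSeries.subst (substAlgHom (R := ℂ) ha f) p := by
  rw [coe_substAlgHom, PowerSeries.subst_def, PowerSeries.subst_def,
    subst_comp_subst_apply hf.const ha]

end Chain

theorem power_eq (f : MiwaSeries) (α : ℂ) : power f α = pow' f α := rfl

/-! ### Shifts as ring homomorphisms -/

theorem hasSubst_sumElim {σ₁ σ₂ τ : Type*} {a : σ₁ → MvPowerSeries τ ℂ}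
    {b : σ₂ → MvPowerSeries τ ℂ}
    (ha : HasSubst a) (hb : HasSubst b) : HasSubst (Sum.elim a b) where
  const_coeff s := by
    cases s with
    | inl s => exact ha.const_coeff s
    | inr s => exact hb.const_coeff s
  coeff_zero d := by
    refine (((ha.coeff_zero d).image Sum.inl).union ((hb.coeff_zero d).image Sum.inr)).subset ?_
    rintro (s | s) hs
    · exact Or.inl ⟨s, hs, rfl⟩
    · exact Or.inr ⟨s, hs, rfl⟩

theorem miwaArg_empty (n : ℕ) : miwaArg ∅ n = X (Sum.inl n) := by simp [miwaArg]

theorem hasSubst_params (b : Fin 2 → MiwaSeries) (hb : ∀ j, constantCoeff (b j) = 0) :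
    HasSubst b := hasSubst_of_constantCoeff_zero hb

/-- `f(t) ↦ f(t + ∑_{i ∈ L} 2[λ_i])` as a homomorphism. -/
def shiftHom (L : Finset (Fin 2)) : TimeSeries →ₐ[ℂ] MiwaSeries :=
  substAlgHom (hasSubst_miwaArg L)

theorem shift_eq (L : Finset (Fin 2)) (f : TimeSeries) : shift L f = shiftHom L f := by
  simp [shiftHom, shift]

theorem finDet_shiftHom (L : Finset (Fin 2)) : FinDet (shiftHom L) := FinDet.substAlgHom _

@[simp] theorem shiftHom_X (L : Finset (Fin 2)) (n : ℕ) : shiftHom L (X n) = miwaArg L n := by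
  rw [shiftHom, substAlgHom_X]

/-- The homomorphism with given values on `λ, μ` which shifts the times by `∑_{i ∈ L} 2[λ_i]`. -/
def miwaHom (L : Finset (Fin 2)) (b : Fin 2 → MiwaSeries) (hb : ∀ j, constantCoeff (b j) = 0) :
    MiwaSeries →ₐ[ℂ] MiwaSeries :=
  substAlgHom (hasSubst_sumElim (hasSubst_miwaArg L) (hasSubst_params b hb))

theorem finDet_miwaHom (L : Finset (Fin 2)) (b : Fin 2 → MiwaSeries)
    (hb : ∀ j, constantCoeff (b j) = 0) : FinDet (miwaHom L b hb) := FinDet.substAlgHom _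

@[simp] theorem miwaHom_time (L : Finset (Fin 2)) (b : Fin 2 → MiwaSeries)
    (hb : ∀ j, constantCoeff (b j) = 0) (n : ℕ) :
    miwaHom L b hb (X (Sum.inl n)) = miwaArg L n := by
  rw [miwaHom, substAlgHom_X, Sum.elim_inl]

@[simp] theorem miwaHom_param (L : Finset (Fin 2)) (b : Fin 2 → MiwaSeries)
    (hb : ∀ j, constantCoeff (b j) = 0) (j : Fin 2) :
    miwaHom L b hb (X (Sum.inr j)) = b j := by
  rw [miwaHom, substAlgHom_X, Sum.elim_inr]

/-- Shift of the times by `2[λ_i]`. -/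
def S (i : Fin 2) : MiwaSeries →ₐ[ℂ] MiwaSeries :=
  miwaHom {i} (fun j => X (Sum.inr j)) (by simp)

/-- Exchange of `λ` and `μ`. -/
def swapHom : MiwaSeries →ₐ[ℂ] MiwaSeries :=
  miwaHom ∅ (fun j => X (Sum.inr (Equiv.swap 0 1 j))) (by simp)

theorem finDet_S (i : Fin 2) : FinDet (S i) := finDet_miwaHom _ _ _
theorem finDet_swapHom : FinDet swapHom := finDet_miwaHom _ _ _

@[simp] theorem S_time (i : Fin 2) (n : ℕ) : S i (X (Sum.inl n)) = miwaArg {i} n := by simp [S]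
@[simp] theorem S_param (i j : Fin 2) : S i (X (Sum.inr j)) = X (Sum.inr j) := by simp [S]
@[simp] theorem swapHom_time (n : ℕ) : swapHom (X (Sum.inl n)) = X (Sum.inl n) := by
  simp [swapHom, miwaArg]
@[simp] theorem swapHom_param (j : Fin 2) :
    swapHom (X (Sum.inr j)) = X (Sum.inr (Equiv.swap 0 1 j)) := by simp [swapHom]

theorem miwaHom_comp_shiftHom {L : Finset (Fin 2)} {b : Fin 2 → MiwaSeries}
    {hb : ∀ j, constantCoeff (b j) = 0} {K K' : Finset (Fin 2)}
    (h : ∀ n, miwaHom L b hb (miwaArg K n) = miwaArg K' n) (f : TimeSeries) :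
    miwaHom L b hb (shiftHom K f) = shiftHom K' f := by
  have := algHom_eq_of_X (Φ := (miwaHom L b hb).comp (shiftHom K)) (Ψ := shiftHom K')
    ((finDet_miwaHom L b hb).comp (finDet_shiftHom K)) (finDet_shiftHom K')
    (fun n => by simp [h]) f
  simpa using this

/-- For `i ∈ L` the left side would shift by `2[λ_i]` twice, whereas `insert i L` would still be
`L`. -/
theorem S_shiftHom {i : Fin 2} {L : Finset (Fin 2)} (h : i ∉ L) (f : TimeSeries) :
    S i (shiftHom L f) = shiftHom (insert i L) f := by
  refine miwaHom_comp_shiftHom (fun n => ?_) f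
  have : ∀ r : ℂ, miwaHom {i} (fun j => X (Sum.inr j)) (by simp) (C r) = C r :=
    algHom_C _
  simp only [miwaArg, map_add, map_sum, map_mul, map_pow, this, miwaHom_param, miwaHom_time,
    Finset.sum_insert h, Finset.sum_singleton]
  ring

theorem swapHom_shiftHom (L : Finset (Fin 2)) (f : TimeSeries) :
    swapHom (shiftHom L f) = shiftHom (L.image (Equiv.swap 0 1)) f := by
  refine miwaHom_comp_shiftHom (fun n => ?_) f
  simp only [miwaArg, map_add, map_sum, map_mul, map_pow, algHom_C, miwaHom_param, miwaHom_time,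
    Finset.sum_empty, add_zero]
  rw [Finset.sum_image (fun _ _ _ _ h => (Equiv.injective _) h)]

/-- The derivative with respect to the time `t_{2n+1}`. -/
abbrev dTime (n : ℕ) : Derivation ℂ MiwaSeries MiwaSeries := pderiv ℂ (Sum.inl n)

/-- The derivative with respect to `λ_i`. -/
abbrev dParam (i : Fin 2) : Derivation ℂ MiwaSeries MiwaSeries := pderiv ℂ (Sum.inr i)

theorem dOne_eq (f : MiwaSeries) : dOne f = dTime 0 f := rfl

theorem dTime_miwaArg (n m : ℕ) (L : Finset (Fin 2)) :
    dTime n (miwaArg L m) = if m = n then 1 else 0 := by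
  classical
  have h : ∀ j : Fin 2, dTime n (X (Sum.inr j) : MiwaSeries) = 0 := fun j =>
    pderiv_X_of_ne (by simp)
  simp only [miwaArg, map_add, map_sum, Derivation.leibniz, Derivation.leibniz_pow, h, pderiv_C,
    smul_zero, add_zero, Finset.sum_const_zero]
  split_ifs with h1
  · subst h1; simp
  · exact pderiv_X_of_ne (by simpa using h1)

theorem derivation_algHom_comm {σ τ : Type*} {Φ : MvPowerSeries σ ℂ →ₐ[ℂ] MvPowerSeries τ ℂ}
    (hΦ : FinDet Φ) {s : τ} {s' : σ} (h : ∀ i, pderiv ℂ s (Φ (X i)) = Φ (pderiv ℂ s' (X i)))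
    (f : MvPowerSeries σ ℂ) : pderiv ℂ s (Φ f) = Φ (pderiv ℂ s' f) := by
  refine eq_of_leibniz (Φ := fun f => pderiv ℂ s (Φ f)) (Ψ := fun f => Φ (pderiv ℂ s' f)) (ρ := Φ)
    ((FinDet.pderiv s).comp hΦ) (hΦ.comp (FinDet.pderiv s')) ?_ ?_ ?_ ?_ ?_ h f
  · simp
  · simp
  · intro f g; simp
  · intro f g; simp
  · intro r; simp only [algHom_C, pderiv_C, map_zero]

theorem dTime_shiftHom (n : ℕ) (L : Finset (Fin 2)) (f : TimeSeries) :
    dTime n (shiftHom L f) = shiftHom L (pderiv ℂ n f) := by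
  classical
  refine derivation_algHom_comm (finDet_shiftHom L) (fun m => ?_) f
  rw [shiftHom_X, dTime_miwaArg]
  split_ifs with h
  · subst h; simp
  · rw [pderiv_X_of_ne h, map_zero]

theorem dTime_miwaHom {L : Finset (Fin 2)} {b : Fin 2 → MiwaSeries}
    {hb : ∀ j, constantCoeff (b j) = 0} {n : ℕ} (h : ∀ j, dTime n (b j) = 0) (f : MiwaSeries) :
    dTime n (miwaHom L b hb f) = miwaHom L b hb (dTime n f) := by
  classical
  refine derivation_algHom_comm (finDet_miwaHom L b hb) ?_ f
  rintro (m | j)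
  · rw [miwaHom_time, dTime_miwaArg]
    split_ifs with h
    · subst h; simp
    · rw [pderiv_X_of_ne (by simpa using h), map_zero]
  · rw [miwaHom_param, h, pderiv_X_of_ne (by simp), map_zero]

@[simp] theorem dTime_X_param (n : ℕ) (j : Fin 2) : dTime n (X (Sum.inr j) : MiwaSeries) = 0 :=
  pderiv_X_of_ne (by simp)
@[simp] theorem dTime_lam (n : ℕ) : dTime n lam = 0 := dTime_X_param n 0
@[simp] theorem dTime_mu (n : ℕ) : dTime n mu = 0 := dTime_X_param n 1

theorem dTime_S (n : ℕ) (i : Fin 2) (f : MiwaSeries) : dTime n (S i f) = S i (dTime n f) :=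
  dTime_miwaHom (by simp) f
theorem dTime_swapHom (n : ℕ) (f : MiwaSeries) : dTime n (swapHom f) = swapHom (dTime n f) :=
  dTime_miwaHom (by simp) f

theorem dParam_shiftHom {i : Fin 2} {L : Finset (Fin 2)} (h : i ∉ L) (f : TimeSeries) :
    dParam i (shiftHom L f) = 0 := by
  have hX : ∀ n, dParam i (miwaArg L n) = 0 := by
    intro n
    simp only [miwaArg, map_add, map_sum, Derivation.leibniz, Derivation.leibniz_pow, pderiv_C,
      smul_zero, add_zero]
    rw [pderiv_X_of_ne (by simp), Finset.sum_eq_zero, add_zero]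
    intro j hj
    rw [pderiv_X_of_ne (by rintro ⟨⟩; exact h hj)]
    simp
  refine eq_of_leibniz (Φ := fun f => dParam i (shiftHom L f)) (Ψ := fun _ => 0)
    (ρ := shiftHom L) ((FinDet.pderiv _).comp (finDet_shiftHom L)) (FinDet.const 0)
    (by simp) (by simp) (fun f g => by simp) (by simp) (fun r => ?_) (fun n => ?_) f
  · simp only [algHom_C, pderiv_C]
  · simp only [shiftHom_X, hX]

theorem dParam_S_of_ne {i j : Fin 2} (h : i ≠ j) (f : MiwaSeries) :
    dParam i (S j f) = S j (dParam i f) := by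
  classical
  refine derivation_algHom_comm (finDet_S j) ?_ f
  rintro (n | l)
  · rw [S_time, pderiv_X_of_ne (by simp), map_zero, ← shiftHom_X, dParam_shiftHom (by simpa using h)]
  · rw [S_param]
    by_cases hl : l = i
    · subst hl; simp
    · rw [pderiv_X_of_ne (by simpa using hl), map_zero]

/-! ### Coefficients with respect to one parameter -/

/-- The indeterminate `λ_i`. -/
abbrev par (i : Fin 2) : MiwaSeries := X (Sum.inr i)

/-- The series does not contain `λ_i`. -/
def Free (i : Fin 2) (a : MiwaSeries) : Prop := dParam i a = 0

theorem free_iff {i : Fin 2} {a : MiwaSeries} :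
    Free i a ↔ ∀ e : ℕ ⊕ Fin 2 →₀ ℕ, e (Sum.inr i) ≠ 0 → coeff e a = 0 := by
  constructor
  · intro h e he
    have h1 := congrArg (coeff (e - single (Sum.inr i) 1)) h
    rw [coeff_pderiv, map_zero, tsub_add_cancel_of_le] at h1
    · exact (mul_eq_zero.1 h1).resolve_right (Nat.cast_add_one_ne_zero _)
    · rw [single_le_iff]; omega
  · intro h
    ext e
    rw [coeff_pderiv, h _ (by simp), zero_mul, map_zero]

theorem Free.add {i : Fin 2} {a b : MiwaSeries} (ha : Free i a) (hb : Free i b) :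
    Free i (a + b) := by
  unfold Free at *; rw [map_add, ha, hb, add_zero]

theorem Free.sub {i : Fin 2} {a b : MiwaSeries} (ha : Free i a) (hb : Free i b) :
    Free i (a - b) := by
  unfold Free at *; rw [map_sub, ha, hb, sub_zero]

theorem Free.mul {i : Fin 2} {a b : MiwaSeries} (ha : Free i a) (hb : Free i b) :
    Free i (a * b) := by
  unfold Free at *; rw [Derivation.leibniz, ha, hb, smul_zero, smul_zero, add_zero]

theorem Free.C (i : Fin 2) (r : ℂ) : Free i (C r) := pderiv_C

theorem Free.one (i : Fin 2) : Free i 1 := pderiv_one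

theorem Free.par {i j : Fin 2} (h : j ≠ i) : Free i (par j) := pderiv_X_of_ne (by simpa using h)

theorem Free.sum {i : Fin 2} {ι : Type*} {s : Finset ι} {a : ι → MiwaSeries}
    (h : ∀ j ∈ s, Free i (a j)) : Free i (∑ j ∈ s, a j) := by
  unfold Free at *; rw [map_sum, Finset.sum_eq_zero h]

theorem pderiv_comm {σ : Type*} (s t : σ) (a : MvPowerSeries σ ℂ) :
    pderiv ℂ s (pderiv ℂ t a) = pderiv ℂ t (pderiv ℂ s a) := by
  classical
  by_cases h : s = t
  · rw [h]
  · ext e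
    simp only [coeff_pderiv, Finsupp.add_apply, single_eq_of_ne h, single_eq_of_ne (Ne.symm h),
      add_zero]
    rw [add_right_comm]
    ring

theorem Free.dTime {i : Fin 2} {a : MiwaSeries} (ha : Free i a) (n : ℕ) :
    Free i (dTime n a) := by
  unfold Free at *; rw [pderiv_comm, ha, map_zero]

theorem Free.S {i j : Fin 2} {a : MiwaSeries} (h : i ≠ j) (ha : Free i a) : Free i (S j a) := by
  unfold Free at *; rw [dParam_S_of_ne h, ha, map_zero]

theorem free_shiftHom {i : Fin 2} {L : Finset (Fin 2)} (h : i ∉ L) (f : TimeSeries) :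
    Free i (shiftHom L f) := dParam_shiftHom h f

/-- The coefficient of `λ_i ^ j`, as a series which does not contain `λ_i`. -/
def cf (i : Fin 2) (j : ℕ) : MiwaSeries →ₗ[ℂ] MiwaSeries where
  toFun a := fun e => if e (Sum.inr i) = 0 then coeff (e + single (Sum.inr i) j) a else 0
  map_add' a b := by
    funext e
    show (if e (Sum.inr i) = 0 then coeff (e + single (Sum.inr i) j) (a + b) else 0) =
      (if e (Sum.inr i) = 0 then coeff (e + single (Sum.inr i) j) a else 0) +
      (if e (Sum.inr i) = 0 then coeff (e + single (Sum.inr i) j) b else 0)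
    split_ifs <;> simp
  map_smul' r a := by
    funext e
    show (if e (Sum.inr i) = 0 then coeff (e + single (Sum.inr i) j) (r • a) else 0) =
      r * (if e (Sum.inr i) = 0 then coeff (e + single (Sum.inr i) j) a else 0)
    split_ifs <;> simp

theorem coeff_cf (i : Fin 2) (j : ℕ) (a : MiwaSeries) (e : ℕ ⊕ Fin 2 →₀ ℕ) :
    coeff e (cf i j a) = if e (Sum.inr i) = 0 then coeff (e + single (Sum.inr i) j) a else 0 := rfl

theorem free_cf (i : Fin 2) (j : ℕ) (a : MiwaSeries) : Free i (cf i j a) :=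
  free_iff.2 fun e he => by rw [coeff_cf, if_neg he]

theorem ext_cf {i : Fin 2} {a b : MiwaSeries} (h : ∀ j, cf i j a = cf i j b) : a = b := by
  ext e
  have h1 := congrArg (coeff (e.erase (Sum.inr i))) (h (e (Sum.inr i)))
  rw [coeff_cf, coeff_cf, if_pos (by simp), if_pos (by simp), erase_add_single] at h1
  exact h1

theorem cf_zero_of_free {i : Fin 2} {a : MiwaSeries} (ha : Free i a) : cf i 0 a = a := by
  ext e
  rw [coeff_cf]
  split_ifs with h
  · simp
  · exact (free_iff.1 ha e h).symm

theorem cf_of_free {i : Fin 2} {a : MiwaSeries} (ha : Free i a) {j : ℕ} (hj : j ≠ 0) :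
    cf i j a = 0 := by
  ext e
  rw [coeff_cf]
  split_ifs with h
  · rw [free_iff.1 ha _ (by simp [hj]), map_zero]
  · simp

theorem cf_par_pow_mul (i : Fin 2) (j k : ℕ) (a : MiwaSeries) :
    cf i j (par i ^ k * a) = if k ≤ j then cf i (j - k) a else 0 := by
  ext e
  rw [coeff_cf, X_pow_eq, coeff_monomial_mul]
  simp only [single_le_iff]
  by_cases h : e (Sum.inr i) = 0
  · simp only [h, if_true, Finsupp.add_apply, single_eq_same, zero_add, one_mul]
    split_ifs with hk
    · rw [coeff_cf, if_pos h]
      congr 2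
      ext s
      by_cases hs : s = Sum.inr i
      · subst hs; simp [h]
      · simp [single_eq_of_ne hs]
    · simp
  · simp only [h, if_false]
    split_ifs
    · rw [coeff_cf, if_neg h]
    · simp

theorem cf_succ_par_mul (i : Fin 2) (j : ℕ) (a : MiwaSeries) :
    cf i (j + 1) (par i * a) = cf i j a := by
  have := cf_par_pow_mul i (j + 1) 1 a
  simpa using this

theorem cf_zero_par_mul (i : Fin 2) (a : MiwaSeries) : cf i 0 (par i * a) = 0 := by
  have := cf_par_pow_mul i 0 1 a
  simpa using this

/-- Division with remainder by `λ_i`; it is the induction step for the multiplicative properties of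
`cf`. -/
theorem exists_eq_add_par_mul (i : Fin 2) (a : MiwaSeries) :
    ∃ b, a = cf i 0 a + par i * b ∧ ∀ j, cf i j b = cf i (j + 1) a := by
  have h : par i ∣ a - cf i 0 a := by
    rw [X_dvd_iff]
    intro e he
    rw [map_sub, coeff_cf, if_pos he]
    simp
  obtain ⟨b, hb⟩ := h
  refine ⟨b, by rw [← hb]; ring, fun j => ?_⟩
  rw [← cf_succ_par_mul, ← hb, map_sub, cf_of_free (free_cf i 0 a) (Nat.succ_ne_zero j), sub_zero]

theorem cf_free_mul {i : Fin 2} {a : MiwaSeries} (ha : Free i a) (j : ℕ) (b : MiwaSeries) :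
    cf i j (a * b) = a * cf i j b := by
  induction j generalizing b with
  | zero =>
    obtain ⟨c, hc, -⟩ := exists_eq_add_par_mul i b
    conv_lhs => rw [hc]
    rw [mul_add, map_add, cf_zero_of_free (ha.mul (free_cf i 0 b)), mul_left_comm,
      cf_zero_par_mul, add_zero]
  | succ j ih =>
    obtain ⟨c, hc, hj⟩ := exists_eq_add_par_mul i b
    conv_lhs => rw [hc]
    rw [mul_add, map_add, cf_of_free (ha.mul (free_cf i 0 b)) (Nat.succ_ne_zero j), mul_left_comm,
      cf_succ_par_mul, zero_add, ih, hj]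

theorem cf_zero_mul (i : Fin 2) (a b : MiwaSeries) : cf i 0 (a * b) = cf i 0 a * cf i 0 b := by
  obtain ⟨c, hc, -⟩ := exists_eq_add_par_mul i a
  conv_lhs => rw [hc]
  rw [add_mul, map_add, mul_assoc, cf_zero_par_mul, add_zero, cf_free_mul (free_cf _ _ _)]

theorem cf_pderiv {i : Fin 2} {s : ℕ ⊕ Fin 2} (hs : s ≠ Sum.inr i) (j : ℕ) (a : MiwaSeries) :
    cf i j (pderiv ℂ s a) = pderiv ℂ s (cf i j a) := by
  ext e
  rw [coeff_cf, coeff_pderiv, coeff_pderiv, coeff_cf]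
  simp only [Finsupp.add_apply, single_eq_of_ne hs, single_eq_of_ne (Ne.symm hs), add_zero]
  split_ifs
  · rw [add_right_comm]
  · simp

theorem cf_dTime (i : Fin 2) (n j : ℕ) (a : MiwaSeries) :
    cf i j (dTime n a) = dTime n (cf i j a) := cf_pderiv (by simp) j a

theorem cf_par_mul_dParam (i : Fin 2) (j : ℕ) (a : MiwaSeries) :
    cf i j (par i * dParam i a) = j * cf i j a := by
  cases j with
  | zero => rw [cf_zero_par_mul]; simp
  | succ j =>
    rw [cf_succ_par_mul]
    ext e
    have : ((j + 1 : ℕ) : MiwaSeries) = MvPowerSeries.C ((j + 1 : ℕ) : ℂ) := by simp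
    rw [this, MvPowerSeries.coeff_C_mul, coeff_cf, coeff_cf]
    split_ifs with h
    · rw [coeff_pderiv, add_assoc, ← single_add]
      simp [h]; ring
    · simp

/-! ### The Euler field of a shift -/

/-- Chain rule: `λ ∂_λ` applied to `t_{2n+1} + 2λ^{2n+1}/(2n+1)` gives `2λ^{2n+1}`. The full sum
over `n` is infinite, so the identity is stated modulo `λ_i^{2N+1}`, which suffices for any given
coefficient. -/
theorem par_pow_dvd_euler (i : Fin 2) (N : ℕ) (a : MiwaSeries) :
    par i ^ (2 * N + 1) ∣ par i * dParam i (S i a) - par i * S i (dParam i a)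
      - 2 * ∑ n ∈ Finset.range N, par i ^ (2 * n + 1) * S i (dTime n a) := by
  classical
  let Δ : MiwaSeries → MiwaSeries := fun a => par i * dParam i (S i a) - par i * S i (dParam i a)
      - 2 * ∑ n ∈ Finset.range N, par i ^ (2 * n + 1) * S i (dTime n a)
  have hΔ : FinDet Δ := by
    refine (((FinDet.const _).mul ((FinDet.pderiv _).comp (finDet_S i))).sub
      ((FinDet.const _).mul ((finDet_S i).comp (FinDet.pderiv _)))).sub
      ((FinDet.const _).mul (FinDet.sum _ fun n =>
        (FinDet.const _).mul ((finDet_S i).comp (FinDet.pderiv _))))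
  have hadd : ∀ a b, Δ (a + b) = Δ a + Δ b := by
    intro a b
    simp only [Δ, map_add, mul_add, Finset.sum_add_distrib]
    ring
  -- The defect is a derivation along `S i`, so divisibility passes from the variables to
  -- polynomials.
  have hmul : ∀ a b, Δ (a * b) = S i a * Δ b + S i b * Δ a := by
    intro a b
    simp only [Δ, map_mul, Derivation.leibniz, smul_eq_mul, map_add, mul_add,
      Finset.sum_add_distrib]
    have e : ∀ a b : MiwaSeries, ∑ n ∈ Finset.range N, par i ^ (2 * n + 1) * (S i a * S i (dTime n b))
        = S i a * ∑ n ∈ Finset.range N, par i ^ (2 * n + 1) * S i (dTime n b) := by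
      intro a b
      rw [Finset.mul_sum]
      exact Finset.sum_congr rfl fun n _ => by ring
    rw [e, e]
    ring
  have hpoly : ∀ p : MvPolynomial (ℕ ⊕ Fin 2) ℂ, par i ^ (2 * N + 1) ∣ Δ p := by
    intro p
    induction p using MvPolynomial.induction_on with
    | C r => 
      have : Δ ((MvPolynomial.C r : MvPolynomial (ℕ ⊕ Fin 2) ℂ) : MiwaSeries) = 0 := by
        simp [Δ, algHom_C]
      rw [this]; exact dvd_zero _
    | add p q hp hq => rw [MvPolynomial.coe_add, hadd]; exact dvd_add hp hq
    | mul_X p s hp =>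
      rw [MvPolynomial.coe_mul, MvPolynomial.coe_X, hmul]
      refine dvd_add (Dvd.dvd.mul_left ?_ _) (hp.mul_left _)
      rcases s with m | j
      · have h1 : dParam i (S i (X (Sum.inl m))) = 
            C (2 / (2 * m + 1) : ℂ) * ((2 * (m : MiwaSeries) + 1) * par i ^ (2 * m)) := by
          rw [S_time, miwaArg, Finset.sum_singleton, map_add, Derivation.leibniz, pderiv_C,
            Derivation.leibniz_pow, pderiv_X_self, pderiv_X_of_ne (by simp)]
          simp
        have h2 : (C (2 / (2 * m + 1) : ℂ) * (2 * (m : MiwaSeries) + 1)) = 2 := by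
          have h3 : (2 * m + 1 : ℂ) ≠ 0 := by exact_mod_cast Nat.succ_ne_zero (2 * m)
          have : (2 * (m : MiwaSeries) + 1) = C (2 * m + 1 : ℂ) := by
            rw [map_add, map_mul, map_ofNat, map_natCast, map_one]
          rw [this, ← map_mul, div_mul_cancel₀ _ h3, map_ofNat]
        have h4 : ∀ n, S i (dTime n (X (Sum.inl m))) = if m = n then 1 else 0 := by
          intro n
          split_ifs with h
          · subst h; simp
          · rw [pderiv_X_of_ne (by simpa using h), map_zero]
        -- For `m < N` the truncated sum contains the cancelling term; otherwise the uncancelled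
        -- `2λ_i^{2m+1}` is itself divisible.
        have h5 : Δ (X (Sum.inl m)) = if m < N then 0 else par i ^ (2 * N + 1) *
            (2 * par i ^ (2 * m - 2 * N)) := by
          simp only [Δ, h1, h4, mul_ite, mul_one, mul_zero, Finset.sum_ite_eq, Finset.mem_range]
          rw [pderiv_X_of_ne (by simp), map_zero, mul_zero, sub_zero]
          split_ifs with h
          · linear_combination par i ^ (2 * m + 1) * h2
          · rw [mul_left_comm (par i ^ (2 * N + 1)), ← pow_add]
            have : 2 * N + 1 + (2 * m - 2 * N) = 2 * m + 1 := by omega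
            rw [this]
            linear_combination par i ^ (2 * m + 1) * h2
        rw [h5]
        split_ifs
        · exact dvd_zero _
        · exact dvd_mul_right _ _
      · have : Δ (X (Sum.inr j)) = 0 := by
          simp only [Δ, S_param, dTime_X_param, map_zero, mul_zero, Finset.sum_const_zero, sub_zero]
          by_cases h : j = i
          · subst h; simp
          · rw [pderiv_X_of_ne (by simpa using h)]; simp
        rw [this]; exact dvd_zero _
  change _ ∣ Δ a
  rw [X_pow_dvd_iff]
  intro e he
  have := hΔ.coeff_eq (FinDet.const 0) e (fun p => ?_) a
  · rw [this, map_zero]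
  · rw [X_pow_dvd_iff.1 (hpoly p) e he, map_zero]

/-- Recursion for the coefficients of a shifted series. -/
theorem natCast_mul_cf_S {i : Fin 2} {a : MiwaSeries} (ha : Free i a) {j N : ℕ}
    (hj : j ≤ 2 * N) : j * cf i j (S i a) = 2 * ∑ n ∈ Finset.range N,
      if 2 * n + 1 ≤ j then cf i (j - (2 * n + 1)) (S i (dTime n a)) else 0 := by
  obtain ⟨b, hb⟩ := par_pow_dvd_euler i N a
  have h1 := congrArg (cf i j) hb
  rw [ha, map_zero, mul_zero, sub_zero, map_sub, cf_par_mul_dParam, cf_par_pow_mul,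
    if_neg (by omega), sub_eq_zero] at h1
  have h2 : (2 : MiwaSeries) = C 2 := (map_ofNat C 2).symm
  rw [h1, h2, cf_free_mul (Free.C i 2), map_sum]
  congr 1
  exact Finset.sum_congr rfl fun n _ => by rw [cf_par_pow_mul]

theorem cf_zero_S {i : Fin 2} {a : MiwaSeries} (ha : Free i a) : cf i 0 (S i a) = a := by
  have key : ∀ a, cf i 0 (S i a) = cf i 0 a := by
    intro a
    refine FinDet.eq_of_polynomial (Φ := fun a => cf i 0 (S i a)) (Ψ := cf i 0) ?_ ?_ ?_ a
    · refine FinDet.comp ?_ (finDet_S i)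
      exact fun e => ⟨{e + single (Sum.inr i) 0}, fun f g h => by
        rw [coeff_cf, coeff_cf, h _ (by simp)]⟩
    · exact fun e => ⟨{e + single (Sum.inr i) 0}, fun f g h => by
        rw [coeff_cf, coeff_cf, h _ (by simp)]⟩
    · intro p
      induction p using MvPolynomial.induction_on with
      | C r => simp [algHom_C]
      | add p q hp hq => simp only [MvPolynomial.coe_add, map_add, hp, hq]
      | mul_X p s hp =>
        rw [MvPolynomial.coe_mul, MvPolynomial.coe_X, map_mul, cf_zero_mul, cf_zero_mul, hp]
        congr 1
        rcases s with m | j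
        · rw [S_time, miwaArg, Finset.sum_singleton, map_add, mul_comm, pow_succ', mul_assoc,
            cf_zero_par_mul, add_zero]
        · rw [S_param]
  rw [key, cf_zero_of_free ha]

/-! ### Evaluation of `∑ c_n z^{-n}` at `z^{-1} = λ_i` -/

theorem eq_of_forall_par_pow_dvd {i : Fin 2} {a b : MiwaSeries}
    (h : ∀ N, par i ^ N ∣ a - b) : a = b := by
  ext e
  have := X_pow_dvd_iff.1 (h (e (Sum.inr i) + 1)) e (Nat.lt_succ_self _)
  rwa [map_sub, sub_eq_zero] at this

/-- `a = ∑ c_n λ_i ^ n`. -/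
def IsEval (i : Fin 2) (c : PowerSeries MiwaSeries) (a : MiwaSeries) : Prop :=
  ∀ N, par i ^ N ∣ a - ∑ m ∈ Finset.range N, par i ^ m * PowerSeries.coeff m c

theorem IsEval.unique {i : Fin 2} {c : PowerSeries MiwaSeries} {a b : MiwaSeries}
    (ha : IsEval i c a) (hb : IsEval i c b) : a = b :=
  eq_of_forall_par_pow_dvd (i := i) fun N => by
    have := dvd_sub (ha N) (hb N)
    rwa [sub_sub_sub_cancel_right] at this

/-- `∑ c_n λ_i ^ n`. -/
def evalFun (i : Fin 2) (c : PowerSeries MiwaSeries) : MiwaSeries := fun e =>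
  coeff e (∑ m ∈ Finset.range (e (Sum.inr i) + 1), par i ^ m * PowerSeries.coeff m c)

theorem isEval_evalFun (i : Fin 2) (c : PowerSeries MiwaSeries) : IsEval i c (evalFun i c) := by
  intro N
  rw [X_pow_dvd_iff]
  intro e he
  rw [map_sub, sub_eq_zero]
  change coeff e (∑ m ∈ Finset.range (e (Sum.inr i) + 1), _) = _
  rw [map_sum, map_sum]
  refine Finset.sum_subset (Finset.range_mono he) fun m _ hm => ?_
  rw [Finset.mem_range, not_lt] at hm
  exact X_pow_dvd_iff.1 (dvd_mul_right (par i ^ m) _) e hm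

theorem evalFun_eq {i : Fin 2} {c : PowerSeries MiwaSeries} {a : MiwaSeries} (h : IsEval i c a) :
    evalFun i c = a := (isEval_evalFun i c).unique h

theorem evalFun_add (i : Fin 2) (c d : PowerSeries MiwaSeries) :
    evalFun i (c + d) = evalFun i c + evalFun i d := by
  refine evalFun_eq fun N => ?_
  have := dvd_add (isEval_evalFun i c N) (isEval_evalFun i d N)
  convert this using 1
  simp only [map_add, mul_add, Finset.sum_add_distrib]
  ring

theorem evalFun_C_mul (i : Fin 2) (a : MiwaSeries) (c : PowerSeries MiwaSeries) :
    evalFun i (PowerSeries.C a * c) = a * evalFun i c := by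
  refine evalFun_eq fun N => ?_
  have := (isEval_evalFun i c N).mul_left a
  convert this using 1
  rw [mul_sub, Finset.mul_sum]
  congr 1
  refine Finset.sum_congr rfl fun m _ => ?_
  rw [PowerSeries.coeff_C_mul]; ring

theorem evalFun_X_mul (i : Fin 2) (c : PowerSeries MiwaSeries) :
    evalFun i (PowerSeries.X * c) = par i * evalFun i c := by
  refine evalFun_eq fun N => ?_
  cases N with
  | zero => simp
  | succ N =>
    have := mul_dvd_mul_left (par i) (isEval_evalFun i c N)
    rw [← pow_succ'] at this
    convert this using 1
    rw [Finset.sum_range_succ', mul_sub, Finset.mul_sum, PowerSeries.coeff_zero_X_mul, mul_zero,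
      add_zero]
    congr 1
    refine Finset.sum_congr rfl fun m _ => ?_
    rw [PowerSeries.coeff_succ_X_mul]; ring

theorem evalFun_one (i : Fin 2) : evalFun i 1 = 1 := by
  refine evalFun_eq fun N => ?_
  cases N with
  | zero => simp
  | succ N =>
    rw [Finset.sum_range_succ', Finset.sum_eq_zero]
    · simp
    · intro m _
      rw [PowerSeries.coeff_one, if_neg (Nat.succ_ne_zero m), mul_zero]

theorem evalFun_mul (i : Fin 2) (c d : PowerSeries MiwaSeries) :
    evalFun i (c * d) = evalFun i c * evalFun i d := by
  refine eq_of_forall_par_pow_dvd (i := i) fun N => ?_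
  -- Writing `c = c₀ + X c'`, the constant part contributes no error and the factor `λ_i` from `X`
  -- gains one order of divisibility.
  induction N generalizing c with
  | zero => simp
  | succ N ih =>
    have hc := PowerSeries.eq_X_mul_shift_add_const c
    obtain ⟨q, hq⟩ := ih (PowerSeries.mk fun n => PowerSeries.coeff (n + 1) c)
    refine ⟨q, ?_⟩
    have h1 : evalFun i c = par i * evalFun i (PowerSeries.mk fun n => PowerSeries.coeff (n + 1) c)
        + PowerSeries.constantCoeff c := by
      conv_lhs => rw [hc]
      rw [evalFun_add, evalFun_X_mul]
      congr 1
      have := evalFun_C_mul i (PowerSeries.constantCoeff c) 1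
      rwa [mul_one, evalFun_one, mul_one] at this
    have h2 : evalFun i (c * d) = par i * evalFun i
        ((PowerSeries.mk fun n => PowerSeries.coeff (n + 1) c) * d)
        + PowerSeries.constantCoeff c * evalFun i d := by
      conv_lhs => rw [hc]
      rw [add_mul, evalFun_add, mul_assoc, evalFun_X_mul, evalFun_C_mul]
    rw [h1, h2, pow_succ]
    linear_combination par i * hq

/-- The homomorphism `∑ c_n z^{-n} ↦ ∑ c_n λ_i ^ n`. -/
def ev (i : Fin 2) : PowerSeries MiwaSeries →+* MiwaSeries where
  toFun := evalFun i
  map_one' := evalFun_one i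
  map_mul' := evalFun_mul i
  map_zero' := by
    have := evalFun_C_mul i 0 0
    simpa using this
  map_add' := evalFun_add i

theorem isEval_ev (i : Fin 2) (c : PowerSeries MiwaSeries) : IsEval i c (ev i c) :=
  isEval_evalFun i c

theorem ev_eq {i : Fin 2} {c : PowerSeries MiwaSeries} {a : MiwaSeries} (h : IsEval i c a) :
    ev i c = a := evalFun_eq h

theorem ev_X_mul (i : Fin 2) (c : PowerSeries MiwaSeries) :
    ev i (PowerSeries.X * c) = par i * ev i c := evalFun_X_mul i c

theorem ev_C (i : Fin 2) (a : MiwaSeries) : ev i (PowerSeries.C a) = a := by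
  have := evalFun_C_mul i a 1
  rw [mul_one, evalFun_one, mul_one] at this
  exact this

/-- The series with the first coefficient dropped. -/
def tail {A : Type*} [CommRing A] (c : PowerSeries A) : PowerSeries A :=
  PowerSeries.mk fun n => PowerSeries.coeff (n + 1) c

theorem ev_eq_tail (i : Fin 2) (c : PowerSeries MiwaSeries) :
    ev i c = PowerSeries.coeff 0 c + par i * ev i (tail c) := by
  conv_lhs => rw [PowerSeries.eq_X_mul_shift_add_const c]
  rw [map_add, ev_X_mul, ev_C, add_comm]
  simp [tail]

theorem constantCoeff_ev (i : Fin 2) (c : PowerSeries MiwaSeries) :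
    constantCoeff (ev i c) = constantCoeff (PowerSeries.coeff 0 c) := by
  rw [ev_eq_tail]; simp

theorem algHom_ev {Φ : MiwaSeries →ₐ[ℂ] MiwaSeries} {i j : Fin 2} (h : Φ (par i) = par j)
    (c : PowerSeries MiwaSeries) :
    Φ (ev i c) = ev j (PowerSeries.map (Φ : MiwaSeries →+* MiwaSeries) c) := by
  refine (ev_eq fun N => ?_).symm
  obtain ⟨q, hq⟩ := isEval_ev i c N
  refine ⟨Φ q, ?_⟩
  have := congrArg Φ hq
  simp only [map_sub, map_sum, map_mul, map_pow, h] at this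
  simpa using this

theorem derivation_ev {D : Derivation ℂ MiwaSeries MiwaSeries} {i : Fin 2} (h : D (par i) = 0)
    (c : PowerSeries MiwaSeries) :
    D (ev i c) = ev i (PowerSeries.mk fun n => D (PowerSeries.coeff n c)) := by
  refine (ev_eq fun N => ?_).symm
  obtain ⟨q, hq⟩ := isEval_ev i c N
  refine ⟨D q, ?_⟩
  have := congrArg D hq
  simp only [map_sub, map_sum, Derivation.leibniz, Derivation.leibniz_pow, h, smul_eq_mul,
    smul_zero, mul_zero, add_zero] at this
  simpa using this

theorem free_ev {i j : Fin 2} (hij : i ≠ j) {c : PowerSeries MiwaSeries}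
    (h : ∀ n, Free j (PowerSeries.coeff n c)) : Free j (ev i c) := by
  have : dParam j (par i) = 0 := Free.par hij
  unfold Free
  rw [derivation_ev this]
  have h0 : (PowerSeries.mk fun n => dParam j (PowerSeries.coeff n c)) = 0 := by
    ext n : 1
    rw [PowerSeries.coeff_mk, h n, map_zero]
  rw [h0, map_zero]

/-! ### Coefficientwise convergence -/

section Conv

variable {σ τ : Type*}

/-- The series `∑ a_m` is coefficientwise finite, with sum `s`. -/
def HasCoeffSum (a : ℕ → MvPowerSeries σ ℂ) (s : MvPowerSeries σ ℂ) : Prop :=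
  ∀ e, ∀ᶠ M in atTop, coeff e (∑ m ∈ Finset.range M, a m) = coeff e s

theorem HasCoeffSum.unique {a : ℕ → MvPowerSeries σ ℂ} {s t : MvPowerSeries σ ℂ}
    (hs : HasCoeffSum a s) (ht : HasCoeffSum a t) : s = t := by
  ext e
  obtain ⟨M, h1, h2⟩ := ((hs e).and (ht e)).exists
  rw [← h1, h2]

/-- This permits differentiating the residue and substituting `s = t + ∑ 2[λ_i]` in it term by term.
-/
theorem HasCoeffSum.map {a : ℕ → MvPowerSeries σ ℂ} {s : MvPowerSeries σ ℂ}
    (hs : HasCoeffSum a s) {Φ : MvPowerSeries σ ℂ →+ MvPowerSeries τ ℂ} (hΦ : FinDet Φ) :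
    HasCoeffSum (fun m => Φ (a m)) (Φ s) := by
  intro e
  obtain ⟨S, hS⟩ := hΦ e
  have : ∀ᶠ M in atTop, ∀ d ∈ S, coeff d (∑ m ∈ Finset.range M, a m) = coeff d s :=
    (Filter.eventually_all_finset S).2 fun d _ => hs d
  filter_upwards [this] with M hM
  rw [← map_sum]
  exact hS _ _ hM

theorem HasCoeffSum.add {a b : ℕ → MvPowerSeries σ ℂ} {s t : MvPowerSeries σ ℂ}
    (hs : HasCoeffSum a s) (ht : HasCoeffSum b t) : HasCoeffSum (fun m => a m + b m) (s + t) := by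
  intro e
  filter_upwards [hs e, ht e] with M h1 h2
  rw [Finset.sum_add_distrib, map_add, map_add, h1, h2]

theorem HasCoeffSum.mul_left {a : ℕ → MvPowerSeries σ ℂ} {s : MvPowerSeries σ ℂ}
    (hs : HasCoeffSum a s) (b : MvPowerSeries σ ℂ) : HasCoeffSum (fun m => b * a m) (b * s) :=
  hs.map (Φ := AddMonoidHom.mulLeft b) ((FinDet.const b).mul FinDet.id)

theorem HasCoeffSum.sub {a b : ℕ → MvPowerSeries σ ℂ} {s t : MvPowerSeries σ ℂ}
    (hs : HasCoeffSum a s) (ht : HasCoeffSum b t) : HasCoeffSum (fun m => a m - b m) (s - t) := by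
  have := hs.add (ht.mul_left (-1))
  simpa [sub_eq_add_neg] using this

theorem hasCoeffSum_single (a : MvPowerSeries σ ℂ) :
    HasCoeffSum (fun m => if m = 0 then a else 0) a := by
  intro e
  filter_upwards [eventually_gt_atTop 0] with M hM
  rw [Finset.sum_ite_eq' (Finset.range M) 0, if_pos (Finset.mem_range.2 hM)]

theorem hasCoeffSum_succ {a : ℕ → MvPowerSeries σ ℂ} {s : MvPowerSeries σ ℂ}
    (hs : HasCoeffSum a s) : HasCoeffSum (fun m => if m = 0 then 0 else a (m - 1)) s := by
  intro e
  obtain ⟨M0, hM0⟩ := eventually_atTop.1 (hs e)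
  refine eventually_atTop.2 ⟨M0 + 1, fun M hM => ?_⟩
  obtain ⟨M, rfl⟩ := Nat.exists_eq_succ_of_ne_zero (by omega : M ≠ 0)
  rw [Finset.sum_range_succ']
  simpa using hM0 M (by omega)

theorem hasCoeffSum_ev (i : Fin 2) (c : PowerSeries MiwaSeries) :
    HasCoeffSum (fun m => par i ^ m * PowerSeries.coeff m c) (ev i c) := by
  intro e
  filter_upwards [eventually_gt_atTop (e (Sum.inr i))] with M hM
  have := X_pow_dvd_iff.1 (isEval_ev i c M) e hM
  rw [map_sub, sub_eq_zero] at this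
  exact this.symm

end Conv

/-! ### Linear differential equations for power series -/

/-- The coefficient of order `n` reads `(n+1) y_{n+1} = ∑ h_i y_j` with all `j ≤ n`. This uniqueness
identifies exponentials by their differential equations. -/
theorem eq_zero_of_derivative_eq_mul {A : Type*} [CommRing A] [IsDomain A] [CharZero A]
    {h y : PowerSeries A} (hd : PowerSeries.derivative A y = h * y)
    (h0 : PowerSeries.constantCoeff y = 0) : y = 0 := by
  ext n
  induction n using Nat.strong_induction_on with
  | _ n ih =>
    cases n with
    | zero => simpa using h0
    | succ n =>
      have := congrArg (PowerSeries.coeff n) hd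
      rw [PowerSeries.coeff_derivative, PowerSeries.coeff_mul, Finset.sum_eq_zero] at this
      · rw [map_zero]
        exact (mul_eq_zero.1 this).resolve_right (Nat.cast_add_one_ne_zero n)
      · intro p hp
        rw [Finset.HasAntidiagonal.mem_antidiagonal] at hp
        rw [ih p.2 (by omega), map_zero, mul_zero]

theorem eq_of_derivative_eq_mul {A : Type*} [CommRing A] [IsDomain A] [CharZero A]
    {h y z : PowerSeries A} (hy : PowerSeries.derivative A y = h * y)
    (hz : PowerSeries.derivative A z = h * z)
    (h0 : PowerSeries.constantCoeff y = PowerSeries.constantCoeff z) : y = z := by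
  rw [← sub_eq_zero]
  exact eq_zero_of_derivative_eq_mul (h := h) (by rw [map_sub, hy, hz]; ring) (by simp [h0])

theorem charZero_mvPowerSeries (σ : Type*) : CharZero (MvPowerSeries σ ℂ) :=
  charZero_of_injective_algebraMap (R := ℂ) (algebraMap ℂ (MvPowerSeries σ ℂ)).injective

instance : IsDomain PairSeries := NoZeroDivisors.to_isDomain _
instance : IsDomain MiwaSeries := NoZeroDivisors.to_isDomain _
instance : CharZero PairSeries := charZero_mvPowerSeries _
instance : CharZero MiwaSeries := charZero_mvPowerSeries _

/-! ### The exponential factor -/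

theorem derivative_expPhase : PowerSeries.derivative PairSeries expPhase =
    PowerSeries.derivative PairSeries phase * expPhase := by
  -- The exponential is rewritten with coefficients in `PairSeries`, the ring over which the
  -- `z`-derivative is taken.
  have h : expPhase = PowerSeries.subst phase (PowerSeries.exp PairSeries) := by
    ext n : 1
    rw [expPhase, PowerSeries.coeff_subst' hasSubst_phase, PowerSeries.coeff_subst' hasSubst_phase]
    refine finsum_congr fun d => ?_
    rw [PowerSeries.coeff_exp, PowerSeries.coeff_exp, IsScalarTower.algebraMap_apply ℚ ℂ PairSeries]
    exact (algebraMap_smul PairSeries (algebraMap ℚ ℂ _) _).symm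
  rw [h, PowerSeries.derivative_subst hasSubst_phase, PowerSeries.derivative_exp, mul_comm]

theorem coeff_zero_expPhase : PowerSeries.coeff 0 expPhase = 1 := by
  rw [expPhase, PowerSeries.coeff_subst' hasSubst_phase, finsum_eq_single _ 0]
  · simp
  · intro n hn
    have : PowerSeries.coeff 0 phase = 0 := by simp [phase]
    rw [PowerSeries.coeff_zero_eq_constantCoeff_apply] at this
    rw [PowerSeries.coeff_zero_eq_constantCoeff_apply, map_pow, this, zero_pow hn, smul_zero]

/-- A derivation applied to the coefficients of a power series. -/
def coeffDer {A : Type*} [CommRing A] [Algebra ℂ A] (D : Derivation ℂ A A) (c : PowerSeries A) :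
    PowerSeries A := PowerSeries.mk fun n => D (PowerSeries.coeff n c)

section coeffDer

variable {A : Type*} [CommRing A] [Algebra ℂ A] (D : Derivation ℂ A A)

theorem coeff_coeffDer (n : ℕ) (c : PowerSeries A) :
    PowerSeries.coeff n (coeffDer D c) = D (PowerSeries.coeff n c) := PowerSeries.coeff_mk _ _

theorem coeffDer_mul (c d : PowerSeries A) :
    coeffDer D (c * d) = coeffDer D c * d + c * coeffDer D d := by
  ext n
  rw [coeff_coeffDer, map_add, PowerSeries.coeff_mul, PowerSeries.coeff_mul, PowerSeries.coeff_mul,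
    map_sum, ← Finset.sum_add_distrib]
  refine Finset.sum_congr rfl fun p _ => ?_
  rw [Derivation.leibniz, coeff_coeffDer, coeff_coeffDer, smul_eq_mul, smul_eq_mul]
  ring

theorem derivative_coeffDer (c : PowerSeries A) :
    PowerSeries.derivative A (coeffDer D c) = coeffDer D (PowerSeries.derivative A c) := by
  ext n
  rw [PowerSeries.coeff_derivative, coeff_coeffDer, coeff_coeffDer, PowerSeries.coeff_derivative,
    Derivation.leibniz, map_add, Derivation.map_natCast, Derivation.map_one_eq_zero]
  simp [mul_comm]

end coeffDer

/-- The derivative with respect to `s₁`. -/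
abbrev dSource : Derivation ℂ PairSeries PairSeries := pderiv ℂ (Sum.inl 0)

/-- Since `∂ξ/∂s₁ = z`, the difference of the two sides solves `y' = ξ' y` in `z` with initial value
`0`. -/
theorem coeffDer_expPhase : coeffDer dSource expPhase = PowerSeries.X * expPhase := by
  have hph : coeffDer dSource (PowerSeries.derivative PairSeries phase) = 1 := by
    ext n : 1
    rw [coeff_coeffDer, PowerSeries.coeff_derivative, Derivation.leibniz, map_add,
      Derivation.map_natCast, Derivation.map_one_eq_zero, phase, PowerSeries.coeff_mk,
      PowerSeries.coeff_one]
    cases n with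
    | zero =>
      simp only [zero_add, odd_one, if_true, map_sub]
      rw [show (1 / 2 : ℕ) = 0 from rfl, pderiv_X_self, pderiv_X_of_ne (by simp)]
      simp
    | succ n =>
      rw [if_neg (Nat.succ_ne_zero n)]
      split_ifs with h1
      · have h2 : (n + 1 + 1) / 2 ≠ 0 := by omega
        rw [map_sub, pderiv_X_of_ne (by simp [h2]), pderiv_X_of_ne (by simp)]
        simp
      · simp
  rw [← sub_eq_zero]
  refine eq_zero_of_derivative_eq_mul (h := PowerSeries.derivative PairSeries phase) ?_ ?_
  · rw [map_sub, derivative_coeffDer, derivative_expPhase, coeffDer_mul, hph, Derivation.leibniz,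
      PowerSeries.derivative_X, derivative_expPhase]
    simp only [smul_eq_mul]
    ring
  · rw [← PowerSeries.coeff_zero_eq_constantCoeff_apply, map_sub, coeff_coeffDer,
      coeff_zero_expPhase, PowerSeries.coeff_zero_X_mul, Derivation.map_one_eq_zero, sub_zero]

/-! ### Residues -/

/-- The residue of `P e^ξ`, for `P = ∑ P_n z^{-n}`. -/
def res (P : PowerSeries PairSeries) : PairSeries := fun e =>
  ∑ᶠ m : ℕ, coeff e (PowerSeries.coeff m expPhase * PowerSeries.coeff (m + 1) P)

theorem hasCoeffSum_res (P : PowerSeries PairSeries) :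
    HasCoeffSum (fun m => PowerSeries.coeff m expPhase * PowerSeries.coeff (m + 1) P) (res P) := by
  intro e
  filter_upwards [eventually_gt_atTop
    (Finsupp.weight (Sum.elim (fun n => 2 * n + 1) (fun n => 2 * n + 1)) e)] with M hM
  change _ = ∑ᶠ m : ℕ, coeff e (PowerSeries.coeff m expPhase * PowerSeries.coeff (m + 1) P)
  rw [map_sum, finsum_eq_sum_of_support_subset]
  intro m hm
  by_contra hcon
  simp only [Finset.coe_range, Set.mem_Iio, not_lt] at hcon
  apply hm
  change coeff e (_ * _) = 0
  rw [coeff_mul]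
  refine Finset.sum_eq_zero fun q hq => ?_
  rw [Finset.HasAntidiagonal.mem_antidiagonal] at hq
  rw [← hq, map_add] at hM
  rw [coeff_coeff_expPhase m q.1 (by omega), zero_mul]

/-- The factor `z` from `∂_{s₁} e^ξ = z e^ξ` is moved onto `P`. On series in `z⁻¹` it acts as
`tail`; the dropped term `P₀ z e^ξ` has no negative powers and hence no residue. -/
theorem dSource_res (P : PowerSeries PairSeries) :
    dSource (res P) = res (coeffDer dSource P + tail P) := by
  have h1 := (hasCoeffSum_res P).map (Φ := (dSource : PairSeries →+ PairSeries))
    (FinDet.pderiv _)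
  have h2 := (hasCoeffSum_succ (hasCoeffSum_res (tail P))).add (hasCoeffSum_res (coeffDer dSource P))
  have h3 := (hasCoeffSum_res (coeffDer dSource P)).add (hasCoeffSum_res (tail P))
  have h4 := hasCoeffSum_res (coeffDer dSource P + tail P)
  simp only [map_add, mul_add] at h4
  rw [h4.unique h3, add_comm]
  refine h1.unique ?_
  convert h2 using 2 with m
  change dSource (_ * _) = _
  rw [Derivation.leibniz, smul_eq_mul, smul_eq_mul, coeff_coeffDer, add_comm]
  congr 1
  have h5 := congrArg (PowerSeries.coeff m) coeffDer_expPhase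
  rw [coeff_coeffDer] at h5
  rw [h5]
  cases m with
  | zero => simp
  | succ m =>
    rw [if_neg (Nat.succ_ne_zero m), PowerSeries.coeff_succ_X_mul, tail, PowerSeries.coeff_mk,
      Nat.add_sub_cancel, mul_comm]

/-! ### Substitution `s = t + ∑ 2[λ_i]` -/

/-- The substitution `s = t + ∑_{i ∈ L} 2[λ_i]`. -/
def sourceHom (L : Finset (Fin 2)) : PairSeries →ₐ[ℂ] MiwaSeries :=
  substAlgHom (hasSubst_sumElim (hasSubst_miwaArg L) (hasSubst_miwaArg ∅))

theorem finDet_sourceHom (L : Finset (Fin 2)) : FinDet (sourceHom L) := FinDet.substAlgHom _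

@[simp] theorem sourceHom_inl (L : Finset (Fin 2)) (n : ℕ) :
    sourceHom L (X (Sum.inl n)) = miwaArg L n := by
  rw [sourceHom, substAlgHom_X, Sum.elim_inl]

@[simp] theorem sourceHom_inr (L : Finset (Fin 2)) (n : ℕ) :
    sourceHom L (X (Sum.inr n)) = miwaArg ∅ n := by
  rw [sourceHom, substAlgHom_X, Sum.elim_inr]

theorem hasSubst_X_comp (e : ℕ ↪ ℕ ⊕ ℕ) :
    HasSubst (fun n => (X (e n) : PairSeries)) where
  const_coeff n := by simp
  coeff_zero d := by
    refine (d.support.finite_toSet.preimage e.injective.injOn).subset fun n hn => ?_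
    simp only [Set.mem_preimage, Finset.mem_coe, Finsupp.mem_support_iff]
    intro h
    apply hn
    rw [coeff_X, if_neg]
    rintro rfl
    simp at h

/-- `f(t) ↦ f(s)` as a homomorphism. -/
def atSHom : TimeSeries →ₐ[ℂ] PairSeries := substAlgHom (hasSubst_X_comp Function.Embedding.inl)

/-- `f(t) ↦ f(t)` as a homomorphism. -/
def atTHom : TimeSeries →ₐ[ℂ] PairSeries := substAlgHom (hasSubst_X_comp Function.Embedding.inr)

theorem atS_eq (f : TimeSeries) : atS f = atSHom f := by
  rw [atS, rename_eq_subst, atSHom, coe_substAlgHom]; rfl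

theorem atT_eq (f : TimeSeries) : atT f = atTHom f := by
  rw [atT, rename_eq_subst, atTHom, coe_substAlgHom]; rfl

theorem finDet_atSHom : FinDet atSHom := FinDet.substAlgHom _
theorem finDet_atTHom : FinDet atTHom := FinDet.substAlgHom _

@[simp] theorem atSHom_X (n : ℕ) : atSHom (X n) = X (Sum.inl n) := by
  rw [atSHom, substAlgHom_X]; rfl

@[simp] theorem atTHom_X (n : ℕ) : atTHom (X n) = X (Sum.inr n) := by
  rw [atTHom, substAlgHom_X]; rfl

theorem sourceHom_atSHom (L : Finset (Fin 2)) (f : TimeSeries) :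
    sourceHom L (atSHom f) = shiftHom L f := by
  refine algHom_eq_of_X (Φ := (sourceHom L).comp atSHom) (Ψ := shiftHom L)
    ((finDet_sourceHom L).comp finDet_atSHom) (finDet_shiftHom L) (fun n => ?_) f
  simp

theorem sourceHom_atTHom (L : Finset (Fin 2)) (f : TimeSeries) :
    sourceHom L (atTHom f) = shiftHom ∅ f := by
  refine algHom_eq_of_X (Φ := (sourceHom L).comp atTHom) (Ψ := shiftHom ∅)
    ((finDet_sourceHom L).comp finDet_atTHom) (finDet_shiftHom ∅) (fun n => ?_) f
  simp

theorem dSource_atSHom (f : TimeSeries) : dSource (atSHom f) = atSHom (pderiv ℂ 0 f) := by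
  classical
  refine derivation_algHom_comm finDet_atSHom (fun n => ?_) f
  rw [atSHom_X]
  by_cases h : n = 0
  · subst h; simp
  · rw [pderiv_X_of_ne (by simpa using h), pderiv_X_of_ne h, map_zero]

theorem dSource_atTHom (f : TimeSeries) : dSource (atTHom f) = 0 := by
  refine eq_of_leibniz (Φ := fun f => dSource (atTHom f)) (Ψ := fun _ => 0)
    (ρ := atTHom) ((FinDet.pderiv _).comp finDet_atTHom) (FinDet.const 0)
    (by simp) (by simp) (fun f g => by simp) (by simp) (fun r => ?_) (fun n => ?_) f
  · simp only [algHom_C, pderiv_C]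
  · simp only [atTHom_X]
    exact pderiv_X_of_ne (by simp)

/-! ### The exponential factor at `s = t + ∑ 2[λ_i]` -/

/-- `(1 + λ_i z) / (1 - λ_i z)`. -/
def kernel (i : Fin 2) : PowerSeries MiwaSeries := 2 * PowerSeries.mk (fun n => par i ^ n) - 1

/-- `2 λ_i / (1 - λ_i² z²)`. -/
def kernelLogDer (i : Fin 2) : PowerSeries MiwaSeries :=
  PowerSeries.mk fun n => if Odd (n + 1) then 2 * par i ^ (n + 1) else 0

theorem one_sub_mul_geom (i : Fin 2) :
    (1 - PowerSeries.C (par i) * PowerSeries.X) * PowerSeries.mk (fun n => par i ^ n) = 1 := by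
  ext n : 1
  rw [sub_mul, one_mul, map_sub, mul_assoc, PowerSeries.coeff_C_mul, PowerSeries.coeff_mk,
    PowerSeries.coeff_one]
  cases n with
  | zero => rw [PowerSeries.coeff_zero_X_mul]; simp
  | succ n =>
    rw [PowerSeries.coeff_succ_X_mul, PowerSeries.coeff_mk, if_neg (Nat.succ_ne_zero n)]
    ring

theorem mul_kernelLogDer (i : Fin 2) :
    (1 - PowerSeries.C (par i) ^ 2 * PowerSeries.X ^ 2) * kernelLogDer i =
      2 * PowerSeries.C (par i) := by
  have h2 : (2 : PowerSeries MiwaSeries) = PowerSeries.C 2 := (map_ofNat PowerSeries.C 2).symm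
  ext n : 1
  rw [sub_mul, one_mul, map_sub, mul_assoc, ← map_pow, PowerSeries.coeff_C_mul, h2, ← map_mul,
    PowerSeries.coeff_C, kernelLogDer, PowerSeries.coeff_mk, PowerSeries.coeff_X_pow_mul',
    PowerSeries.coeff_mk]
  match n with
  | 0 => simp
  | 1 => simp [Nat.odd_iff]
  | n + 2 =>
    have h3 : Odd (n + 2 + 1) ↔ Odd (n + 2 - 2 + 1) := by
      rw [Nat.odd_iff, Nat.odd_iff]; omega
    rw [if_neg (by omega : ¬ n + 2 = 0), if_pos (by omega : 2 ≤ n + 2)]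
    simp only [h3]
    split_ifs
    · rw [Nat.add_sub_cancel]; ring
    · ring

theorem derivative_kernel (i : Fin 2) :
    PowerSeries.derivative MiwaSeries (kernel i) = kernelLogDer i * kernel i := by
  have h1 := one_sub_mul_geom i
  have h2 := mul_kernelLogDer i
  have h3 := congrArg (PowerSeries.derivative MiwaSeries) h1
  have hz : ∀ a : PowerSeries MiwaSeries, (1 - a * PowerSeries.X) ≠ 0 := by
    intro a h
    have := congrArg PowerSeries.constantCoeff h
    simp at this
  have hC : PowerSeries.derivative MiwaSeries (PowerSeries.C (par i)) = 0 := by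
    simp
  simp only [Derivation.leibniz, map_sub, Derivation.map_one_eq_zero, hC, PowerSeries.derivative_X,
    smul_eq_mul] at h3
  have hK : PowerSeries.derivative MiwaSeries (kernel i) =
      2 * PowerSeries.derivative MiwaSeries (PowerSeries.mk fun n => par i ^ n) := by
    have : (2 : PowerSeries MiwaSeries) = ((2 : ℕ) : PowerSeries MiwaSeries) := by simp
    rw [kernel, map_sub, Derivation.leibniz, this, Derivation.map_natCast,
      Derivation.map_one_eq_zero]
    simp
  rw [hK, kernel]
  set A : PowerSeries MiwaSeries := PowerSeries.mk fun n => par i ^ n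
  set l : PowerSeries MiwaSeries := PowerSeries.C (par i)
  have h4 : (1 - l * PowerSeries.X) * ((1 - l * PowerSeries.X) * (1 - -l * PowerSeries.X)) ≠ 0 :=
    mul_ne_zero (hz _) (mul_ne_zero (hz _) (hz _))
  refine mul_left_cancel₀ h4 ?_
  linear_combination 2 * (1 - l * PowerSeries.X) * (1 + l * PowerSeries.X) * h3
    - (1 - l * PowerSeries.X) * (2 * A - 1) * h2
    + (2 * l * (1 + l * PowerSeries.X) - 4 * l) * h1

theorem coeff_zero_kernel (i : Fin 2) : PowerSeries.constantCoeff (kernel i) = 1 := by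
  rw [← PowerSeries.coeff_zero_eq_constantCoeff_apply, kernel, map_sub,
    show (2 : PowerSeries MiwaSeries) = PowerSeries.C 2
      from (map_ofNat PowerSeries.C 2).symm,
    PowerSeries.coeff_C_mul,
    PowerSeries.coeff_mk]
  simp; norm_num

theorem map_derivative {A B : Type*} [CommRing A] [CommRing B] (φ : A →+* B) (c : PowerSeries A) :
    PowerSeries.derivative B (PowerSeries.map φ c) =
      PowerSeries.map φ (PowerSeries.derivative A c) := by
  ext n
  simp [PowerSeries.coeff_derivative]

/-- The factors `2/(2m+1)` of the Miwa shift cancel the exponents, leaving `∑ 2λ_i^{2m+1} z^{2m} =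
2λ_i/(1 - λ_i²z²)` for each `i`. -/
theorem derivative_map_phase (L : Finset (Fin 2)) :
    PowerSeries.derivative MiwaSeries (PowerSeries.map (sourceHom L : PairSeries →+* MiwaSeries)
      phase) = ∑ i ∈ L, kernelLogDer i := by
  ext n : 1
  rw [PowerSeries.coeff_derivative, PowerSeries.coeff_map, phase, PowerSeries.coeff_mk, map_sum]
  simp only [kernelLogDer, PowerSeries.coeff_mk]
  by_cases h : Odd (n + 1)
  · simp only [if_pos h]
    obtain ⟨m, hm⟩ := h
    obtain rfl : n = 2 * m := by omega
    have : (2 * m + 1) / 2 = m := by omega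
    rw [this]
    simp only [RingHom.coe_coe, map_sub, sourceHom_inl, sourceHom_inr, miwaArg_empty]
    rw [miwaArg, add_sub_cancel_left, Finset.sum_mul]
    refine Finset.sum_congr rfl fun i _ => ?_
    have hc : (C (2 / (2 * m + 1) : ℂ) : MiwaSeries) * (2 * m + 1) = 2 := by
      have h3 : (2 * (m : ℂ) + 1) ≠ 0 := by exact_mod_cast Nat.succ_ne_zero (2 * m)
      have := congrArg (C (σ := ℕ ⊕ Fin 2)) (div_mul_cancel₀ (2 : ℂ) h3)
      rwa [map_mul, map_add, map_mul, map_one, map_natCast, map_ofNat] at this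
    push_cast
    linear_combination par i ^ (2 * m + 1) * hc
  · simp [h]

/-- `exp ξ(s - t, z)` at `s = t + ∑_{i ∈ L} 2[λ_i]`. -/
theorem map_expPhase (L : Finset (Fin 2)) :
    PowerSeries.map (sourceHom L : PairSeries →+* MiwaSeries) expPhase = ∏ i ∈ L, kernel i := by
  -- Both sides have constant term `1` and logarithmic `z`-derivative `∑ 2λ_i/(1 - λ_i²z²)`.
  refine eq_of_derivative_eq_mul (h := ∑ i ∈ L, kernelLogDer i) ?_ ?_ ?_
  · rw [map_derivative, derivative_expPhase, map_mul, ← map_derivative, derivative_map_phase]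
  · classical
    induction L using Finset.induction_on with
    | empty => simp
    | insert i L hi ih =>
      rw [Finset.prod_insert hi, Finset.sum_insert hi, Derivation.leibniz, ih, derivative_kernel]
      simp only [smul_eq_mul]; ring
  · rw [map_prod, Finset.prod_congr rfl fun i _ => coeff_zero_kernel i,
      ← PowerSeries.coeff_zero_eq_constantCoeff_apply, PowerSeries.coeff_map, coeff_zero_expPhase]
    simp

theorem hasCoeffSum_sourceHom_res (L : Finset (Fin 2)) (P : PowerSeries PairSeries) :
    HasCoeffSum (fun m => PowerSeries.coeff m (∏ i ∈ L, kernel i) * PowerSeries.coeff (m + 1)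
      (PowerSeries.map (sourceHom L : PairSeries →+* MiwaSeries) P)) (sourceHom L (res P)) := by
  have := (hasCoeffSum_res P).map (Φ := (sourceHom L : PairSeries →+ MiwaSeries))
    (finDet_sourceHom L)
  rw [← map_expPhase]
  convert this using 2 with m
  · simp
  · rfl

theorem hasCoeffSum_one_mul (c : PowerSeries MiwaSeries) :
    HasCoeffSum (fun m => PowerSeries.coeff m (1 : PowerSeries MiwaSeries)
      * PowerSeries.coeff (m + 1) c) (PowerSeries.coeff 1 c) := by
  have := hasCoeffSum_single (PowerSeries.coeff 1 c)
  convert this using 2 with m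
  rw [PowerSeries.coeff_one]
  split_ifs with h
  · subst h; simp
  · simp

theorem hasCoeffSum_geom_mul (i : Fin 2) (c : PowerSeries MiwaSeries) :
    HasCoeffSum (fun m => PowerSeries.coeff m (PowerSeries.mk fun n => par i ^ n)
      * PowerSeries.coeff (m + 1) c) (ev i (tail c)) := by
  have := hasCoeffSum_ev i (tail c)
  convert this using 2 with m
  rw [PowerSeries.coeff_mk, tail, PowerSeries.coeff_mk]

theorem sourceHom_res_empty (P : PowerSeries PairSeries) : sourceHom ∅ (res P) =
    PowerSeries.coeff 1 (PowerSeries.map (sourceHom ∅ : PairSeries →+* MiwaSeries) P) := by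
  have := hasCoeffSum_sourceHom_res ∅ P
  rw [Finset.prod_empty] at this
  exact this.unique (hasCoeffSum_one_mul _)

/-- `kernel i` is `2/(1 - λ_i z) - 1`; the residue against the geometric series is an evaluation at
`z⁻¹ = λ_i`, and against `1` it is the coefficient of `z⁻¹`. -/
theorem sourceHom_res_single (i : Fin 2) (P : PowerSeries PairSeries) : sourceHom {i} (res P) =
    2 * ev i (tail (PowerSeries.map (sourceHom {i} : PairSeries →+* MiwaSeries) P)) -
    PowerSeries.coeff 1 (PowerSeries.map (sourceHom {i} : PairSeries →+* MiwaSeries) P) := by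
  have := hasCoeffSum_sourceHom_res {i} P
  rw [Finset.prod_singleton] at this
  refine this.unique ?_
  convert ((hasCoeffSum_geom_mul i _).mul_left 2).sub (hasCoeffSum_one_mul _) using 2 with m
  rw [kernel, map_sub, show (2 : PowerSeries MiwaSeries) = PowerSeries.C 2
      from (map_ofNat PowerSeries.C 2).symm,
    PowerSeries.coeff_C_mul]
  ring

theorem sourceHom_res_pair (P : PowerSeries PairSeries) :
    (lam - mu) * sourceHom {0, 1} (res P) =
    2 * (lam + mu) *
      (ev 0 (tail (PowerSeries.map (sourceHom {0, 1} : PairSeries →+* MiwaSeries) P)) -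
        ev 1 (tail (PowerSeries.map (sourceHom {0, 1} : PairSeries →+* MiwaSeries) P))) +
    (lam - mu) *
      PowerSeries.coeff 1 (PowerSeries.map (sourceHom {0, 1} : PairSeries →+* MiwaSeries) P) := by
  have := (hasCoeffSum_sourceHom_res {0, 1} P).mul_left (lam - mu)
  rw [Finset.prod_insert (by simp), Finset.prod_singleton] at this
  refine this.unique ?_
  convert (((hasCoeffSum_geom_mul 0 _).sub (hasCoeffSum_geom_mul 1 _)).mul_left
    (2 * (lam + mu))).add ((hasCoeffSum_one_mul _).mul_left (lam - mu)) using 2 with m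
  -- Partial fractions in `z`: the product of kernels tends to `1` at infinity and has poles at
  -- `1/λ` and `1/μ` with coefficients `±2(λ+μ)/(λ-μ)`.
  have hK : PowerSeries.C (lam - mu) * (kernel 0 * kernel 1) =
      PowerSeries.C (2 * (lam + mu)) * (PowerSeries.mk (fun n => par 0 ^ n) -
        PowerSeries.mk (fun n => par 1 ^ n)) + PowerSeries.C (lam - mu) * 1 := by
    have h0 := one_sub_mul_geom 0
    have h1 := one_sub_mul_geom 1
    change (1 - PowerSeries.C lam * PowerSeries.X) * _ = _ at h0
    change (1 - PowerSeries.C mu * PowerSeries.X) * _ = _ at h1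
    have hz : ∀ a : PowerSeries MiwaSeries, (1 - a * PowerSeries.X) ≠ 0 := by
      intro a h
      have := congrArg PowerSeries.constantCoeff h
      simp at this
    rw [kernel, kernel]
    simp only [map_sub, map_mul, map_add]
    rw [show PowerSeries.C (2 : MiwaSeries) = 2 from map_ofNat PowerSeries.C 2]
    set A : PowerSeries MiwaSeries := PowerSeries.mk fun n => par 0 ^ n
    set B : PowerSeries MiwaSeries := PowerSeries.mk fun n => par 1 ^ n
    refine mul_left_cancel₀ (mul_ne_zero (hz (PowerSeries.C lam)) (hz (PowerSeries.C mu))) ?_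
    generalize PowerSeries.C lam = l at *
    generalize PowerSeries.C mu = m at *
    generalize (PowerSeries.X : PowerSeries MiwaSeries) = X at *
    linear_combination ((l - m) * (4 * (1 - m * X) * B - 2 * (1 - m * X)) - 2 * (l + m) * (1 - m * X)) * h0
      + ((l - m) * (4 - 2 * (1 - l * X)) + 2 * (l + m) * (1 - l * X)) * h1
  have := congrArg (PowerSeries.coeff m) hK
  rw [PowerSeries.coeff_C_mul, map_add, PowerSeries.coeff_C_mul, PowerSeries.coeff_C_mul,
    map_sub] at this
  rw [← mul_assoc, this]
  ring

/-! ### Consequences of the bilinear identity -/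

/-- `∑ u_n λ_i ^ n`, Miwa shifted by `L`. -/
def evShift (i : Fin 2) (L : Finset (Fin 2)) (u : ℕ → TimeSeries) : MiwaSeries :=
  ev i (PowerSeries.map (shiftHom L : TimeSeries →+* MiwaSeries) (PowerSeries.mk u))

theorem S_evShift {i j : Fin 2} {L : Finset (Fin 2)} (h : j ∉ L) (u : ℕ → TimeSeries) :
    S j (evShift i L u) = evShift i (insert j L) u := by
  rw [evShift, algHom_ev (S_param j i), evShift]
  congr 1
  ext n : 1
  simp [S_shiftHom h]

theorem dTime_evShift (n : ℕ) (i : Fin 2) (L : Finset (Fin 2)) (u : ℕ → TimeSeries) :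
    dTime n (evShift i L u) = evShift i L (fun m => pderiv ℂ n (u m)) := by
  rw [evShift, derivation_ev (dTime_X_param n i), evShift]
  congr 1
  ext m : 1
  simp [dTime_shiftHom]

theorem constantCoeff_shiftHom (L : Finset (Fin 2)) (f : TimeSeries) :
    constantCoeff (shiftHom L f) = constantCoeff f := by
  have h : constantCoeff (shiftHom L (f - C (constantCoeff f))) = 0 := by
    rw [shiftHom, coe_substAlgHom]
    refine constantCoeff_subst_eq_zero (hasSubst_miwaArg L) (fun n => ?_) (by simp)
    simp [miwaArg]
  rw [map_sub, map_sub, algHom_C, sub_eq_zero] at h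
  simpa using h

theorem constantCoeff_evShift (i : Fin 2) (L : Finset (Fin 2)) (u : ℕ → TimeSeries) :
    constantCoeff (evShift i L u) = constantCoeff (u 0) := by
  rw [evShift, constantCoeff_ev, PowerSeries.coeff_map, PowerSeries.coeff_mk]
  exact constantCoeff_shiftHom L _

theorem free_evShift {i j : Fin 2} {L : Finset (Fin 2)} (hij : i ≠ j) (h : j ∉ L)
    (u : ℕ → TimeSeries) : Free j (evShift i L u) :=
  free_ev hij fun n => by simpa using free_shiftHom h _

theorem par_mul_ev_tail (i : Fin 2) (c : PowerSeries MiwaSeries) :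
    par i * ev i (tail c) = ev i c - PowerSeries.coeff 0 c := by
  rw [ev_eq_tail i c]; ring

section Bilinear

variable {w wt : ℕ → TimeSeries}

/-- `w(s,z) w̃(t,z)`. -/
def waveSeries (w wt : ℕ → TimeSeries) : PowerSeries PairSeries :=
  PowerSeries.map (atSHom : TimeSeries →+* PairSeries) (PowerSeries.mk w) *
    PowerSeries.map (atTHom : TimeSeries →+* PairSeries) (PowerSeries.mk wt)

theorem coeff_waveSeries (n : ℕ) : PowerSeries.coeff n (waveSeries w wt) = waveProd w wt n := by
  rw [waveSeries, PowerSeries.coeff_mul, waveProd]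
  refine Finset.sum_congr rfl fun p _ => ?_
  simp [atS_eq, atT_eq]

theorem bilinearResidue_eq : bilinearResidue w wt = res (waveSeries w wt) := by
  funext e
  simp only [bilinearResidue, res, coeff_waveSeries]

theorem map_waveSeries (L : Finset (Fin 2)) :
    PowerSeries.map (sourceHom L : PairSeries →+* MiwaSeries) (waveSeries w wt) =
      PowerSeries.map (shiftHom L : TimeSeries →+* MiwaSeries) (PowerSeries.mk w) *
        PowerSeries.map (shiftHom ∅ : TimeSeries →+* MiwaSeries) (PowerSeries.mk wt) := by
  rw [waveSeries, map_mul]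
  congr 1
  · ext n : 1; simp [sourceHom_atSHom]
  · ext n : 1; simp [sourceHom_atTHom]

theorem map_coeffDer_waveSeries (L : Finset (Fin 2)) :
    PowerSeries.map (sourceHom L : PairSeries →+* MiwaSeries)
        (coeffDer dSource (waveSeries w wt)) =
      PowerSeries.map (shiftHom L : TimeSeries →+* MiwaSeries)
          (PowerSeries.mk fun n => pderiv ℂ 0 (w n)) *
        PowerSeries.map (shiftHom ∅ : TimeSeries →+* MiwaSeries) (PowerSeries.mk wt) := by
  rw [waveSeries, coeffDer_mul, map_add, map_mul, map_mul]
  have h1 : PowerSeries.map (sourceHom L : PairSeries →+* MiwaSeries) (coeffDer dSource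
      (PowerSeries.map (atTHom : TimeSeries →+* PairSeries) (PowerSeries.mk wt))) = 0 := by
    ext n : 1; simp [coeff_coeffDer, dSource_atTHom]
  rw [h1, mul_zero, add_zero]
  congr 1
  · ext n : 1; simp [coeff_coeffDer, dSource_atSHom, sourceHom_atSHom]
  · ext n : 1; simp [sourceHom_atTHom]

theorem map_tail (L : Finset (Fin 2)) (P : PowerSeries PairSeries) :
    PowerSeries.map (sourceHom L : PairSeries →+* MiwaSeries) (tail P) =
      tail (PowerSeries.map (sourceHom L : PairSeries →+* MiwaSeries) P) := by
  ext n : 1; simp [tail]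

theorem coeff_zero_map_waveSeries (hw : w 0 = 1) (hwt : wt 0 = 1) (L : Finset (Fin 2)) :
    PowerSeries.coeff 0 (PowerSeries.map (sourceHom L : PairSeries →+* MiwaSeries)
      (waveSeries w wt)) = 1 := by
  rw [map_waveSeries, PowerSeries.coeff_mul]
  simp [hw, hwt]

theorem coeff_one_map_waveSeries (hw : w 0 = 1) (hwt : wt 0 = 1) (L : Finset (Fin 2)) :
    PowerSeries.coeff 1 (PowerSeries.map (sourceHom L : PairSeries →+* MiwaSeries)
      (waveSeries w wt)) = shiftHom L (w 1) + shiftHom ∅ (wt 1) := by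
  rw [map_waveSeries, PowerSeries.coeff_mul, Finset.Nat.antidiagonal_succ]
  simp [hw, hwt, add_comm]

theorem coeff_two_map_waveSeries (hw : w 0 = 1) (hwt : wt 0 = 1) (L : Finset (Fin 2)) :
    PowerSeries.coeff 2 (PowerSeries.map (sourceHom L : PairSeries →+* MiwaSeries)
      (waveSeries w wt)) =
      shiftHom L (w 2) + shiftHom L (w 1) * shiftHom ∅ (wt 1) + shiftHom ∅ (wt 2) := by
  rw [map_waveSeries, PowerSeries.coeff_mul, Finset.Nat.sum_antidiagonal_eq_sum_range_succ_mk]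
  simp [Finset.sum_range_succ, hw, hwt]
  ring

/-- The source derivative of the integrand of the bilinear identity. -/
def derWaveSeries (w wt : ℕ → TimeSeries) : PowerSeries PairSeries :=
  coeffDer dSource (waveSeries w wt) + tail (waveSeries w wt)

theorem coeff_zero_map_derWaveSeries (hw : w 0 = 1) (hwt : wt 0 = 1) (L : Finset (Fin 2)) :
    PowerSeries.coeff 0 (PowerSeries.map (sourceHom L : PairSeries →+* MiwaSeries)
      (derWaveSeries w wt)) = shiftHom L (w 1) + shiftHom ∅ (wt 1) := by
  rw [derWaveSeries, map_add, map_coeffDer_waveSeries, map_add, map_tail, tail,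
    PowerSeries.coeff_mk, coeff_one_map_waveSeries hw hwt, PowerSeries.coeff_mul]
  simp [hw, hwt]

theorem coeff_one_map_derWaveSeries (hw : w 0 = 1) (hwt : wt 0 = 1) (L : Finset (Fin 2)) :
    PowerSeries.coeff 1 (PowerSeries.map (sourceHom L : PairSeries →+* MiwaSeries)
      (derWaveSeries w wt)) = shiftHom L (pderiv ℂ 0 (w 1)) +
      (shiftHom L (w 2) + shiftHom L (w 1) * shiftHom ∅ (wt 1) + shiftHom ∅ (wt 2)) := by
  rw [derWaveSeries, map_add, map_coeffDer_waveSeries, map_add, map_tail, tail,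
    PowerSeries.coeff_mk, coeff_two_map_waveSeries hw hwt, PowerSeries.coeff_mul,
    Finset.Nat.antidiagonal_succ]
  simp [hw, hwt]

theorem ev_map_waveSeries (i : Fin 2) (L : Finset (Fin 2)) :
    ev i (PowerSeries.map (sourceHom L : PairSeries →+* MiwaSeries) (waveSeries w wt)) =
      evShift i L w * evShift i ∅ wt := by
  rw [map_waveSeries, map_mul]; rfl

theorem par_mul_ev_map_derWaveSeries (hw : w 0 = 1) (hwt : wt 0 = 1)
    (i : Fin 2) (L : Finset (Fin 2)) :
    par i * ev i (PowerSeries.map (sourceHom L : PairSeries →+* MiwaSeries) (derWaveSeries w wt)) =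
      par i * (dTime 0 (evShift i L w) * evShift i ∅ wt) +
        (evShift i L w * evShift i ∅ wt - 1) := by
  rw [derWaveSeries, map_add, map_coeffDer_waveSeries, map_add, map_tail, map_mul, mul_add,
    par_mul_ev_tail, coeff_zero_map_waveSeries hw hwt, ev_map_waveSeries, dTime_evShift]
  rfl

theorem res_waveSeries (h : BilinearIdentity w wt) : res (waveSeries w wt) = 0 := by
  rw [← bilinearResidue_eq]; exact h

theorem res_derWaveSeries (h : BilinearIdentity w wt) : res (derWaveSeries w wt) = 0 := by
  rw [derWaveSeries, ← dSource_res, res_waveSeries h, map_zero]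

/-- At `s = t` the exponential is `1`, so the residue is `w₁ + w̃₁`. -/
theorem shiftHom_dual_one (hw : w 0 = 1) (hwt : wt 0 = 1) (h : BilinearIdentity w wt) :
    shiftHom ∅ (wt 1) = shiftHom ∅ (phi w) := by
  have := sourceHom_res_empty (waveSeries w wt)
  rw [res_waveSeries h, coeff_one_map_waveSeries hw hwt, map_zero] at this
  rw [phi, map_neg]
  linear_combination -this

theorem C_half_mul_two : (C (1 / 2 : ℂ) : MiwaSeries) * 2 = 1 := by
  rw [show (2 : MiwaSeries) = C 2 from (map_ofNat C 2).symm, ← map_mul]; norm_num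

/-- The coefficient of `z^{-1}` in the differentiated integrand. -/
theorem coeff_one_map_derWaveSeries_eq {k : ℂ} (hw : w 0 = 1) (hwt : wt 0 = 1)
    (h : BilinearIdentity w wt) (hθ : theta w = C k * pderiv ℂ 0 (phi w)) (L : Finset (Fin 2)) :
    PowerSeries.coeff 1 (PowerSeries.map (sourceHom L : PairSeries →+* MiwaSeries)
      (derWaveSeries w wt)) =
      -(C (k + 1 / 2) * dTime 0 (shiftHom L (phi w) - shiftHom ∅ (phi w))) +
        C (1 / 2) * (shiftHom L (phi w) - shiftHom ∅ (phi w)) ^ 2 := by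
  -- The differentiated identity at `s = t` determines `w̃₂`, which is then eliminated; `θ = k
  -- φ_{t₁}` enters through `w₂`.
  have h0 := sourceHom_res_empty (derWaveSeries w wt)
  rw [res_derWaveSeries h, coeff_one_map_derWaveSeries hw hwt, map_zero,
    shiftHom_dual_one hw hwt h] at h0
  rw [coeff_one_map_derWaveSeries hw hwt, shiftHom_dual_one hw hwt h]
  have h1 : w 1 = -phi w := by rw [phi, neg_neg]
  have h2 : w 2 = C (1 / 2) * (pderiv ℂ 0 (phi w) + phi w ^ 2) -
      C k * pderiv ℂ 0 (phi w) := by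
    rw [← hθ, theta]; ring
  rw [h2, h1] at h0 ⊢
  simp only [map_sub, map_add, map_mul, map_neg, map_pow, algHom_C, dTime_shiftHom] at h0 ⊢
  linear_combination -h0 + (shiftHom L (pderiv ℂ 0 (phi w)) - shiftHom ∅ (pderiv ℂ 0 (phi w))
    - shiftHom ∅ (phi w) ^ 2 + shiftHom L (phi w) * shiftHom ∅ (phi w)) * C_half_mul_two

theorem F_eq (φ : TimeSeries) (L : Finset (Fin 2)) (i : Fin 2) :
    F φ L i = 1 - C (1 / 2) * par i * (shiftHom (insert i L) φ - shiftHom L φ) := by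
  rw [F, shift_eq, shift_eq]

theorem par_ne_zero (i : Fin 2) : par i ≠ 0 := fun h => by
  have := congrArg (coeff (single (Sum.inr i) 1)) h
  rw [coeff_X, if_pos rfl, map_zero] at this
  exact one_ne_zero this

/-- The residue at `s = t + 2[λ_i]`, times `λ_i/2`, says that the product is `1 + (λ_i/2)(w₁(s) +
w̃₁(t))`, and `w̃₁ = φ = -w₁`. -/
theorem evShift_mul_evShift (hw : w 0 = 1) (hwt : wt 0 = 1)
    (h : BilinearIdentity w wt) (i : Fin 2) :
    evShift i {i} w * evShift i ∅ wt = F (phi w) ∅ i := by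
  have h0 := sourceHom_res_single i (waveSeries w wt)
  rw [res_waveSeries h, coeff_one_map_waveSeries hw hwt, map_zero, shiftHom_dual_one hw hwt h] at h0
  have h1 := par_mul_ev_tail i
    (PowerSeries.map (sourceHom {i} : PairSeries →+* MiwaSeries) (waveSeries w wt))
  rw [coeff_zero_map_waveSeries hw hwt, ev_map_waveSeries] at h1
  have h2 : w 1 = -phi w := by rw [phi, neg_neg]
  rw [h2, map_neg] at h0
  rw [F_eq, insert_empty_eq]
  linear_combination - h1 - C (1 / 2) * par i * h0 -
    par i * ev i (tail (PowerSeries.map (sourceHom {i} : PairSeries →+* MiwaSeries)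
      (waveSeries w wt))) * C_half_mul_two

/-- The same evaluation for the identity differentiated in `s₁`. The two summands of `k + 1/2` come
from `θ` and from the `φ_{t₁}/2` in `w₂`, combined with `∂w₁`. -/
theorem dTime_evShift_mul_evShift {k : ℂ} (hw : w 0 = 1) (hwt : wt 0 = 1)
    (h : BilinearIdentity w wt) (hθ : theta w = C k * pderiv ℂ 0 (phi w)) (i : Fin 2) :
    dTime 0 (evShift i {i} w) * evShift i ∅ wt = C (k + 1 / 2) * dTime 0 (F (phi w) ∅ i) -
      C (1 / 2) * (shiftHom {i} (phi w) - shiftHom ∅ (phi w)) * F (phi w) ∅ i := by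
  have h0 := sourceHom_res_single i (derWaveSeries w wt)
  rw [res_derWaveSeries h, coeff_one_map_derWaveSeries_eq hw hwt h hθ, map_zero] at h0
  have h1 := par_mul_ev_tail i
    (PowerSeries.map (sourceHom {i} : PairSeries →+* MiwaSeries) (derWaveSeries w wt))
  rw [coeff_zero_map_derWaveSeries hw hwt, shiftHom_dual_one hw hwt h] at h1
  have h3 := par_mul_ev_map_derWaveSeries hw hwt i {i}
  have h2 : w 1 = -phi w := by rw [phi, neg_neg]
  have h4 := evShift_mul_evShift hw hwt h i
  rw [h2, map_neg] at h1
  have h5 : dTime 0 (F (phi w) ∅ i) =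
      -(C (1 / 2) * par i * dTime 0 (shiftHom {i} (phi w) - shiftHom ∅ (phi w))) := by
    rw [F_eq, insert_empty_eq, map_sub, Derivation.leibniz, Derivation.leibniz, dTime_X_param,
      Derivation.map_one_eq_zero, pderiv_C]
    simp only [smul_eq_mul]; ring
  rw [h4] at h3
  rw [h5]
  have h6 : F (phi w) ∅ i = 1 - C (1 / 2) * par i * (shiftHom {i} (phi w) - shiftHom ∅ (phi w)) := by
    rw [F_eq, insert_empty_eq]
  rw [h6] at h3 ⊢
  generalize dTime 0 (shiftHom {i} (phi w) - shiftHom ∅ (phi w)) = D at *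
  generalize ev i (tail (PowerSeries.map (sourceHom {i} : PairSeries →+* MiwaSeries)
      (derWaveSeries w wt))) = T at *
  generalize ev i (PowerSeries.map (sourceHom {i} : PairSeries →+* MiwaSeries)
      (derWaveSeries w wt)) = T' at *
  generalize dTime 0 (evShift i {i} w) * evShift i ∅ wt = Y at *
  generalize hd : shiftHom {i} (phi w) = a at *
  generalize shiftHom ∅ (phi w) = b at *
  refine mul_left_cancel₀ (par_ne_zero i) ?_
  have hh := C_half_mul_two
  generalize (C (1 / 2 : ℂ) : MiwaSeries) = c at *
  generalize C (k + 1 / 2 : ℂ) = K at *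
  generalize par i = l at *
  linear_combination -h3 - l * h1 - c * l ^ 2 * h0 + (- l ^ 2 * T + l * (a - b)) * hh

/-- The residue at `s = t + 2[λ] + 2[μ]`, multiplied by `λμ(λ-μ)`; the next lemma treats the
differentiated identity in the same way with `λ²μ²(λ-μ)`. -/
theorem evShift_pair (hw : w 0 = 1) (hwt : wt 0 = 1) (h : BilinearIdentity w wt) :
    2 * (lam + mu) * (mu * (evShift 0 {0, 1} w * evShift 0 ∅ wt - 1) -
        lam * (evShift 1 {0, 1} w * evShift 1 ∅ wt - 1)) =
      (lam - mu) * lam * mu * (shiftHom {0, 1} (phi w) - shiftHom ∅ (phi w)) := by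
  have h0 := sourceHom_res_pair (waveSeries w wt)
  rw [res_waveSeries h, coeff_one_map_waveSeries hw hwt, map_zero, shiftHom_dual_one hw hwt h] at h0
  have h1 := par_mul_ev_tail 0
    (PowerSeries.map (sourceHom {0, 1} : PairSeries →+* MiwaSeries) (waveSeries w wt))
  have h2 := par_mul_ev_tail 1
    (PowerSeries.map (sourceHom {0, 1} : PairSeries →+* MiwaSeries) (waveSeries w wt))
  rw [coeff_zero_map_waveSeries hw hwt, ev_map_waveSeries] at h1 h2
  have h3 : w 1 = -phi w := by rw [phi, neg_neg]
  rw [h3, map_neg] at h0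
  change lam * _ = _ at h1
  change mu * _ = _ at h2
  linear_combination 2 * (lam + mu) * lam * h2 - 2 * (lam + mu) * mu * h1 - lam * mu * h0

theorem dTime_evShift_pair {k : ℂ} (hw : w 0 = 1) (hwt : wt 0 = 1)
    (h : BilinearIdentity w wt) (hθ : theta w = C k * pderiv ℂ 0 (phi w)) :
    2 * (lam + mu) * (mu ^ 2 * (lam * (dTime 0 (evShift 0 {0, 1} w) * evShift 0 ∅ wt) +
          evShift 0 {0, 1} w * evShift 0 ∅ wt - 1 +
          lam * (shiftHom {0, 1} (phi w) - shiftHom ∅ (phi w))) -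
        lam ^ 2 * (mu * (dTime 0 (evShift 1 {0, 1} w) * evShift 1 ∅ wt) +
          evShift 1 {0, 1} w * evShift 1 ∅ wt - 1 +
          mu * (shiftHom {0, 1} (phi w) - shiftHom ∅ (phi w)))) =
      (lam - mu) * lam ^ 2 * mu ^ 2 *
        (C (k + 1 / 2) * dTime 0 (shiftHom {0, 1} (phi w) - shiftHom ∅ (phi w)) -
        C (1 / 2) * (shiftHom {0, 1} (phi w) - shiftHom ∅ (phi w)) ^ 2) := by
  have h0 := sourceHom_res_pair (derWaveSeries w wt)
  rw [res_derWaveSeries h, coeff_one_map_derWaveSeries_eq hw hwt h hθ, map_zero] at h0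
  have h1 := par_mul_ev_tail 0
    (PowerSeries.map (sourceHom {0, 1} : PairSeries →+* MiwaSeries) (derWaveSeries w wt))
  have h2 := par_mul_ev_tail 1
    (PowerSeries.map (sourceHom {0, 1} : PairSeries →+* MiwaSeries) (derWaveSeries w wt))
  rw [coeff_zero_map_derWaveSeries hw hwt, shiftHom_dual_one hw hwt h] at h1 h2
  have h3 : w 1 = -phi w := by rw [phi, neg_neg]
  rw [h3, map_neg] at h1 h2
  have h4 := par_mul_ev_map_derWaveSeries hw hwt 0 {0, 1}
  have h5 := par_mul_ev_map_derWaveSeries hw hwt 1 {0, 1}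
  change lam * _ = _ at h1
  change mu * _ = _ at h2
  change lam * _ = lam * _ + _ at h4
  change mu * _ = mu * _ + _ at h5
  linear_combination 2 * (lam + mu) * (lam ^ 2 * (mu * h2 + h5) - mu ^ 2 * (lam * h1 + h4))
    - lam ^ 2 * mu ^ 2 * h0

end Bilinear

/-! ### Elimination in the residue identities -/

/-- The relations between `f = F(λ)`, `g = F(μ)`, their shifts `fm = F_{2[μ]}(λ)`,
`gl = F_{2[λ]}(μ)` and the products `W`, `U` of wave functions which come from the bilinear
identity. -/
structure FayRelations {A : Type*} [CommRing A] [Algebra ℂ A] (D : Derivation ℂ A A)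
    (K Kt l m f g fm gl W U : A) : Prop where
  D_l : D l = 0
  D_m : D m = 0
  D_K : D K = 0
  K_add : K + Kt = 1
  add_eq : m * fm + l * g = l * gl + m * f
  first : (l + m) * (m * W - l * U) = (m - l) * (m * fm + l * g)
  -- `X` stands for `(λ ∂_{t₁} w + w) w̃` at `z = 1/λ`, with `w` shifted twice, and `Y` for the same
  -- at `1/μ`. They are known only after multiplication by `fm`, `gl`, and the existential form
  -- avoids dividing.
  second : ∃ X Y, fm * X = W * (fm ^ 2 + K * l * D fm) ∧ gl * Y = U * (gl ^ 2 + K * m * D gl) ∧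
    (l + m) * (m ^ 2 * X - l ^ 2 * Y) =
      (m - l) * ((m * fm + l * g) ^ 2 + K * l * m * D (m * fm + l * g))
  D_W : l * f * fm * D W = W * (l * K * D fm * f + l * Kt * D f * fm + (fm - f) * f * fm)
  D_U : m * g * gl * D U = U * (m * K * D gl * g + m * Kt * D g * gl + (gl - g) * g * gl)
  l_ne : l ≠ 0
  m_ne : m ≠ 0
  lm_ne : l + m ≠ 0
  f_ne : f ≠ 0
  g_ne : g ≠ 0
  fm_ne : fm ≠ 0
  gl_ne : gl ≠ 0
  W_ne : W ≠ 0
  U_ne : U ≠ 0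

namespace FayRelations

variable {A : Type*} [CommRing A] [Algebra ℂ A] {D : Derivation ℂ A A}
  {K Kt l m f g fm gl W U : A}

theorem D_add_eq (h : FayRelations D K Kt l m f g fm gl W U) :
    m * D fm + l * D g = l * D gl + m * D f := by
  have := congrArg D h.add_eq
  simpa [h.D_l, h.D_m] using this

theorem D_Kt (h : FayRelations D K Kt l m f g fm gl W U) : D Kt = 0 := by
  have := congrArg D h.K_add
  simpa [h.D_K] using this

variable [IsDomain A]

/-- With `R = m fm + l g`, the right side of `second`, multiplied by `R`, contains `(m - l) R`,
which `first` replaces by a combination of `W` and `U`. What remains is homogeneous in `W`, `U`. -/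
theorem first_relation (h : FayRelations D K Kt l m f g fm gl W U) :
    W * gl * (fm * g * (m * fm + l * g) - K * (l * m * (D fm * g - fm * D g))) =
      U * fm * (gl * f * (m * fm + l * g) - K * (l * m * (D gl * f - gl * D f))) := by
  obtain ⟨X, Y, hX, hY, hXY⟩ := h.second
  have hR := h.add_eq
  have hR' := h.D_add_eq
  have h1 := h.first
  simp only [map_add, Derivation.leibniz, smul_eq_mul, h.D_l, h.D_m, mul_zero, add_zero] at hXY
  generalize D fm = fm' at *
  generalize D g = g' at *
  generalize D gl = gl' at *
  generalize D f = f' at *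
  refine mul_left_cancel₀ (mul_ne_zero h.lm_ne (mul_ne_zero h.l_ne h.m_ne)) ?_
  obtain ⟨R, hRd⟩ : ∃ R, R = m * fm + l * g := ⟨_, rfl⟩
  obtain ⟨R', hRd'⟩ : ∃ R', R' = m * fm' + l * g' := ⟨_, rfl⟩
  have key : (l + m) * (R * (m ^ 2 * (gl * (W * (fm ^ 2 + K * l * fm'))) -
      l ^ 2 * (fm * (U * (gl ^ 2 + K * m * gl'))))) =
      fm * gl * (R ^ 2 + K * l * m * R') * ((l + m) * (m * W - l * U)) := by
    rw [← hX, ← hY, h1, hRd, hRd']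
    linear_combination (fm * gl * (m * fm + l * g)) * hXY
  -- The two expressions for `R` in `add_eq` are used asymmetrically: `fm`, `g` in the coefficient
  -- of `W`, and `gl`, `f` in that of `U`.
  have hg : l * g = R - m * fm := by rw [hRd]; ring
  have hf : m * f = R - l * gl := by rw [hRd, hR]; ring
  have hg' : l * g' = R' - m * fm' := by rw [hRd']; ring
  have hf' : m * f' = R' - l * gl' := by rw [hRd', hR']; ring
  rw [← hRd]
  linear_combination (-1 : A) * key
    + (l + m) * W * gl * m * (fm * R - K * l * m * fm') * hg
    - (l + m) * U * fm * l * (gl * R - K * l * m * gl') * hf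
    + (l + m) * K * l * m ^ 2 * W * gl * fm * hg' - (l + m) * K * l ^ 2 * m * U * fm * gl * hf'

/-- Differentiating `first` and inserting `D_W`, `D_U` gives another homogeneous relation. Modulo
`first_relation` it becomes this one, with `Kt` for `K` and the two brackets exchanged. -/
theorem second_relation (h : FayRelations D K Kt l m f g fm gl W U) :
    W * g * (gl * f * (m * fm + l * g) - Kt * (l * m * (D gl * f - gl * D f))) =
      U * f * (fm * g * (m * fm + l * g) - Kt * (l * m * (D fm * g - fm * D g))) := by
  have h1 := h.first_relation
  have hR := h.add_eq
  have hR' := h.D_add_eq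
  have hE := h.first
  have hE' := congrArg D hE
  have hKt : Kt = 1 - K := by rw [← h.K_add]; ring
  have hW := h.D_W
  have hU := h.D_U
  simp only [map_add, map_sub, Derivation.leibniz, smul_eq_mul, h.D_l, h.D_m, mul_zero, add_zero,
    sub_zero] at hE'
  generalize D fm = fm' at *
  generalize D g = g' at *
  generalize D gl = gl' at *
  generalize D f = f' at *
  generalize D W = W' at *
  generalize D U = U' at *
  have hE2 : (l + m) * ((m * fm + l * g) * (m * W' - l * U')) =
      (l + m) * ((m * fm' + l * g') * (m * W - l * U)) := by
    linear_combination (m * fm + l * g) * hE' - (m * fm' + l * g') * hE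
  have hE3 := mul_left_cancel₀ h.lm_ne hE2
  have hE4 : (m * fm + l * g) * (m ^ 2 * g * gl * (l * f * fm * W')
      - l ^ 2 * f * fm * (m * g * gl * U')) =
      (m * fm' + l * g') * (m * W - l * U) * (l * m * f * fm * g * gl) := by
    linear_combination l * m * f * fm * g * gl * hE3
  rw [hW, hU] at hE4
  refine mul_left_cancel₀ (mul_ne_zero (mul_ne_zero h.l_ne h.m_ne)
    (mul_ne_zero h.fm_ne h.gl_ne)) ?_
  subst hKt
  linear_combination hE4 + l * m * f * g * h1
    + (-W * f * g * fm * gl * (m * fm + l * g) * m - U * f * g * fm * gl * (m * fm + l * g) * l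
      - (1 - K) * l * m ^ 2 * fm * gl * g * f' * W + K * l ^ 2 * m * f * g * fm * gl' * U) * hR
    + ((1 - K) * l * m ^ 2 * fm * gl * g * f * W - K * l ^ 2 * m * f * g * fm * gl * U) * hR'

/-- Logarithmic derivative of `W / U`. -/
theorem wronskian (h : FayRelations D K Kt l m f g fm gl W U) :
    (D W * U - D U * W) * (fm * gl * f * g) =
      W * U * (K * (D fm * gl - D gl * fm) * (f * g) + Kt * (D f * g - D g * f) * (fm * gl)) := by
  have hR := h.add_eq
  refine mul_left_cancel₀ (mul_ne_zero h.l_ne h.m_ne) ?_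
  linear_combination m * g * gl * U * h.D_W - l * f * fm * W * h.D_U
    + W * U * f * fm * g * gl * hR

/-- The case in which the two relations for `W / U` coincide. -/
theorem sq_relation (h : FayRelations D K K l m f g fm gl W U)
    (hA : fm * g * (m * fm + l * g) - K * (l * m * (D fm * g - fm * D g)) ≠ 0)
    (hB : gl * f * (m * fm + l * g) - K * (l * m * (D gl * f - gl * D f)) ≠ 0) :
    W ^ 2 * gl * g = U ^ 2 * fm * f := by
  -- For `K = Kt` the relations read `W gl A = U fm B` and `W g B = U f A` with the same `A`, `B`,
  -- so their product is divisible by `A B`.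
  have h1 := h.first_relation
  have h2 := h.second_relation
  refine mul_left_cancel₀ (mul_ne_zero hA hB) ?_
  linear_combination (W * g * (gl * f * (m * fm + l * g) - K * (l * m * (D gl * f - gl * D f)))) * h1
    + U * fm * (gl * f * (m * fm + l * g) - K * (l * m * (D gl * f - gl * D f))) * h2

/-- Elimination of `W / U` for generic `K`. -/
theorem generic_relation (h : FayRelations D K Kt l m f g fm gl W U) (hK : K ≠ 0) (hKt : Kt ≠ 0)
    (hKK : K - Kt ≠ 0)
    {a b n p R : A} (ha : a = fm * g) (hb : b = gl * f) (hn : n = D fm * g - fm * D g)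
    (hp : p = D gl * f - gl * D f) (hR : R = m * fm + l * g)
    (hA : a * R - K * (l * m * n) ≠ 0) (hB : a * R - Kt * (l * m * n) ≠ 0)
    (hR0 : R ≠ 0) :
    b ^ 2 * n * ((D n * a - n * D a) * R - n * a * D R) =
      a ^ 2 * p * ((D p * b - p * D b) * R - p * b * D R) := by
  have h1 := h.first_relation
  have h2 := h.second_relation
  have h3 := h.wronskian
  rw [← ha, ← hb, ← hn, ← hp, ← hR] at h1 h2
  have hl := h.D_l
  have hm := h.D_m
  have hDK := h.D_K
  have hDKt := h.D_Kt
  have hda : D a = D fm * g + fm * D g := by rw [ha]; simp; ring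
  have hdb : D b = D gl * f + gl * D f := by rw [hb]; simp; ring
  obtain ⟨A1, hA1⟩ : ∃ x, x = a * R - K * (l * m * n) := ⟨_, rfl⟩
  obtain ⟨B1, hB1⟩ : ∃ x, x = b * R - K * (l * m * p) := ⟨_, rfl⟩
  obtain ⟨A2, hA2⟩ : ∃ x, x = a * R - Kt * (l * m * n) := ⟨_, rfl⟩
  obtain ⟨B2, hB2⟩ : ∃ x, x = b * R - Kt * (l * m * p) := ⟨_, rfl⟩
  have hA1' : D A1 = D a * R + a * D R - K * (l * m * D n) := by
    rw [hA1]; simp [hl, hm, hDK]; ring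
  have hB1' : D B1 = D b * R + b * D R - K * (l * m * D p) := by
    rw [hB1]; simp [hl, hm, hDK]; ring
  have hA2' : D A2 = D a * R + a * D R - Kt * (l * m * D n) := by
    rw [hA2]; simp [hl, hm, hDKt]; ring
  have hB2' : D B2 = D b * R + b * D R - Kt * (l * m * D p) := by
    rw [hB2]; simp [hl, hm, hDKt]; ring
  rw [← hA1, ← hB1] at h1
  rw [← hA2, ← hB2] at h2
  rw [← hA1] at hA
  rw [← hA2] at hB
  have h1' := congrArg D h1
  have h2' := congrArg D h2
  simp only [Derivation.leibniz, smul_eq_mul] at h1' h2'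
  have hWU := mul_ne_zero h.W_ne h.U_ne
  have hKadd := h.K_add
  obtain rfl : Kt = 1 - K := by rw [← hKadd]; ring
  -- In logarithmic derivatives, `first_relation` and `wronskian` give `D log(A1/B1) = Kt D
  -- log(a/b)`; `second_relation` similarly gives `D log(A2/B2) = K D log(a/b)`.
  have e1 : (1 - K) * (D a * b - D b * a) * (A1 * B1) = a * b * (D A1 * B1 - A1 * D B1) := by
    refine mul_left_cancel₀ hWU ?_
    rw [hda, hdb, ha, hb]
    linear_combination (-(f * g)) * (U * fm * B1 * h1' -
      (U * fm * D B1 + B1 * (U * D fm + fm * D U)) * h1) + A1 * B1 * h3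
  have e2 : K * (D a * b - D b * a) * (A2 * B2) = a * b * (D A2 * B2 - A2 * D B2) := by
    refine mul_left_cancel₀ hWU ?_
    rw [hda, hdb, ha, hb]
    linear_combination (fm * gl) * (U * f * A2 * h2' -
      (U * f * D A2 + A2 * (U * D f + f * D U)) * h2) - A2 * B2 * h3
  -- Equating the two expressions for `W/U` removes it altogether.
  have e3 : b * (A1 * A2) = a * (B1 * B2) := by
    refine mul_left_cancel₀ hWU ?_
    rw [ha, hb]
    linear_combination U * f * A2 * h1 - U * fm * B1 * h2
  rw [hA1', hB1'] at e1
  rw [hA2', hB2'] at e2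
  have f1 : (D a * b - D b * a) * (R * (A1 * B1)) =
      l * m * (((D n * a - n * D a) * R - n * a * D R) * (b * B1) -
        ((D p * b - p * D b) * R - p * b * D R) * (a * A1)) := by
    refine mul_left_cancel₀ (mul_ne_zero hK hR0) ?_
    rw [hA1, hB1] at e1 ⊢
    linear_combination (-R ^ 2) * e1
  have f2 : (D a * b - D b * a) * (R * (A2 * B2)) =
      l * m * (((D n * a - n * D a) * R - n * a * D R) * (b * B2) -
        ((D p * b - p * D b) * R - p * b * D R) * (a * A2)) := by
    refine mul_left_cancel₀ (mul_ne_zero hKt hR0) ?_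
    rw [hA2, hB2] at e2 ⊢
    linear_combination (-R ^ 2) * e2
  obtain ⟨N, hN⟩ : ∃ x, x = (D n * a - n * D a) * R - n * a * D R := ⟨_, rfl⟩
  obtain ⟨P, hP⟩ : ∃ x, x = (D p * b - p * D b) * R - p * b * D R := ⟨_, rfl⟩
  rw [← hN, ← hP] at f1 f2 ⊢
  -- Eliminating `D log(a/b)` from `f1` and `f2` leaves the differences `A2 - A1` and `B2 - B1`,
  -- which are `(K - Kt) l m` times `n` and `p`; hence `K ≠ Kt` is needed. With `e3`, every trace of
  -- `K` then disappears.
  have f3 : N * n * (b * (B1 * B2)) = P * p * (a * (A1 * A2)) := by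
    have hc : l * m * (l * m * (K - (1 - K))) ≠ 0 :=
      mul_ne_zero (mul_ne_zero h.l_ne h.m_ne) (mul_ne_zero (mul_ne_zero h.l_ne h.m_ne) hKK)
    refine mul_left_cancel₀ hc ?_
    have d1 : A2 - A1 = (K - (1 - K)) * (l * m * n) := by rw [hA1, hA2]; ring
    have d2 : B2 - B1 = (K - (1 - K)) * (l * m * p) := by rw [hB1, hB2]; ring
    linear_combination A1 * B1 * f2 - A2 * B2 * f1 - l * m * N * b * B1 * B2 * d1
      + l * m * P * a * A1 * A2 * d2
  refine mul_left_cancel₀ (mul_ne_zero hA hB) ?_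
  linear_combination b * n * N * e3 + a * f3

end FayRelations

/-! ### Wave functions as a model of the elimination relations. -/

theorem constantCoeff_F (φ : TimeSeries) (L : Finset (Fin 2)) (i : Fin 2) :
    constantCoeff (F φ L i) = 1 := by
  rw [F_eq]; simp

theorem F_ne_zero (φ : TimeSeries) (L : Finset (Fin 2)) (i : Fin 2) : F φ L i ≠ 0 :=
  ne_zero_of_constantCoeff_eq_one (constantCoeff_F φ L i)

theorem S_F {i j : Fin 2} (h : j ≠ i) (φ : TimeSeries) : S j (F φ ∅ i) = F φ {j} i := by
  rw [F_eq, F_eq, insert_empty_eq, Finset.pair_comm]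
  simp only [map_sub, map_mul, map_one, algHom_C, S_param]
  rw [S_shiftHom (by simpa using h), S_shiftHom (by simp), insert_empty_eq]

theorem lam_ne_zero : lam ≠ 0 := par_ne_zero 0
theorem mu_ne_zero : mu ≠ 0 := par_ne_zero 1

theorem lam_add_mu_ne_zero : lam + mu ≠ 0 := fun h => by
  have := congrArg (coeff (single (Sum.inr 0) 1)) h
  rw [map_add, lam, mu, coeff_X, coeff_X, if_pos rfl, if_neg, map_zero, add_zero] at this
  · exact one_ne_zero this
  · intro h
    have := DFunLike.congr_fun h (Sum.inr 1)
    simp at this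

/-- Half of the difference `φ_{2[λ_i]} - φ`, shifted. -/
def delta (φ : TimeSeries) (L : Finset (Fin 2)) (i : Fin 2) : MiwaSeries :=
  C (1 / 2) * (shiftHom (insert i L) φ - shiftHom L φ)

theorem F_eq_delta (φ : TimeSeries) (L : Finset (Fin 2)) (i : Fin 2) :
    F φ L i = 1 - par i * delta φ L i := by
  rw [F_eq, delta]; ring

theorem S_delta {i j : Fin 2} (h : j ≠ i) (φ : TimeSeries) :
    S j (delta φ ∅ i) = delta φ {j} i := by
  rw [delta, delta, insert_empty_eq, Finset.pair_comm, map_mul, map_sub, algHom_C,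
    S_shiftHom (by simpa using h), S_shiftHom (by simp), insert_empty_eq]

theorem delta_add (φ : TimeSeries) : delta φ ∅ 0 + delta φ {0} 1 = delta φ ∅ 1 + delta φ {1} 0 := by
  simp only [delta, insert_empty_eq]
  rw [Finset.pair_comm]; ring

section Wave

variable {w wt : ℕ → TimeSeries} {k : ℂ}

/-- Multiplying by `w` and using `w w̃ = F` gives an equation without `w̃`. It can then be shifted
on its own, as `W` requires: there `w` is shifted by `2[μ]` further and `w̃` is not. -/
theorem dTime_evShift_source (hw : w 0 = 1) (hwt : wt 0 = 1)
    (h : BilinearIdentity w wt) (hθ : theta w = C k * pderiv ℂ 0 (phi w)) (i : Fin 2) :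
    dTime 0 (evShift i {i} w) * F (phi w) ∅ i = evShift i {i} w *
      (C (k + 1 / 2) * dTime 0 (F (phi w) ∅ i) - delta (phi w) ∅ i * F (phi w) ∅ i) := by
  have h1 := evShift_mul_evShift hw hwt h i
  have h2 := dTime_evShift_mul_evShift hw hwt h hθ i
  rw [delta, insert_empty_eq]
  linear_combination - dTime 0 (evShift i {i} w) * h1 + evShift i {i} w * h2

theorem C_add_C (k : ℂ) : (C (k + 1 / 2) + C (-k + 1 / 2) : MiwaSeries) = 1 := by
  rw [← map_add]; ring_nf; simp

theorem dTime_evShift_dual (hw : w 0 = 1) (hwt : wt 0 = 1)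
    (h : BilinearIdentity w wt) (hθ : theta w = C k * pderiv ℂ 0 (phi w)) (i : Fin 2) :
    dTime 0 (evShift i ∅ wt) * F (phi w) ∅ i = evShift i ∅ wt *
      (C (-k + 1 / 2) * dTime 0 (F (phi w) ∅ i) + delta (phi w) ∅ i * F (phi w) ∅ i) := by
  have h1 := evShift_mul_evShift hw hwt h i
  have h2 := dTime_evShift_mul_evShift hw hwt h hθ i
  have h3 := congrArg (dTime 0) h1
  rw [Derivation.leibniz, smul_eq_mul, smul_eq_mul] at h3
  have h4 := C_add_C k
  rw [delta, insert_empty_eq]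
  linear_combination - dTime 0 (evShift i ∅ wt) * h1 + evShift i ∅ wt * (h3 - h2)
    - evShift i ∅ wt * dTime 0 (F (phi w) ∅ i) * h4

theorem dTime_evShift_source_shift (hw : w 0 = 1) (hwt : wt 0 = 1)
    (h : BilinearIdentity w wt) (hθ : theta w = C k * pderiv ℂ 0 (phi w)) {i j : Fin 2}
    (hij : j ≠ i) :
    dTime 0 (evShift i {i, j} w) * F (phi w) {j} i = evShift i {i, j} w *
      (C (k + 1 / 2) * dTime 0 (F (phi w) {j} i) - delta (phi w) {j} i * F (phi w) {j} i) := by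
  have := congrArg (S j) (dTime_evShift_source hw hwt h hθ i)
  simp only [map_mul, map_sub, ← dTime_S, S_F hij, S_delta hij, algHom_C] at this
  rwa [S_evShift (by simpa using hij), Finset.pair_comm] at this

theorem delta_pair (φ : TimeSeries) :
    shiftHom {0, 1} φ - shiftHom ∅ φ = 2 * (delta φ ∅ 0 + delta φ {0} 1) := by
  simp only [delta, insert_empty_eq]
  rw [Finset.pair_comm]
  linear_combination - (shiftHom {1, 0} φ - shiftHom ∅ φ) * C_half_mul_two

/-- The relations between `F` and the wave functions at two Miwa shifts. -/
theorem fayRelations (hw : w 0 = 1) (hwt : wt 0 = 1)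
    (h : BilinearIdentity w wt) (hθ : theta w = C k * pderiv ℂ 0 (phi w)) :
    FayRelations (dTime 0) (C (k + 1 / 2)) (C (-k + 1 / 2)) lam mu (F (phi w) ∅ 0) (F (phi w) ∅ 1)
      (F (phi w) {1} 0) (F (phi w) {0} 1) (evShift 0 {0, 1} w * evShift 0 ∅ wt)
      (evShift 1 {0, 1} w * evShift 1 ∅ wt) := by
  have a0 := dTime_evShift_source_shift hw hwt h hθ (i := 0) (j := 1) (by decide)
  have a1 := dTime_evShift_source_shift hw hwt h hθ (i := 1) (j := 0) (by decide)
  rw [Finset.pair_comm] at a1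
  have b0 := dTime_evShift_dual hw hwt h hθ 0
  have b1 := dTime_evShift_dual hw hwt h hθ 1
  have hf := F_eq_delta (phi w) ∅ 0
  have hg := F_eq_delta (phi w) ∅ 1
  have hfm := F_eq_delta (phi w) {1} 0
  have hgl := F_eq_delta (phi w) {0} 1
  change _ = 1 - lam * _ at hf
  change _ = 1 - mu * _ at hg
  change _ = 1 - lam * _ at hfm
  change _ = 1 - mu * _ at hgl
  have hd := delta_add (phi w)
  have E1 := evShift_pair hw hwt h
  have E2 := dTime_evShift_pair hw hwt h hθ
  rw [delta_pair] at E1 E2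
  have h2 : (2 : MiwaSeries) ≠ 0 := two_ne_zero
  have hdd : ∀ a, dTime 0 (2 * a) = 2 * dTime 0 a := by
    intro a; rw [two_mul, map_add, two_mul]
  refine ⟨dTime_lam 0, dTime_mu 0, pderiv_C, C_add_C k, ?_, ?_, ?_, ?_, ?_,
    lam_ne_zero, mu_ne_zero, lam_add_mu_ne_zero, F_ne_zero _ _ _, F_ne_zero _ _ _,
    F_ne_zero _ _ _, F_ne_zero _ _ _, ?_, ?_⟩
  · rw [hf, hg, hfm, hgl]
    linear_combination lam * mu * hd
  · refine mul_left_cancel₀ h2 ?_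
    rw [hfm, hg]
    linear_combination E1 - 2 * (mu - lam) * lam * mu * hd
  · refine ⟨lam * (dTime 0 (evShift 0 {0, 1} w) * evShift 0 ∅ wt) +
      evShift 0 {0, 1} w * evShift 0 ∅ wt, mu * (dTime 0 (evShift 1 {0, 1} w) * evShift 1 ∅ wt) +
      evShift 1 {0, 1} w * evShift 1 ∅ wt, ?_, ?_, ?_⟩
    · linear_combination lam * evShift 0 ∅ wt * a0 -
        evShift 0 {0, 1} w * evShift 0 ∅ wt * F (phi w) {1} 0 * hfm
    · linear_combination mu * evShift 1 ∅ wt * a1 -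
        evShift 1 {0, 1} w * evShift 1 ∅ wt * F (phi w) {0} 1 * hgl
    · have hR : mu * F (phi w) {1} 0 + lam * F (phi w) ∅ 1 =
          lam + mu - lam * mu * (delta (phi w) ∅ 0 + delta (phi w) {0} 1) := by
        rw [hfm, hg]; linear_combination lam * mu * hd
      rw [hR]
      rw [hdd] at E2
      generalize delta (phi w) ∅ 0 + delta (phi w) {0} 1 = d at *
      have hR' : dTime 0 (lam + mu - lam * mu * d) = - (lam * mu * dTime 0 d) := by
        simp only [map_sub, map_add, Derivation.leibniz, dTime_lam, dTime_mu, smul_eq_mul]; ring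
      rw [hR']
      have hh := C_half_mul_two
      generalize (C (1 / 2 : ℂ) : MiwaSeries) = c at *
      refine mul_left_cancel₀ h2 ?_
      linear_combination E2 - (lam - mu) * lam ^ 2 * mu ^ 2 * 2 * d ^ 2 * hh
  · rw [Derivation.leibniz, smul_eq_mul, smul_eq_mul]
    linear_combination lam * F (phi w) ∅ 0 * evShift 0 ∅ wt * a0 +
      lam * F (phi w) {1} 0 * evShift 0 {0, 1} w * b0 +
      F (phi w) ∅ 0 * F (phi w) {1} 0 * evShift 0 {0, 1} w * evShift 0 ∅ wt * (hf - hfm)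
  · rw [Derivation.leibniz, smul_eq_mul, smul_eq_mul]
    linear_combination mu * F (phi w) ∅ 1 * evShift 1 ∅ wt * a1 +
      mu * F (phi w) {0} 1 * evShift 1 {0, 1} w * b1 +
      F (phi w) ∅ 1 * F (phi w) {0} 1 * evShift 1 {0, 1} w * evShift 1 ∅ wt * (hg - hgl)
  · exact ne_zero_of_constantCoeff_eq_one (by simp [constantCoeff_evShift, hw, hwt])
  · exact ne_zero_of_constantCoeff_eq_one (by simp [constantCoeff_evShift, hw, hwt])

end Wave

/-! ### Expansions -/

theorem cf_mul (i : Fin 2) (j : ℕ) (a b : MiwaSeries) :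
    cf i j (a * b) = ∑ p ∈ Finset.HasAntidiagonal.antidiagonal j, cf i p.1 a * cf i p.2 b := by
  induction j generalizing a with
  | zero => simp [cf_zero_mul]
  | succ j ih =>
    obtain ⟨c, hc, hcf⟩ := exists_eq_add_par_mul i a
    rw [Finset.Nat.sum_antidiagonal_succ]
    conv_lhs => rw [hc, add_mul, map_add, mul_assoc, cf_succ_par_mul, cf_free_mul (free_cf _ _ _),
      ih]
    simp only [hcf]

theorem cf_one_mul (i : Fin 2) (a b : MiwaSeries) :
    cf i 1 (a * b) = cf i 0 a * cf i 1 b + cf i 1 a * cf i 0 b := by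
  rw [cf_mul, Finset.Nat.sum_antidiagonal_eq_sum_range_succ_mk]
  simp [Finset.sum_range_succ]

theorem cf_two_mul (i : Fin 2) (a b : MiwaSeries) :
    cf i 2 (a * b) = cf i 0 a * cf i 2 b + cf i 1 a * cf i 1 b + cf i 2 a * cf i 0 b := by
  rw [cf_mul, Finset.Nat.sum_antidiagonal_eq_sum_range_succ_mk]
  simp [Finset.sum_range_succ]

/-- Low orders of `exp(2λ∂₁ + (2/3)λ³∂₃ + ⋯) = 1 + 2λ∂₁ + 2λ²∂₁² + λ³((4/3)∂₁³ + (2/3)∂₃) + ⋯`,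
obtained here and below from the Euler recursion. -/
theorem cf_one_S {i : Fin 2} {a : MiwaSeries} (ha : Free i a) : cf i 1 (S i a) = 2 * dTime 0 a := by
  have := natCast_mul_cf_S ha (j := 1) (N := 1) (by norm_num)
  simpa [cf_zero_S (ha.dTime 0)] using this

theorem cf_two_S {i : Fin 2} {a : MiwaSeries} (ha : Free i a) :
    cf i 2 (S i a) = 2 * dTime 0 (dTime 0 a) := by
  have := natCast_mul_cf_S ha (j := 2) (N := 1) (by norm_num)
  simp [cf_one_S (ha.dTime 0)] at this
  exact this

theorem cf_three_S {i : Fin 2} {a : MiwaSeries} (ha : Free i a) :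
    3 * cf i 3 (S i a) = 4 * dTime 0 (dTime 0 (dTime 0 a)) + 2 * dTime 1 a := by
  have := natCast_mul_cf_S ha (j := 3) (N := 2) (by norm_num)
  simp [Finset.sum_range_succ, cf_two_S (ha.dTime 0), cf_zero_S (ha.dTime 1)] at this
  rw [this]; ring

/-! ### Differential algebra -/

section DifferentialAlgebra

variable {A : Type*} [CommRing A] [IsDomain A] [CharZero A] [Algebra ℂ A]

/-- The two lowest order consequences of the relation for generic `k` force `u'' = 0`. -/
theorem derivation_eq_zero_of_relations {D E : Derivation ℂ A A} (hDE : ∀ a, D (E a) = E (D a))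
    {u : A} (h1 : D (D u * D (D u)) = 0)
    (h2 : D (D (D u * (2 * D (D (D u)) + E u))) + 3 * D (D (D u) * D (D (D u))) +
      12 * (D u) ^ 2 * D (D u) = 0) : D (D u) = 0 := by
  obtain ⟨Y, hY⟩ : ∃ Y, Y = D u := ⟨_, rfl⟩
  obtain ⟨y1, hy1⟩ : ∃ y, y = D Y := ⟨_, rfl⟩
  obtain ⟨y2, hy2⟩ : ∃ y, y = D y1 := ⟨_, rfl⟩
  obtain ⟨v, hv⟩ : ∃ v, v = E u := ⟨_, rfl⟩
  obtain ⟨Y3, hY3⟩ : ∃ y, y = E Y := ⟨_, rfl⟩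
  obtain ⟨z, hz⟩ : ∃ y, y = E y1 := ⟨_, rfl⟩
  obtain ⟨h, hh⟩ : ∃ h, h = Y * y1 := ⟨_, rfl⟩
  obtain ⟨h3, hh3⟩ : ∃ y, y = E h := ⟨_, rfl⟩
  have dv : D v = Y3 := by rw [hv, hDE, hY3, hY]
  have dY3 : D Y3 = z := by rw [hY3, hDE, hz, hy1]
  have h3eq : h3 = Y3 * y1 + Y * z := by
    rw [hh3, hh, Derivation.leibniz, smul_eq_mul, smul_eq_mul, ← hz, ← hY3]; ring
  rw [← hY, ← hy1, ← hy2, ← hv] at h2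
  rw [← hY, ← hy1, ← hh] at h1
  rw [← hY, ← hy1]
  -- `h = u' u''` is a constant of `D`, hence so is `E h`, because `D` and `E` commute. The aim is
  -- an equation for `E h` contradicting this when `u'' ≠ 0`.
  have dh3 : D h3 = 0 := by rw [hh3, hDE, h1, map_zero]
  have e0 : Y * y2 + y1 ^ 2 = 0 := by
    have := h1
    rw [hh, Derivation.leibniz, ← hy1, ← hy2, smul_eq_mul, smul_eq_mul] at this
    linear_combination this
  by_contra hy
  by_cases hY0 : Y = 0
  · rw [hY0, map_zero] at hy1
    exact hy hy1
  have hh0 : h ≠ 0 := by rw [hh]; exact mul_ne_zero hY0 hy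
  have D2 : D (2 : A) = 0 := by simpa using Derivation.map_natCast D 2
  have e1 : D (D (Y * v)) * 2 - D (D (y1 * y1)) + 24 * Y ^ 2 * y1 = 0 := by
    have t1 : Y * (2 * y2 + v) = Y * v - 2 * (y1 * y1) := by linear_combination 2 * e0
    have t2 : D (y1 * y1) = 2 * (y1 * y2) := by
      rw [Derivation.leibniz, ← hy2, smul_eq_mul]; ring
    have t3 : D (D (y1 * y1)) = 2 * D (y1 * y2) := by
      rw [t2, Derivation.leibniz, D2]; simp
    rw [t1] at h2
    simp only [map_sub] at h2
    have t4 : D (D (2 * (y1 * y1))) = 2 * D (D (y1 * y1)) := by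
      rw [two_mul, map_add, map_add, two_mul]
    rw [t4] at h2
    linear_combination 2 * h2 + 3 * t3
  have e2 : Y ^ 2 * D (D (y1 * y1)) = 8 * y1 ^ 4 := by
    have t1 := congrArg D e0
    simp only [map_add, Derivation.leibniz, Derivation.leibniz_pow, ← hy1, ← hy2, smul_eq_mul,
      map_zero, nsmul_eq_mul] at t1 ⊢
    push_cast at t1
    ring_nf at t1
    linear_combination 2 * Y * y1 * t1 + (2 * Y * y2 - 8 * y1 ^ 2) * e0
  have e3 : Y ^ 2 * h3 + Y * h * Y3 - h * y1 * v - 4 * y1 ^ 4 + 12 * Y ^ 3 * y1 * Y = 0 := by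
    refine mul_left_cancel₀ (two_ne_zero (α := A)) ?_
    have t1 : D (D (Y * v)) = Y * z + 2 * y1 * Y3 + y2 * v := by
      simp only [map_add, Derivation.leibniz, ← hy1, ← hy2, dv, dY3, smul_eq_mul]; ring
    rw [t1] at e1
    rw [h3eq, hh]
    linear_combination Y ^ 2 * e1 + e2 - 2 * v * Y * e0
  have e4 : h * h3 * Y + 3 * y1 ^ 5 + 12 * Y ^ 2 * h ^ 2 = 0 := by
    have t1 := congrArg D e3
    have D4 : D (4 : A) = 0 := by simpa using Derivation.map_natCast D 4
    have D12 : D (12 : A) = 0 := by simpa using Derivation.map_natCast D 12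
    simp only [map_add, map_sub, Derivation.leibniz, Derivation.leibniz_pow, ← hy1, ← hy2, dv, dY3,
      dh3, h1, D4, D12, smul_eq_mul, map_zero, nsmul_eq_mul] at t1
    push_cast at t1
    refine mul_left_cancel₀ (by norm_num : (4 : A) ≠ 0) ?_
    rw [h3eq, hh] at t1 e3 ⊢
    linear_combination Y * t1 + y1 * e3 - (-(Y * y1) * v - 16 * y1 ^ 3 + 12 * Y ^ 4) * e0
  have e5 : h ^ 2 * h3 - 15 * y1 ^ 6 + 24 * Y * h ^ 3 = 0 := by
    have t1 := congrArg D e4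
    have D3 : D (3 : A) = 0 := by simpa using Derivation.map_natCast D 3
    have D12 : D (12 : A) = 0 := by simpa using Derivation.map_natCast D 12
    simp only [map_add, Derivation.leibniz, Derivation.leibniz_pow, ← hy1, ← hy2,
      dh3, h1, D3, D12, smul_eq_mul, map_zero, nsmul_eq_mul] at t1
    push_cast at t1
    rw [hh] at t1 ⊢
    linear_combination Y * t1 - 15 * y1 ^ 4 * e0
  -- In `e5 + 5 u'' e4` the powers `u''^6` cancel. Applying `D` to the result kills `h3` and leaves
  -- `14 h u'' = 0`.
  have e6 : h3 = -(14 * h * Y) := by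
    have : (6 : A) * h ^ 2 ≠ 0 := mul_ne_zero (by norm_num) (pow_ne_zero 2 hh0)
    refine mul_left_cancel₀ this ?_
    rw [hh] at e4 e5 ⊢
    linear_combination e5 + 5 * y1 * e4
  have e7 := congrArg D e6
  have D14 : D (14 : A) = 0 := by simpa using Derivation.map_natCast D 14
  simp only [map_neg, Derivation.leibniz, dh3, h1, D14, ← hy1, smul_eq_mul] at e7
  have : (14 : A) * h * y1 = 0 := by linear_combination e7
  exact mul_ne_zero (mul_ne_zero (by norm_num) hh0) hy this

/-- The relation for generic `k` forces `f' = 0` if `f''' = 0`. -/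
theorem derivation_eq_zero_of_quadratic {D : Derivation ℂ A A} {f : A} (hf : f ≠ 0)
    (h3 : D (D (D f)) = 0) (hq : f ^ 2 * (D (D f)) ^ 2 - 4 * f * (D f) ^ 2 * D (D f)
      + 2 * (D f) ^ 4 = 0) : D f = 0 := by
  have h4 := congrArg D hq
  have D2 : D (2 : A) = 0 := by simpa using Derivation.map_natCast D 2
  have D4 : D (4 : A) = 0 := by simpa using Derivation.map_natCast D 4
  simp only [map_add, map_sub, Derivation.leibniz, Derivation.leibniz_pow, h3, D2, D4, smul_eq_mul,
    map_zero, nsmul_eq_mul] at h4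
  push_cast at h4
  generalize D (D f) = f2 at *
  generalize D f = f1 at *
  by_contra h1
  have hf2 : f2 ≠ 0 := by
    rintro rfl
    have : 2 * f1 ^ 4 = 0 := by linear_combination hq
    exact h1 (by simpa using this)
  -- With `f''' = 0`, the derivative of the quadratic relation is `2 f' f'' (2 f'² - 3 f f'')`;
  -- substituting back yields `(f f'')² = 0`.
  have h5 : 2 * f1 ^ 2 - 3 * (f * f2) = 0 := by
    have : 2 * f1 * f2 ≠ 0 := mul_ne_zero (mul_ne_zero two_ne_zero h1) hf2
    refine mul_left_cancel₀ this ?_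
    ring_nf at h4 ⊢
    linear_combination h4
  have h6 : (f * f2) ^ 2 = 0 := by
    linear_combination (-2 : A) * hq + (2 * f1 ^ 2 - f * f2) * h5
  exact mul_ne_zero hf hf2 (by simpa using h6)

end DifferentialAlgebra

/-! ### The generic case -/

/-- `φ_{2[λ]} - φ` already vanishes at `λ = 0`, so `F(λ) = 1 + O(λ²)`. -/
theorem cf_F (φ : TimeSeries) {L : Finset (Fin 2)} {i : Fin 2} (h : i ∉ L) :
    cf i 0 (F φ L i) = 1 ∧ cf i 1 (F φ L i) = 0 := by
  rw [F_eq, mul_comm (C _), mul_assoc]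
  have h1 : cf i 0 (C (1 / 2) * (shiftHom (insert i L) φ - shiftHom L φ)) = 0 := by
    rw [cf_free_mul (Free.C _ _), map_sub, ← S_shiftHom h, cf_zero_S (free_shiftHom h φ),
      cf_zero_of_free (free_shiftHom h φ), sub_self, mul_zero]
  constructor
  · rw [map_sub, cf_zero_par_mul, cf_zero_of_free (Free.one i), sub_zero]
  · rw [map_sub, cf_of_free (Free.one i) one_ne_zero, zero_sub]
    have := cf_succ_par_mul i 0 (C (1 / 2) * (shiftHom (insert i L) φ - shiftHom L φ))
    rw [zero_add] at this
    rw [this, h1, neg_zero]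

theorem free_F (φ : TimeSeries) {L : Finset (Fin 2)} {i j : Fin 2} (hij : i ≠ j) (h : j ∉ L) :
    Free j (F φ L i) := by
  rw [F_eq]
  exact (Free.one j).sub (((Free.C _ _).mul (Free.par hij)).mul
    ((free_shiftHom (by simpa [hij.symm] using h) φ).sub (free_shiftHom h φ)))

section Generic

variable (φ : TimeSeries)

theorem cf_F_pair : cf 1 0 (F φ {1} 0) = F φ ∅ 0 ∧ cf 1 1 (F φ {1} 0) = 2 * dTime 0 (F φ ∅ 0) := by
  rw [← S_F (by decide)]
  have := free_F φ (i := 0) (j := 1) (L := ∅) (by decide) (by simp)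
  exact ⟨cf_zero_S this, cf_one_S this⟩

theorem free_lam : Free 1 lam := Free.par (by decide)

theorem cf_mu_mul (a : MiwaSeries) : cf 1 0 (mu * a) = 0 ∧ cf 1 1 (mu * a) = cf 1 0 a :=
  ⟨cf_zero_par_mul 1 a, cf_succ_par_mul 1 0 a⟩

/-- At `μ = 0` this factor, and likewise the next one, reduces to `λ F(λ)`. -/
theorem relation_factor_ne_zero (K : ℂ) {n : MiwaSeries} :
    F φ {1} 0 * F φ ∅ 1 * (mu * F φ {1} 0 + lam * F φ ∅ 1) - C K * (lam * mu * n) ≠ 0 := by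
  intro h
  have := congrArg (cf 1 0) h
  rw [map_sub, cf_free_mul (Free.C _ _), mul_assoc lam, cf_free_mul free_lam, (cf_mu_mul n).1,
    cf_zero_mul, cf_zero_mul, map_add, (cf_mu_mul _).1, cf_free_mul free_lam, (cf_F_pair φ).1,
    (cf_F φ (by simp)).1, map_zero, mul_zero, mul_zero, mul_one, mul_one, zero_add,
    sub_zero] at this
  exact mul_ne_zero (F_ne_zero _ _ _) lam_ne_zero this

theorem relation_factor_ne_zero' (K : ℂ) {n : MiwaSeries} :
    F φ {0} 1 * F φ ∅ 0 * (mu * F φ {1} 0 + lam * F φ ∅ 1) - C K * (lam * mu * n) ≠ 0 := by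
  intro h
  have := congrArg (cf 1 0) h
  rw [map_sub, cf_free_mul (Free.C _ _), mul_assoc lam, cf_free_mul free_lam, (cf_mu_mul n).1,
    cf_zero_mul, cf_zero_mul, map_add, (cf_mu_mul _).1, cf_free_mul free_lam,
    (cf_F φ (by simp)).1, (cf_F φ (by simp)).1,
    cf_zero_of_free (free_F φ (by decide) (by simp)), map_zero, mul_zero, mul_zero, mul_one,
    one_mul, zero_add, sub_zero] at this
  exact mul_ne_zero (F_ne_zero _ _ _) lam_ne_zero this

/-- The first order in `μ` of the relation obtained by elimination. -/
theorem first_order_relation {a b n p R f : MiwaSeries} (hf : f = F φ ∅ 0)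
    (ha : a = F φ {1} 0 * F φ ∅ 1)
    (hb : b = F φ {0} 1 * F φ ∅ 0)
    (hn : n = dTime 0 (F φ {1} 0) * F φ ∅ 1 - F φ {1} 0 * dTime 0 (F φ ∅ 1))
    (hp : p = dTime 0 (F φ {0} 1) * F φ ∅ 0 - F φ {0} 1 * dTime 0 (F φ ∅ 0))
    (hR : R = mu * F φ {1} 0 + lam * F φ ∅ 1)
    (h : b ^ 2 * n * ((dTime 0 n * a - n * dTime 0 a) * R - n * a * dTime 0 R) =
      a ^ 2 * p * ((dTime 0 p * b - p * dTime 0 b) * R - p * b * dTime 0 R)) :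
    f ^ 2 * ((dTime 0 (dTime 0 f)) ^ 2 + dTime 0 f * dTime 0 (dTime 0 (dTime 0 f))) -
      4 * f * (dTime 0 f) ^ 2 * dTime 0 (dTime 0 f) + 2 * (dTime 0 f) ^ 4 = 0 := by
  have fm0 := (cf_F_pair φ).1
  have fm1 := (cf_F_pair φ).2
  obtain ⟨g0, g1⟩ := cf_F φ (L := ∅) (i := 1) (by simp)
  obtain ⟨gl0, gl1⟩ := cf_F φ (L := {0}) (i := 1) (by simp)
  have hff : Free 1 (F φ ∅ 0) := free_F φ (by decide) (by simp)
  have f0 := cf_zero_of_free hff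
  have f1 := cf_of_free hff one_ne_zero
  rw [← hf] at fm0 fm1 f0 f1 hb hp
  have D2 : dTime 0 (2 : MiwaSeries) = 0 := by simpa using Derivation.map_natCast (dTime 0) 2
  have D1 : dTime 0 (1 : MiwaSeries) = 0 := Derivation.map_one_eq_zero _
  have a0 : cf 1 0 a = f := by rw [ha, cf_zero_mul, fm0, g0, mul_one]
  have a1 : cf 1 1 a = 2 * dTime 0 f := by rw [ha, cf_one_mul, fm1, g0, g1]; ring
  have b0 : cf 1 0 b = f := by rw [hb, cf_zero_mul, f0, gl0, one_mul]
  have b1 : cf 1 1 b = 0 := by rw [hb, cf_one_mul, f1, gl0, gl1]; ring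
  have n0 : cf 1 0 n = dTime 0 f := by
    rw [hn, map_sub, cf_zero_mul, cf_zero_mul, cf_dTime, cf_dTime, fm0, g0, D1]; ring
  have n1 : cf 1 1 n = 2 * dTime 0 (dTime 0 f) := by
    rw [hn, map_sub, cf_one_mul, cf_one_mul]
    simp only [cf_dTime, fm0, fm1, g0, g1, D1, map_zero, Derivation.leibniz, D2, smul_eq_mul]
    ring
  have p0 : cf 1 0 p = - dTime 0 f := by
    rw [hp, map_sub, cf_zero_mul, cf_zero_mul, cf_dTime, cf_dTime, f0, gl0, D1]; ring
  have p1 : cf 1 1 p = 0 := by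
    rw [hp, map_sub, cf_one_mul, cf_one_mul]
    simp only [cf_dTime, f0, f1, gl0, gl1, D1, map_zero]
    ring
  have R0 : cf 1 0 R = lam := by
    rw [hR, map_add, (cf_mu_mul _).1, cf_free_mul free_lam, g0]; ring
  have R1 : cf 1 1 R = f := by
    rw [hR, map_add, (cf_mu_mul _).2, cf_free_mul free_lam, g1, fm0]; ring
  -- At `μ = 0` one has `a = b = f`, `n = f'`, `p = -f'`, and the signs cancel, so order zero is
  -- vacuous. Order one is the first condition on `f`.
  have h1 := congrArg (cf 1 1) h
  simp only [pow_two, map_sub, cf_one_mul, cf_zero_mul, cf_dTime, a0, a1, b0, b1, n0, n1, p0, p1,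
    R0, R1, dTime_lam, map_neg, map_zero, Derivation.leibniz, D2, smul_eq_mul] at h1
  have hf0 : f ≠ 0 := by rw [hf]; exact F_ne_zero _ _ _
  refine mul_left_cancel₀ (mul_ne_zero two_ne_zero (mul_ne_zero lam_ne_zero (pow_ne_zero 2 hf0))) ?_
  generalize dTime 0 (dTime 0 (dTime 0 f)) = f3 at *
  generalize dTime 0 (dTime 0 f) = f2 at *
  generalize dTime 0 f = f' at *
  linear_combination f * h1

end Generic

theorem dTime_F (φ : TimeSeries) (i : Fin 2) : dTime 0 (F φ ∅ i) =
    par i * -(C (1 / 2) * (S i (shiftHom ∅ (pderiv ℂ 0 φ)) - shiftHom ∅ (pderiv ℂ 0 φ))) := by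
  rw [F_eq, S_shiftHom (by simp), map_sub, Derivation.map_one_eq_zero, Derivation.leibniz,
    Derivation.leibniz, dTime_X_param, pderiv_C, map_sub, dTime_shiftHom, dTime_shiftHom]
  simp only [smul_eq_mul]; ring

/-- The relation for generic `k` forces `F(λ)` not to depend on `t₁`. -/
theorem dTime_F_eq_zero (φ : TimeSeries)
    (h : ∀ f, f = F φ ∅ 0 →
      f ^ 2 * ((dTime 0 (dTime 0 f)) ^ 2 + dTime 0 f * dTime 0 (dTime 0 (dTime 0 f))) -
        4 * f * (dTime 0 f) ^ 2 * dTime 0 (dTime 0 f) + 2 * (dTime 0 f) ^ 4 = 0) :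
    dTime 0 (F φ ∅ 0) = 0 := by
  obtain ⟨f, hf⟩ : ∃ f, f = F φ ∅ 0 := ⟨_, rfl⟩
  have hK := h f hf
  rw [← hf]
  obtain ⟨u, hu⟩ : ∃ u, u = shiftHom ∅ (pderiv ℂ 0 φ) := ⟨_, rfl⟩
  have hfree : Free 0 u := by rw [hu]; exact free_shiftHom (by simp) _
  have hD1 := dTime_F φ 0
  rw [← hf, ← hu] at hD1
  obtain ⟨q, hq, hqcf⟩ := exists_eq_add_par_mul 0 (S 0 u)
  rw [cf_zero_S hfree] at hq
  obtain ⟨y, hy⟩ : ∃ y, y = -(C (1 / 2) * q) := ⟨_, rfl⟩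
  -- As `F(λ) = 1 + O(λ²)`, the factor `λ²` is split off; `y` starts with `-u'`, where `u = φ_{t₁}`.
  have hfy : dTime 0 f = lam ^ 2 * y := by
    rw [hD1, hq, hy]; change lam * -(C (1 / 2) * (u + lam * q - u)) = _; ring
  have hhalf := C_half_mul_two
  have y0 : cf 0 0 y = - dTime 0 u := by
    rw [hy, map_neg, cf_free_mul (Free.C _ _), hqcf, cf_one_S hfree, ← mul_assoc, hhalf, one_mul]
  have y1 : cf 0 1 y = - dTime 0 (dTime 0 u) := by
    rw [hy, map_neg, cf_free_mul (Free.C _ _), hqcf, cf_two_S hfree, ← mul_assoc, hhalf, one_mul]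
  have y2 : 3 * cf 0 2 y = - (2 * dTime 0 (dTime 0 (dTime 0 u)) + dTime 1 u) := by
    rw [hy, map_neg, cf_free_mul (Free.C _ _), hqcf]
    linear_combination -C (1 / 2) * cf_three_S hfree -
      (2 * dTime 0 (dTime 0 (dTime 0 u)) + dTime 1 u) * hhalf
  obtain ⟨f0, f1⟩ := cf_F φ (L := ∅) (i := 0) (by simp)
  rw [← hf] at f0 f1
  have hdl : ∀ a, dTime 0 (lam ^ 2 * a) = lam ^ 2 * dTime 0 a := by
    intro a; simp [Derivation.leibniz_pow]
  have hK2 : f ^ 2 * dTime 0 (y * dTime 0 y) - lam ^ 2 * (4 * f * y ^ 2 * dTime 0 y) +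
      lam ^ 4 * (2 * y ^ 4) = 0 := by
    rw [hfy, hdl, hdl] at hK
    refine mul_left_cancel₀ (pow_ne_zero 4 lam_ne_zero) ?_
    rw [Derivation.leibniz, smul_eq_mul, smul_eq_mul]
    linear_combination hK
  -- Orders `0` and `2` in `λ` are the two hypotheses of `derivation_eq_zero_of_relations` for `D =
  -- ∂_{t₁}`, `E = ∂_{t₃}`, the latter up to a factor `3`.
  have k0 := congrArg (cf 0 0) hK2
  have k2 := congrArg (cf 0 2) hK2
  have l2 := fun a j => cf_par_pow_mul 0 j 2 a
  have l4 := fun a j => cf_par_pow_mul 0 j 4 a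
  change ∀ a j, cf 0 j (lam ^ 2 * a) = _ at l2
  change ∀ a j, cf 0 j (lam ^ 4 * a) = _ at l4
  have c4 : ∀ a, cf 0 0 (4 * f * a) = 4 * cf 0 0 a := by
    intro a
    have : Free 0 (4 : MiwaSeries) := by
      unfold Free; simpa using Derivation.map_natCast (dParam 0) 4
    rw [mul_assoc, cf_free_mul this, cf_zero_mul, f0, one_mul]
  rw [map_add, map_sub, l2, l4, if_neg (by norm_num), if_neg (by norm_num), cf_zero_mul, pow_two,
    cf_zero_mul, f0, one_mul, one_mul, cf_dTime, cf_zero_mul, cf_dTime, y0, map_zero, sub_zero,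
    add_zero] at k0
  rw [map_add, map_sub, l2, l4, if_pos (by norm_num), if_neg (by norm_num), pow_two f, cf_two_mul,
    cf_one_mul, cf_zero_mul, f0, f1, Nat.sub_self, mul_assoc (4 * f), c4, cf_zero_mul, pow_two y,
    cf_zero_mul, cf_dTime, cf_dTime, cf_dTime, cf_dTime, cf_two_mul, cf_zero_mul, cf_dTime,
    cf_dTime, cf_dTime, y0, y1, k0, map_zero] at k2
  have hDE : ∀ a, dTime 0 (dTime 1 a) = dTime 1 (dTime 0 a) := fun a => pderiv_comm _ _ a
  have hu2 : dTime 0 (dTime 0 u) = 0 := by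
    refine derivation_eq_zero_of_relations hDE (u := u) ?_ ?_
    · simpa using k0
    · have e : dTime 0 u * (2 * dTime 0 (dTime 0 (dTime 0 u)) + dTime 1 u) =
          3 * (cf 0 2 y * -dTime 0 u) := by linear_combination (dTime 0 u) * y2
      rw [e]
      have D3 : ∀ a : MiwaSeries, dTime 0 (3 * a) = 3 * dTime 0 a := by
        intro a
        have : dTime 0 (3 : MiwaSeries) = 0 := by simpa using Derivation.map_natCast (dTime 0) 3
        rw [Derivation.leibniz, this]; simp
      rw [D3, D3]
      have e2 : dTime 0 (cf 0 2 y * -dTime 0 u) =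
          -dTime 0 u * dTime 0 (cf 0 2 y) + cf 0 2 y * dTime 0 (-dTime 0 u) := by
        rw [Derivation.leibniz, smul_eq_mul, smul_eq_mul]; ring
      have e3 : -dTime 0 (dTime 0 u) * dTime 0 (-dTime 0 (dTime 0 u)) =
          dTime 0 (dTime 0 u) * dTime 0 (dTime 0 (dTime 0 u)) := by rw [map_neg]; ring
      rw [e3, map_add, map_add] at k2
      rw [e2, map_add]
      rw [map_neg (dTime 0) (dTime 0 u)] at *
      linear_combination 3 * k2
  have hf3 : dTime 0 (dTime 0 (dTime 0 f)) = 0 := by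
    rw [hD1]
    change dTime 0 (dTime 0 (lam * _)) = 0
    have hdl1 : ∀ a, dTime 0 (lam * a) = lam * dTime 0 a := by intro a; simp
    have hdc : ∀ a, dTime 0 (C (1 / 2) * a) = C (1 / 2) * dTime 0 a := by
      intro a; rw [Derivation.leibniz, pderiv_C]; simp
    rw [hdl1, hdl1, map_neg, map_neg, hdc, hdc, map_sub, map_sub, dTime_S, dTime_S, hu2, map_zero,
      sub_self, mul_zero, neg_zero, mul_zero]
  refine derivation_eq_zero_of_quadratic (by rw [hf]; exact F_ne_zero _ _ _) hf3 ?_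
  linear_combination hK - f ^ 2 * dTime 0 f * hf3

/-! ### The ratio of the two wave products. -/

theorem swapHom_F (φ : TimeSeries) : swapHom (F φ ∅ 0) = F φ ∅ 1 := by
  rw [F_eq, F_eq, insert_empty_eq, insert_empty_eq, map_sub, map_mul, map_mul, map_sub, algHom_C,
    swapHom_param, swapHom_shiftHom, swapHom_shiftHom, map_one]
  simp

theorem pow'_mul_pow'_of_eq {σ : Type*} {x y W U : MvPowerSeries σ ℂ}
    (hx : constantCoeff x = 1) (hy : constantCoeff y = 1) (hW : constantCoeff W = 1)
    (hU : constantCoeff U = 1) (h : W * x = U * y) (α : ℂ) :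
    pow' W α * pow' x α = pow' U α * pow' y α := by
  rw [← mul_pow' hW hx, h, mul_pow' hU hy]

/-- The ratio of the two products of wave functions in terms of `F`. -/
theorem wave_mul_pow {w wt : ℕ → TimeSeries} {k : ℂ} (hw : w 0 = 1) (hwt : wt 0 = 1)
    (h : BilinearIdentity w wt) (hθ : theta w = C k * pderiv ℂ 0 (phi w)) :
    evShift 0 {0, 1} w * evShift 0 ∅ wt *
        (pow' (F (phi w) {0} 1) (k + 1 / 2) * pow' (F (phi w) ∅ 1) (-k + 1 / 2)) =
      evShift 1 {0, 1} w * evShift 1 ∅ wt *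
        (pow' (F (phi w) {1} 0) (k + 1 / 2) * pow' (F (phi w) ∅ 0) (-k + 1 / 2)) := by
  have H := fayRelations hw hwt h hθ
  have hW : constantCoeff (evShift 0 {0, 1} w * evShift 0 ∅ wt) = 1 := by
    simp [constantCoeff_evShift, hw, hwt]
  have hU : constantCoeff (evShift 1 {0, 1} w * evShift 1 ∅ wt) = 1 := by
    simp [constantCoeff_evShift, hw, hwt]
  have hA := fun K n => relation_factor_ne_zero (phi w) K (n := n)
  have hB := fun K n => relation_factor_ne_zero' (phi w) K (n := n)
  have hf := constantCoeff_F (phi w) ∅ 0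
  have hg := constantCoeff_F (phi w) ∅ 1
  have hfm := constantCoeff_F (phi w) {1} 0
  have hgl := constantCoeff_F (phi w) {0} 1
  have r1 := H.first_relation
  have r2 := H.second_relation
  have hR : mu * F (phi w) {1} 0 + lam * F (phi w) ∅ 1 ≠ 0 := by
    intro h0
    refine hA 0 0 ?_
    rw [h0]; simp
  by_cases hk0 : k = 0
  · subst hk0
    rw [neg_zero] at *
    have hsq := H.sq_relation (hA _ _) (hB _ _)
    rw [zero_add]
    have h2 : ∀ x : MiwaSeries, constantCoeff x = 1 →
        pow' x (1 / 2) * pow' x (1 / 2) = x := by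
      intro x hx
      rw [← pow'_add hx, add_halves, pow'_one hx]
    refine (mul_self_eq_mul_self_iff.1 ?_).resolve_right ?_
    · linear_combination hsq + (evShift 0 {0, 1} w * evShift 0 ∅ wt) ^ 2 *
        (pow' (F (phi w) ∅ 1) (1 / 2) ^ 2 * h2 _ hgl + F (phi w) {0} 1 * h2 _ hg) -
        (evShift 1 {0, 1} w * evShift 1 ∅ wt) ^ 2 *
        (pow' (F (phi w) ∅ 0) (1 / 2) ^ 2 * h2 _ hfm + F (phi w) {1} 0 * h2 _ hf)
    · intro h0
      have := congrArg constantCoeff h0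
      rw [map_neg, map_mul, map_mul _ (_ * _) (_ * _), hW, hU, map_mul, map_mul,
        constantCoeff_pow' hf, constantCoeff_pow' hg, constantCoeff_pow' hfm,
        constantCoeff_pow' hgl] at this
      norm_num at this
  generalize evShift 0 {0, 1} w * evShift 0 ∅ wt = W at *
  generalize evShift 1 {0, 1} w * evShift 1 ∅ wt = U at *
  by_cases hk1 : k + 1 / 2 = 0
  -- For `K = 0` the derivative terms drop out of `first_relation`; for `Kt = 0`, below, the same
  -- happens to `second_relation`.
  · have hk2 : -k + 1 / 2 = 1 := by linear_combination -hk1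
    rw [hk1, hk2, pow'_zero hgl, pow'_zero hfm, pow'_one hg, pow'_one hf]
    rw [hk1, map_zero] at r1
    refine mul_left_cancel₀ (mul_ne_zero hR (mul_ne_zero H.fm_ne H.gl_ne)) ?_
    linear_combination r1
  by_cases hk2 : -k + 1 / 2 = 0
  · have hk1 : k + 1 / 2 = 1 := by linear_combination -hk2
    rw [hk1, hk2, pow'_zero hg, pow'_zero hf, pow'_one hgl, pow'_one hfm]
    rw [hk2, map_zero] at r2
    refine mul_left_cancel₀ (mul_ne_zero hR (mul_ne_zero H.f_ne H.g_ne)) ?_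
    linear_combination r2
  have hC : ∀ c : ℂ, c ≠ 0 → (C c : MiwaSeries) ≠ 0 := by
    intro c hc h0
    apply hc
    simpa using congrArg constantCoeff h0
  have hKK : (C (k + 1 / 2) - C (-k + 1 / 2) : MiwaSeries) ≠ 0 := by
    rw [← map_sub]
    refine hC _ ?_
    intro h0
    apply hk0
    linear_combination (1 / 2) * h0
  have hDf : dTime 0 (F (phi w) ∅ 0) = 0 := by
    refine dTime_F_eq_zero (phi w) fun f hf => first_order_relation (phi w) hf rfl rfl rfl rfl rfl ?_
    exact H.generic_relation (hC _ hk1) (hC _ hk2) hKK rfl rfl rfl rfl rfl (hA _ _) (hA _ _) hR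
  have hDg : dTime 0 (F (phi w) ∅ 1) = 0 := by
    rw [← swapHom_F, dTime_swapHom, hDf, map_zero]
  have hDfm : dTime 0 (F (phi w) {1} 0) = 0 := by
    rw [← S_F (by decide), dTime_S, hDf, map_zero]
  have hDgl : dTime 0 (F (phi w) {0} 1) = 0 := by
    rw [← S_F (by decide), dTime_S, hDg, map_zero]
  rw [hDf, hDg, hDfm, hDgl] at r1 r2
  -- With all `t₁`-derivatives zero, the two relations say `W g = U f` and `W gl = U fm`. Their
  -- powers with exponents `-k + 1/2` and `k + 1/2` multiply to the claim.
  have s1 : W * F (phi w) ∅ 1 = U * F (phi w) ∅ 0 := by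
    refine mul_left_cancel₀ (mul_ne_zero hR (mul_ne_zero H.fm_ne H.gl_ne)) ?_
    linear_combination r1
  have s2 : W * F (phi w) {0} 1 = U * F (phi w) {1} 0 := by
    refine mul_left_cancel₀ (mul_ne_zero hR (mul_ne_zero H.f_ne H.g_ne)) ?_
    linear_combination r2
  have t1 := pow'_mul_pow'_of_eq hg hf hW hU s1 (-k + 1 / 2)
  have t2 := pow'_mul_pow'_of_eq hgl hfm hW hU s2 (k + 1 / 2)
  have e : ∀ x : MiwaSeries, constantCoeff x = 1 →
      pow' x (k + 1 / 2) * pow' x (-k + 1 / 2) = x := by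
    intro x hx
    rw [← pow'_add hx, show k + 1 / 2 + (-k + 1 / 2) = 1 by ring, pow'_one hx]
  rw [← e W hW, ← e U hU]
  linear_combination pow' W (k + 1 / 2) * pow' (F (phi w) {0} 1) (k + 1 / 2) * t1 +
    pow' U (-k + 1 / 2) * pow' (F (phi w) ∅ 0) (-k + 1 / 2) * t2

/-! ### Series without `λ, μ` -/

theorem shiftHom_empty_eq (f : TimeSeries) :
    shiftHom ∅ f = rename (Function.Embedding.inl : ℕ ↪ ℕ ⊕ Fin 2) f := by
  rw [rename_eq_subst, shiftHom, coe_substAlgHom]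
  congr 1
  funext n
  rw [miwaArg_empty]; rfl

theorem shiftHom_empty_injective : Function.Injective (shiftHom ∅) := by
  intro f g h
  rw [shiftHom_empty_eq, shiftHom_empty_eq] at h
  exact rename_injective _ h

theorem exists_shiftHom_empty_eq {a : MiwaSeries} (h : ∀ i, Free i a) :
    ∃ f, shiftHom ∅ f = a := by
  refine ⟨killCompl Function.Embedding.inl a, ?_⟩
  rw [shiftHom_empty_eq]
  ext e
  by_cases he : ∀ i, e (Sum.inr i) = 0
  · obtain ⟨d, rfl⟩ : ∃ d : ℕ →₀ ℕ, e = d.embDomain Function.Embedding.inl := by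
      refine ⟨e.comapDomain Sum.inl Sum.inl_injective.injOn, ?_⟩
      ext s
      rcases s with n | i
      · exact (embDomain_apply_self (Function.Embedding.inl : ℕ ↪ ℕ ⊕ Fin 2)
          (e.comapDomain Sum.inl Sum.inl_injective.injOn) n).symm
      · rw [he i, embDomain_of_notMem_range]
        rintro ⟨n, hn⟩
        cases hn
    rw [coeff_embDomain_rename, coeff_killCompl]
  · push Not at he
    obtain ⟨i, hi⟩ := he
    rw [free_iff.1 (h i) e hi, coeff_rename_eq_zero]
    rintro ⟨d, rfl⟩
    apply hi
    rw [mapDomain_of_notMem_range]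
    rintro ⟨n, hn⟩
    cases hn

theorem cf_algHom {Φ : MiwaSeries →ₐ[ℂ] MiwaSeries} {i j : Fin 2} (hp : Φ (par i) = par j)
    (hF : ∀ a, Free i a → Free j (Φ a)) (n : ℕ) (a : MiwaSeries) :
    cf j n (Φ a) = Φ (cf i n a) := by
  induction n generalizing a with
  | zero =>
    obtain ⟨b, hb, -⟩ := exists_eq_add_par_mul i a
    conv_lhs => rw [hb]
    rw [map_add, map_mul, hp, map_add, cf_zero_par_mul, add_zero,
      cf_zero_of_free (hF _ (free_cf _ _ _))]
  | succ n ih =>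
    obtain ⟨b, hb, hcf⟩ := exists_eq_add_par_mul i a
    conv_lhs => rw [hb]
    rw [map_add, map_mul, hp, map_add, cf_succ_par_mul, ih, hcf,
      cf_of_free (hF _ (free_cf _ _ _)) (Nat.succ_ne_zero n), zero_add]

theorem cf_S {i j : Fin 2} (h : i ≠ j) (n : ℕ) (a : MiwaSeries) :
    cf i n (S j a) = S j (cf i n a) :=
  cf_algHom (S_param j i) (fun _ ha => ha.S h) n a

theorem dParam_swapHom (i : Fin 2) (a : MiwaSeries) :
    dParam i (swapHom a) = swapHom (dParam (Equiv.swap 0 1 i) a) := by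
  classical
  refine derivation_algHom_comm finDet_swapHom ?_ a
  rintro (n | l)
  · rw [swapHom_time, pderiv_X_of_ne (by simp), pderiv_X_of_ne (by simp), map_zero]
  · rw [swapHom_param]
    by_cases hl : l = Equiv.swap 0 1 i
    · subst hl
      rw [Equiv.swap_apply_self, pderiv_X_self, pderiv_X_self, map_one]
    · rw [pderiv_X_of_ne, pderiv_X_of_ne (by simpa using hl), map_zero]
      intro h
      apply hl
      rw [← Sum.inr_injective h, Equiv.swap_apply_self]

theorem cf_swapHom (n : ℕ) (a : MiwaSeries) : cf 1 n (swapHom a) = swapHom (cf 0 n a) :=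
  cf_algHom (swapHom_param 0) (fun a ha => by
    unfold Free at *
    rw [dParam_swapHom, show Equiv.swap (0 : Fin 2) 1 (Equiv.swap 0 1 0) = 0 from rfl, ha, map_zero]) n a

theorem swapHom_of_free {a : MiwaSeries} (h : ∀ i, Free i a) : swapHom a = a := by
  obtain ⟨f, rfl⟩ := exists_shiftHom_empty_eq h
  rw [swapHom_shiftHom, Finset.image_empty]

theorem free_cf_of_free {i j : Fin 2} (h : i ≠ j) {a : MiwaSeries} (ha : Free j a) (n : ℕ) :
    ∀ l, Free l (cf i n a) := by
  have h1 : Free j (cf i n a) := by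
    have := cf_pderiv (i := i) (s := Sum.inr j) (by simpa using h.symm) n a
    change cf i n (dParam j a) = dParam j (cf i n a) at this
    rw [show dParam j a = 0 from ha, map_zero] at this
    exact this.symm
  intro l
  by_cases hl : l = i
  · rw [hl]; exact free_cf i n a
  · obtain rfl : l = j := by omega
    exact h1

/-- Shifts fix the series which do not depend on the times. -/
theorem S_of_dTime_eq_zero {i : Fin 2} {a : MiwaSeries} (hi : Free i a)
    (h : ∀ n, dTime n a = 0) : S i a = a := by
  refine ext_cf (i := i) fun j => ?_
  cases j with
  | zero => rw [cf_zero_S hi, cf_zero_of_free hi]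
  | succ j =>
    have := natCast_mul_cf_S hi (j := j + 1) (N := j + 1) (by omega)
    rw [Finset.sum_eq_zero, mul_zero] at this
    · rw [cf_of_free hi (Nat.succ_ne_zero j)]
      exact (mul_eq_zero.1 this).resolve_left (Nat.cast_ne_zero.2 (Nat.succ_ne_zero j))
    · intro n _
      rw [h n, map_zero, map_zero, ite_self]

/-! ### Integration of closed forms -/

/-- Formal Poincaré lemma: a nonconstant coefficient of `T` can be computed through any variable
occurring in its monomial, and closedness makes the answers agree. -/
theorem exists_pderiv_eq {σ : Type*} {ω : σ → MvPowerSeries σ ℂ}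
    (h : ∀ m n, pderiv ℂ m (ω n) = pderiv ℂ n (ω m)) :
    ∃ T : MvPowerSeries σ ℂ, (∀ n, pderiv ℂ n T = ω n) ∧ constantCoeff T = 0 := by
  classical
  let T : MvPowerSeries σ ℂ := fun e => if he : e.support.Nonempty then
    coeff (e - single he.choose 1) (ω he.choose) / (e he.choose : ℂ) else 0
  refine ⟨T, fun n => ?_, ?_⟩
  · ext e
    rw [coeff_pderiv]
    have he : (e + single n 1).support.Nonempty := ⟨n, by simp⟩
    obtain ⟨m, hm⟩ : ∃ m, m = he.choose := ⟨_, rfl⟩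
    have hm0 : (e + single n 1 : σ →₀ ℕ) m ≠ 0 := by
      have := he.choose_spec
      rw [← hm] at this
      exact Finsupp.mem_support_iff.1 this
    have hT : coeff (e + single n 1) T =
        coeff (e + single n 1 - single m 1) (ω m) / ((e + single n 1 : σ →₀ ℕ) m : ℂ) := by
      subst hm
      exact dif_pos he
    rw [hT]
    by_cases hmn : m = n
    · subst hmn
      have h1 : ((e + single m 1 : σ →₀ ℕ) m : ℂ) = (e m : ℂ) + 1 := by simp
      have h2 : (e m : ℂ) + 1 ≠ 0 := Nat.cast_add_one_ne_zero _
      rw [add_tsub_cancel_right, h1]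
      field_simp
    · have hem : (e + single n 1 : σ →₀ ℕ) m = e m := by simp [hmn]
      rw [hem] at hm0 ⊢
      have hle : single m 1 ≤ e := single_le_iff.2 (Nat.one_le_iff_ne_zero.2 hm0)
      obtain ⟨d, rfl⟩ := exists_add_of_le hle
      have h1 := congrArg (coeff d) (h m n)
      rw [coeff_pderiv, coeff_pderiv] at h1
      have h3 : single m 1 + d + single n 1 - single m 1 = d + single n 1 := by
        rw [add_assoc, add_tsub_cancel_left]
      have h4 : ((single m 1 + d : σ →₀ ℕ) m : ℂ) = (d m : ℂ) + 1 := by simp [add_comm]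
      have h5 : ((single m 1 + d : σ →₀ ℕ) n : ℂ) = (d n : ℂ) := by
        simp [single_eq_of_ne (Ne.symm hmn)]
      have h6 : (d m : ℂ) + 1 ≠ 0 := Nat.cast_add_one_ne_zero _
      rw [h3, h4, h5, div_mul_eq_mul_div, ← h1, add_comm (single m 1) d]
      field_simp
  · rw [← coeff_zero_eq_constantCoeff_apply]
    have h0 : ¬ (0 : σ →₀ ℕ).support.Nonempty := by simp
    change (if he : (0 : σ →₀ ℕ).support.Nonempty then
      coeff (0 - single he.choose 1) (ω he.choose) / ((0 : σ →₀ ℕ) he.choose : ℂ) else 0) = 0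
    exact dif_neg h0

/-! ### Logarithms and powers of shifted series -/

theorem constantCoeff_miwaHom (L : Finset (Fin 2)) (b : Fin 2 → MiwaSeries)
    (hb : ∀ j, constantCoeff (b j) = 0) (a : MiwaSeries) :
    constantCoeff (miwaHom L b hb a) = constantCoeff a := by
  have h : constantCoeff (miwaHom L b hb (a - C (constantCoeff a))) = 0 := by
    rw [miwaHom, coe_substAlgHom]
    refine constantCoeff_subst_eq_zero
      (hasSubst_sumElim (hasSubst_miwaArg L) (hasSubst_params b hb)) (fun s => ?_) (by simp)
    rcases s with n | j
    · simp [miwaArg]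
    · exact hb j
  rw [map_sub, map_sub, algHom_C, sub_eq_zero] at h
  simpa using h

theorem constantCoeff_S (i : Fin 2) (a : MiwaSeries) :
    constantCoeff (S i a) = constantCoeff a := constantCoeff_miwaHom _ _ _ a

theorem miwaHom_powerSeries_subst (L : Finset (Fin 2)) (b : Fin 2 → MiwaSeries)
    (hb : ∀ j, constantCoeff (b j) = 0) {a : MiwaSeries} (ha : constantCoeff a = 1)
    (p : PowerSeries ℂ) : miwaHom L b hb (PowerSeries.subst (a - 1) p) =
      PowerSeries.subst (miwaHom L b hb a - 1) p := by
  rw [miwaHom, algHom_powerSeries_subst _ (hasSubst_sub_one ha), map_sub, map_one]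

theorem S_log' (i : Fin 2) {a : MiwaSeries} (ha : constantCoeff a = 1) :
    S i (log' a) = log' (S i a) := miwaHom_powerSeries_subst _ _ _ ha _

theorem swapHom_log' {a : MiwaSeries} (ha : constantCoeff a = 1) :
    swapHom (log' a) = log' (swapHom a) := miwaHom_powerSeries_subst _ _ _ ha _

theorem S_pow' (i : Fin 2) {a : MiwaSeries} (ha : constantCoeff a = 1) (α : ℂ) :
    S i (pow' a α) = pow' (S i a) α := miwaHom_powerSeries_subst _ _ _ ha _

theorem swapHom_pow' {a : MiwaSeries} (ha : constantCoeff a = 1) (α : ℂ) :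
    swapHom (pow' a α) = pow' (swapHom a) α := miwaHom_powerSeries_subst _ _ _ ha _

theorem log'_mul {σ : Type*} {a b : MvPowerSeries σ ℂ} (ha : constantCoeff a = 1)
    (hb : constantCoeff b = 1) : log' (a * b) = log' a + log' b := by
  have hab : constantCoeff (a * b) = 1 := by simp [ha, hb]
  refine pderiv.ext (fun i => ?_) (by
    rw [map_add, constantCoeff_log' hab, constantCoeff_log' ha, constantCoeff_log' hb, add_zero])
  refine mul_right_cancel₀ (ne_zero_of_constantCoeff_eq_one hab) ?_
  rw [pderiv_log' hab, map_add, Derivation.leibniz, smul_eq_mul, smul_eq_mul]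
  linear_combination - a * pderiv_log' hb i - b * pderiv_log' ha i

theorem Free.log' {i : Fin 2} {a : MiwaSeries} (h : Free i a) (ha : constantCoeff a = 1) :
    Free i (log' a) := by
  have := pderiv_log' ha (Sum.inr i)
  rw [show pderiv ℂ (Sum.inr i) a = 0 from h] at this
  exact (mul_eq_zero.1 this).resolve_right (ne_zero_of_constantCoeff_eq_one ha)

theorem Free.pow' {i : Fin 2} {a : MiwaSeries} (h : Free i a) (ha : constantCoeff a = 1) (α : ℂ) :
    Free i (pow' a α) := by
  have := pderiv_pow' ha (Sum.inr i) α
  rw [show pderiv ℂ (Sum.inr i) a = 0 from h, mul_zero, zero_mul] at this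
  exact (mul_eq_zero.1 this).resolve_right (ne_zero_of_constantCoeff_eq_one ha)

theorem pow'_neg_mul {σ : Type*} {a : MvPowerSeries σ ℂ} (ha : constantCoeff a = 1) (α : ℂ) :
    pow' a (-α) * pow' a α = 1 := by
  rw [← pow'_add ha, neg_add_cancel, pow'_zero ha]

/-- It transfers `F(λ) = 1 + O(λ²)` to the powers of `F(λ)`. -/
theorem sub_one_dvd_pow'_sub_one {σ : Type*} {a : MvPowerSeries σ ℂ} (ha : constantCoeff a = 1)
    (α : ℂ) : a - 1 ∣ pow' a α - 1 := by
  have h := hasSubst_sub_one ha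
  have h1 := PowerSeries.eq_X_mul_shift_add_const (PowerSeries.binomialSeries ℂ α)
  have h2 := congrArg (PowerSeries.substAlgHom (R := ℂ) h) h1
  rw [map_add, map_mul, PowerSeries.substAlgHom_X] at h2
  refine ⟨PowerSeries.substAlgHom (R := ℂ) h (PowerSeries.mk fun n =>
    PowerSeries.coeff (n + 1) (PowerSeries.binomialSeries ℂ α)), ?_⟩
  have h3 : PowerSeries.substAlgHom (R := ℂ) h (PowerSeries.C 1) = 1 := by
    rw [map_one, map_one]
  rw [PowerSeries.binomialSeries_constantCoeff, h3, PowerSeries.coe_substAlgHom] at h2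
  change pow' a α = _ at h2
  rw [h2, PowerSeries.coe_substAlgHom]
  ring

/-! ### The tau function -/

section Tau

variable {w wt : ℕ → TimeSeries} {k : ℂ}

/-- The dual wave function, normalised by a power of `F`. -/
def dualTau (w wt : ℕ → TimeSeries) (k : ℂ) (i : Fin 2) : MiwaSeries :=
  evShift i ∅ wt * pow' (F (phi w) ∅ i) (-(-k + 1 / 2))

theorem constantCoeff_dualTau (hwt : wt 0 = 1) (i : Fin 2) :
    constantCoeff (dualTau w wt k i) = 1 := by
  rw [dualTau, map_mul, constantCoeff_evShift, hwt, constantCoeff_pow' (constantCoeff_F _ _ _)]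
  simp

theorem S_dualTau {i j : Fin 2} (h : j ≠ i) : S j (dualTau w wt k i) =
    evShift i {j} wt * pow' (F (phi w) {j} i) (-(-k + 1 / 2)) := by
  rw [dualTau, map_mul, S_evShift (by simp), S_pow' _ (constantCoeff_F _ _ _), S_F h,
    insert_empty_eq]

theorem swapHom_dualTau : swapHom (dualTau w wt k 0) = dualTau w wt k 1 := by
  rw [dualTau, map_mul, swapHom_pow' (constantCoeff_F _ _ _), swapHom_F, evShift,
    algHom_ev (swapHom_param 0), dualTau, evShift]
  congr 2
  ext n : 1
  simp [swapHom_shiftHom]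

theorem free_dualTau {i j : Fin 2} (h : i ≠ j) : Free j (dualTau w wt k i) :=
  (free_evShift h (by simp) wt).mul ((free_F _ h (by simp)).pow' (constantCoeff_F _ _ _) _)

theorem evShift_shift_mul (hw : w 0 = 1) (hwt : wt 0 = 1) (h : BilinearIdentity w wt)
    {i j : Fin 2} (hij : j ≠ i) :
    evShift i {i, j} w * evShift i {j} wt = F (phi w) {j} i := by
  have := congrArg (S j) (evShift_mul_evShift hw hwt h i)
  rwa [map_mul, S_evShift (by simpa using hij), S_evShift (by simp), S_F hij, insert_empty_eq,
    Finset.pair_comm] at this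

theorem pow'_mul_pow'_eq_self {x : MiwaSeries} (hx : constantCoeff x = 1) :
    pow' x (k + 1 / 2) * pow' x (-k + 1 / 2) = x := by
  rw [← pow'_add hx, show k + 1 / 2 + (-k + 1 / 2) = 1 by ring, pow'_one hx]

/-- The product of wave functions in terms of the normalised dual wave function. -/
theorem wave_mul_S_dualTau_zero (hw : w 0 = 1) (hwt : wt 0 = 1) (h : BilinearIdentity w wt) :
    evShift 0 {0, 1} w * evShift 0 ∅ wt * S 1 (dualTau w wt k 0) = dualTau w wt k 0 *
      (pow' (F (phi w) {1} 0) (k + 1 / 2) * pow' (F (phi w) ∅ 0) (-k + 1 / 2)) := by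
  have h1 := evShift_shift_mul hw hwt h (i := 0) (j := 1) (by decide)
  have h2 := pow'_mul_pow'_eq_self (k := k) (constantCoeff_F (phi w) {1} 0)
  have h3 := pow'_neg_mul (constantCoeff_F (phi w) {1} 0) (-k + 1 / 2)
  have h4 := pow'_neg_mul (constantCoeff_F (phi w) ∅ 0) (-k + 1 / 2)
  rw [S_dualTau (by decide), dualTau]
  linear_combination evShift 0 ∅ wt * pow' (F (phi w) {1} 0) (-(-k + 1 / 2)) * (h1 - h2)
    + evShift 0 ∅ wt * pow' (F (phi w) {1} 0) (k + 1 / 2) * (h3 - h4)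

theorem wave_mul_S_dualTau_one (hw : w 0 = 1) (hwt : wt 0 = 1) (h : BilinearIdentity w wt) :
    evShift 1 {0, 1} w * evShift 1 ∅ wt * S 0 (dualTau w wt k 1) = dualTau w wt k 1 *
      (pow' (F (phi w) {0} 1) (k + 1 / 2) * pow' (F (phi w) ∅ 1) (-k + 1 / 2)) := by
  have h1 := evShift_shift_mul hw hwt h (i := 1) (j := 0) (by decide)
  rw [Finset.pair_comm] at h1
  have h2 := pow'_mul_pow'_eq_self (k := k) (constantCoeff_F (phi w) {0} 1)
  have h3 := pow'_neg_mul (constantCoeff_F (phi w) {0} 1) (-k + 1 / 2)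
  have h4 := pow'_neg_mul (constantCoeff_F (phi w) ∅ 1) (-k + 1 / 2)
  rw [S_dualTau (by decide), dualTau]
  linear_combination evShift 1 ∅ wt * pow' (F (phi w) {0} 1) (-(-k + 1 / 2)) * (h1 - h2)
    + evShift 1 ∅ wt * pow' (F (phi w) {0} 1) (k + 1 / 2) * (h3 - h4)

/-- Writing `V_λ`, `V_μ` for the two series, `W = Q V_λ/(V_λ)_{2[μ]}` and `U = P V_μ/(V_μ)_{2[λ]}`;
in `W P = U Q` the powers of `F` cancel. -/
theorem dualTau_cocycle (hw : w 0 = 1) (hwt : wt 0 = 1) (h : BilinearIdentity w wt)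
    (hθ : theta w = C k * pderiv ℂ 0 (phi w)) :
    dualTau w wt k 0 * S 0 (dualTau w wt k 1) = dualTau w wt k 1 * S 1 (dualTau w wt k 0) := by
  have h0 := wave_mul_S_dualTau_zero (k := k) hw hwt h
  have h1 := wave_mul_S_dualTau_one (k := k) hw hwt h
  have H := wave_mul_pow hw hwt h hθ
  have hP : ∀ L i α, pow' (F (phi w) L i) α ≠ 0 := fun L i α =>
    ne_zero_of_constantCoeff_eq_one (constantCoeff_pow' (constantCoeff_F _ _ _) α)
  have hU : evShift 1 {0, 1} w * evShift 1 ∅ wt ≠ 0 :=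
    ne_zero_of_constantCoeff_eq_one (by simp [constantCoeff_evShift, hw, hwt])
  generalize evShift 0 {0, 1} w * evShift 0 ∅ wt = W at *
  generalize evShift 1 {0, 1} w * evShift 1 ∅ wt = U at *
  refine mul_left_cancel₀ (mul_ne_zero hU (mul_ne_zero (hP {1} 0 (k + 1 / 2))
    (hP ∅ 0 (-k + 1 / 2)))) ?_
  linear_combination (dualTau w wt k 0 * (pow' (F (phi w) {1} 0) (k + 1 / 2) *
      pow' (F (phi w) ∅ 0) (-k + 1 / 2))) * h1
    - dualTau w wt k 1 * (pow' (F (phi w) {0} 1) (k + 1 / 2) *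
      pow' (F (phi w) ∅ 1) (-k + 1 / 2)) * h0
    + dualTau w wt k 1 * S 1 (dualTau w wt k 0) * H

theorem constantCoeff_S_dualTau (hwt : wt 0 = 1) (i j : Fin 2) :
    constantCoeff (S j (dualTau w wt k i)) = 1 := by
  rw [constantCoeff_S, constantCoeff_dualTau hwt]

/-- The logarithm of the normalised dual wave function. -/
def logDual (w wt : ℕ → TimeSeries) (k : ℂ) (i : Fin 2) : MiwaSeries := log' (dualTau w wt k i)

theorem logDual_cocycle (hw : w 0 = 1) (hwt : wt 0 = 1) (h : BilinearIdentity w wt)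
    (hθ : theta w = C k * pderiv ℂ 0 (phi w)) :
    S 0 (logDual w wt k 1) - logDual w wt k 1 = S 1 (logDual w wt k 0) - logDual w wt k 0 := by
  have := congrArg log' (dualTau_cocycle hw hwt h hθ)
  rw [log'_mul (constantCoeff_dualTau hwt _) (constantCoeff_S_dualTau hwt _ _),
    log'_mul (constantCoeff_dualTau hwt _) (constantCoeff_S_dualTau hwt _ _),
    ← S_log' _ (constantCoeff_dualTau hwt _), ← S_log' _ (constantCoeff_dualTau hwt _)] at this
  unfold logDual
  linear_combination this

theorem free_logDual (hwt : wt 0 = 1) {i j : Fin 2} (h : i ≠ j) : Free j (logDual w wt k i) :=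
  (free_dualTau h).log' (constantCoeff_dualTau hwt i)

/-- The coefficients of `logDual`. -/
def logCoeff (w wt : ℕ → TimeSeries) (k : ℂ) (j : ℕ) : MiwaSeries := cf 1 j (logDual w wt k 1)

theorem free_logCoeff (hwt : wt 0 = 1) (j : ℕ) : ∀ l, Free l (logCoeff w wt k j) :=
  free_cf_of_free (by decide) (free_logDual hwt (j := 0) (by decide)) j

/-- Exchanging `λ` and `μ` swaps the two logarithms and fixes series in the times alone, so both
have the same coefficients. -/
theorem cf_logDual (hwt : wt 0 = 1) (j : ℕ) :
    cf 0 j (logDual w wt k 0) = logCoeff w wt k j := by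
  have h1 : ∀ l, Free l (cf 0 j (logDual w wt k 0)) :=
    free_cf_of_free (by decide) (free_logDual hwt (j := 1) (by decide)) j
  rw [← swapHom_of_free h1, ← cf_swapHom, logDual, swapHom_log' (constantCoeff_dualTau hwt 0),
    swapHom_dualTau]
  rfl

/-- The logarithmic derivatives of the tau function. -/
def tauForm (w wt : ℕ → TimeSeries) (k : ℂ) (n : ℕ) : MiwaSeries :=
  C (1 / 2) * ((2 * (n : MiwaSeries) + 1) * logCoeff w wt k (2 * n + 1) -
    2 * ∑ m ∈ Finset.range n, dTime m (logCoeff w wt k (2 * (n - m))))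

theorem Free.natCast (i : Fin 2) (n : ℕ) : Free i (n : MiwaSeries) :=
  Derivation.map_natCast (dParam i) n

theorem free_tauForm (hwt : wt 0 = 1) (n : ℕ) (l : Fin 2) : Free l (tauForm w wt k n) := by
  have h2 : Free l (2 : MiwaSeries) := Free.natCast l 2
  unfold tauForm
  exact (Free.C _ _).mul ((((h2.mul (Free.natCast l n)).add (Free.one l)).mul
    (free_logCoeff hwt _ l)).sub (h2.mul (Free.sum fun m _ => (free_logCoeff hwt _ l).dTime m)))

/-- Extracting odd coefficients from a sum over odd steps. -/
theorem sum_range_ite_odd (n : ℕ) (b : ℕ → ℕ → MiwaSeries) :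
    ∑ m ∈ Finset.range (n + 1), (if 2 * m + 1 ≤ 2 * n + 1 then b m (2 * n + 1 - (2 * m + 1))
      else 0) = b n 0 + ∑ m ∈ Finset.range n, b m (2 * (n - m)) := by
  rw [Finset.sum_range_succ, if_pos le_rfl, Nat.sub_self, add_comm]
  congr 1
  refine Finset.sum_congr rfl fun m hm => ?_
  rw [Finset.mem_range] at hm
  rw [if_pos (by omega)]
  congr 1
  omega

theorem natCast_mul_cf_S_odd {i : Fin 2} {a : MiwaSeries} (ha : Free i a) (n : ℕ) :
    (2 * n + 1) * cf i (2 * n + 1) (S i a) = 2 * (dTime n a +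
      ∑ m ∈ Finset.range n, cf i (2 * (n - m)) (S i (dTime m a))) := by
  have h1 := natCast_mul_cf_S ha (j := 2 * n + 1) (N := n + 1) (by omega)
  rw [sum_range_ite_odd n fun m j => cf i j (S i (dTime m a)), cf_zero_S (ha.dTime n)] at h1
  push_cast at h1
  exact h1

/-- `tauForm` is the Euler recursion solved for `∂_n log τ`, as if `log V_μ = log τ_{2[μ]} - log τ`.
Here that recursion, in `μ`, is applied to `log V_λ`, and the cocycle rewrites the coefficients of
`(log V_λ)_{2[μ]}` as shift differences of those of `log V_μ`. -/
theorem S_tauForm_sub (hw : w 0 = 1) (hwt : wt 0 = 1) (h : BilinearIdentity w wt)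
    (hθ : theta w = C k * pderiv ℂ 0 (phi w)) (n : ℕ) :
    S 0 (tauForm w wt k n) - tauForm w wt k n = dTime n (logDual w wt k 0) := by
  have hc := logDual_cocycle hw hwt h hθ
  have hfree : Free 1 (logDual w wt k 0) := free_logDual hwt (by decide)
  have h1 := natCast_mul_cf_S_odd hfree n
  have h2 : ∀ j, j ≠ 0 → cf 1 j (S 1 (logDual w wt k 0)) =
      S 0 (logCoeff w wt k j) - logCoeff w wt k j := by
    intro j hj
    have := congrArg (cf 1 j) hc
    rw [map_sub, map_sub, cf_S (by decide), cf_of_free hfree hj, sub_zero] at this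
    exact this.symm
  have h3 : ∀ m j, j ≠ 0 → cf 1 j (S 1 (dTime m (logDual w wt k 0))) =
      S 0 (dTime m (logCoeff w wt k j)) - dTime m (logCoeff w wt k j) := by
    intro m j hj
    rw [← dTime_S, cf_dTime, h2 j hj, map_sub, dTime_S]
  rw [h2 (2 * n + 1) (by omega), Finset.sum_congr rfl fun m hm => h3 m (2 * (n - m)) (by
    rw [Finset.mem_range] at hm; omega), Finset.sum_sub_distrib] at h1
  have hS : S 0 (tauForm w wt k n) = C (1 / 2) * ((2 * (n : MiwaSeries) + 1) *
      S 0 (logCoeff w wt k (2 * n + 1)) -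
      2 * ∑ m ∈ Finset.range n, S 0 (dTime m (logCoeff w wt k (2 * (n - m))))) := by
    rw [tauForm]
    simp only [map_mul, map_sub, map_add, map_one, map_natCast, map_ofNat, map_sum, algHom_C]
  rw [hS, tauForm]
  linear_combination C (1 / 2) * h1 + dTime n (logDual w wt k 0) * C_half_mul_two

/-- By `S_tauForm_sub`, the positive `λ`-coefficients of the shifted `tauForm` of index `n` are
`∂_n` of the `logCoeff`. The Euler recursion for `∂_m` of this form is thus `∂_n` of the formula
defining the form of index `m`. -/
theorem tauForm_closed (hw : w 0 = 1) (hwt : wt 0 = 1) (h : BilinearIdentity w wt)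
    (hθ : theta w = C k * pderiv ℂ 0 (phi w)) (m n : ℕ) :
    dTime m (tauForm w wt k n) = dTime n (tauForm w wt k m) := by
  have hc := S_tauForm_sub hw hwt h hθ
  have hfree := fun n => free_tauForm (w := w) (k := k) hwt n 0
  have h1 := natCast_mul_cf_S_odd (hfree n) m
  have h2 : ∀ j, j ≠ 0 → cf 0 j (S 0 (tauForm w wt k n)) = dTime n (logCoeff w wt k j) := by
    intro j hj
    have := congrArg (cf 0 j) (hc n)
    rw [map_sub, cf_of_free (hfree n) hj, sub_zero, cf_dTime, cf_logDual hwt] at this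
    exact this
  have h3 : ∀ l j, j ≠ 0 → cf 0 j (S 0 (dTime l (tauForm w wt k n))) =
      dTime n (dTime l (logCoeff w wt k j)) := by
    intro l j hj
    rw [← dTime_S, cf_dTime, h2 j hj, pderiv_comm]
  rw [h2 (2 * m + 1) (by omega), Finset.sum_congr rfl fun l hl => h3 l (2 * (m - l)) (by
    rw [Finset.mem_range] at hl; omega), ← map_sum] at h1
  have hD : dTime n (tauForm w wt k m) = C (1 / 2) * ((2 * (m : MiwaSeries) + 1) *
      dTime n (logCoeff w wt k (2 * m + 1)) -
      2 * dTime n (∑ l ∈ Finset.range m, dTime l (logCoeff w wt k (2 * (m - l))))) := by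
    have D2 : dTime n (2 : MiwaSeries) = 0 := Derivation.map_natCast (dTime n) 2
    rw [tauForm]
    simp only [Derivation.leibniz, map_sub, map_add, Derivation.map_natCast, D2, pderiv_C,
      Derivation.map_one_eq_zero, smul_eq_mul]
    ring
  rw [hD]
  linear_combination - C (1 / 2) * h1 - dTime m (tauForm w wt k n) * C_half_mul_two

end Tau

/-! ### The tau function and its differential Fay identity. -/

section TauFay

variable {w wt : ℕ → TimeSeries} {k : ℂ}

theorem cf_zero_dParam (i : Fin 2) (a : MiwaSeries) : cf i 0 (dParam i a) = cf i 1 a := by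
  have := cf_par_mul_dParam i 1 a
  rw [cf_succ_par_mul] at this
  simpa using this

/-- To first order in `μ` the normalising power of `F(μ)` is `1`, so only `w̃₁ = φ` contributes.
This yields `φ = 2 (ln τ)_{t₁}`. -/
theorem logCoeff_one (hw : w 0 = 1) (hwt : wt 0 = 1) (h : BilinearIdentity w wt) :
    logCoeff w wt k 1 = shiftHom ∅ (phi w) := by
  obtain ⟨g0, g1⟩ := cf_F (phi w) (L := ∅) (i := 1) (by simp)
  have hF := constantCoeff_F (phi w) ∅ 1
  have hp0 : cf 1 0 (pow' (F (phi w) ∅ 1) (-(-k + 1 / 2))) = 1 := by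
    obtain ⟨q, hq⟩ := sub_one_dvd_pow'_sub_one hF (-(-k + 1 / 2))
    have := congrArg (cf 1 0) hq
    rw [map_sub, cf_zero_mul, map_sub, g0, cf_zero_of_free (Free.one 1), sub_self, zero_mul] at this
    exact sub_eq_zero.1 this
  have hp1 : cf 1 1 (pow' (F (phi w) ∅ 1) (-(-k + 1 / 2))) = 0 := by
    obtain ⟨q, hq⟩ := sub_one_dvd_pow'_sub_one hF (-(-k + 1 / 2))
    have := congrArg (cf 1 1) hq
    rwa [map_sub, cf_one_mul, map_sub, map_sub, g0, g1, cf_zero_of_free (Free.one 1),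
      cf_of_free (Free.one 1) one_ne_zero, sub_self, zero_mul, sub_self, zero_mul, sub_zero,
      zero_add] at this
  have hv0 : cf 1 0 (evShift 1 ∅ wt) = 1 := by
    rw [evShift, ev_eq_tail, map_add, cf_zero_par_mul, add_zero, PowerSeries.coeff_map,
      PowerSeries.coeff_mk, hwt]
    simpa using cf_zero_of_free (Free.one 1)
  have hv1 : cf 1 1 (evShift 1 ∅ wt) = shiftHom ∅ (phi w) := by
    have e := cf_succ_par_mul 1 0 (ev 1 (tail (PowerSeries.map
      (shiftHom ∅ : TimeSeries →+* MiwaSeries) (PowerSeries.mk wt))))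
    rw [zero_add] at e
    rw [evShift, ev_eq_tail, map_add, e, ev_eq_tail, map_add, cf_zero_par_mul, add_zero, tail,
      PowerSeries.coeff_mk, PowerSeries.coeff_map, PowerSeries.coeff_map, PowerSeries.coeff_mk,
      PowerSeries.coeff_mk, hwt]
    have e1 : cf 1 1 ((shiftHom ∅ : TimeSeries →+* MiwaSeries) 1) = 0 := by
      rw [map_one, cf_of_free (Free.one 1) one_ne_zero]
    have e2 := cf_zero_of_free (free_shiftHom (i := 1) (L := ∅) (by simp) (wt 1))
    rw [e1, zero_add, ← shiftHom_dual_one hw hwt h]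
    exact e2
  have hV0 : cf 1 0 (dualTau w wt k 1) = 1 := by
    rw [dualTau, cf_zero_mul, hv0, hp0, one_mul]
  have hV1 : cf 1 1 (dualTau w wt k 1) = shiftHom ∅ (phi w) := by
    rw [dualTau, cf_one_mul, hv0, hp0, hv1, hp1, mul_zero, zero_add, mul_one]
  have := congrArg (cf 1 0) (pderiv_log' (constantCoeff_dualTau (w := w) (k := k) hwt 1) (Sum.inr 1))
  rw [cf_zero_mul, hV0, mul_one] at this
  change cf 1 0 (dParam 1 _) = cf 1 0 (dParam 1 _) at this
  rw [cf_zero_dParam, cf_zero_dParam, hV1] at this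
  exact this

theorem tauForm_zero (hw : w 0 = 1) (hwt : wt 0 = 1) (h : BilinearIdentity w wt) :
    tauForm w wt k 0 = C (1 / 2) * shiftHom ∅ (phi w) := by
  rw [tauForm, ← logCoeff_one (k := k) hw hwt h]
  simp

/-- The tau function attached to a solution of the bilinear identity. -/
theorem exists_tau (hw : w 0 = 1) (hwt : wt 0 = 1) (h : BilinearIdentity w wt)
    (hθ : theta w = C k * pderiv ℂ 0 (phi w)) :
    ∃ τ : TimeSeries, constantCoeff τ = 1 ∧
      ∀ n, dTime n (shiftHom ∅ τ) = tauForm w wt k n * shiftHom ∅ τ := by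
  choose ω hω using fun n => exists_shiftHom_empty_eq (free_tauForm (w := w) (k := k) hwt n)
  obtain ⟨T, hT, hT0⟩ := exists_pderiv_eq (ω := ω) (fun m n => by
    apply shiftHom_empty_injective
    rw [← dTime_shiftHom, ← dTime_shiftHom, hω, hω, tauForm_closed hw hwt h hθ])
  refine ⟨exp' T, constantCoeff_exp' hT0, fun n => ?_⟩
  rw [dTime_shiftHom, pderiv_exp' hT0, hT, map_mul, hω]

/-- The shifts of the tau function, up to factors which do not depend on the times. -/
theorem tau_shift (hw : w 0 = 1) (hwt : wt 0 = 1) (h : BilinearIdentity w wt)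
    (hθ : theta w = C k * pderiv ℂ 0 (phi w)) {t : MiwaSeries} (ht : constantCoeff t = 1)
    (hfree : ∀ i, Free i t) (hd : ∀ n, dTime n t = tauForm w wt k n * t) :
    t * S 1 (S 0 t) * dualTau w wt k 0 = S 0 t * S 1 t * S 1 (dualTau w wt k 0) := by
  have hV := constantCoeff_dualTau (w := w) (k := k) hwt 0
  have htV : constantCoeff (t * dualTau w wt k 0) = 1 := by rw [map_mul, ht, hV, one_mul]
  have hne := ne_zero_of_constantCoeff_eq_one htV
  have hinv : t * dualTau w wt k 0 * (t * dualTau w wt k 0)⁻¹ = 1 :=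
    MvPowerSeries.mul_inv_cancel _ (by rw [htV]; exact one_ne_zero)
  -- The quotient `τ_{2[λ]}/(τ V_λ)` depends neither on `μ` nor on the times, so the shift by `2[μ]`
  -- fixes it and it cancels; its value is not needed.
  obtain ⟨c, hc⟩ : ∃ c, c = S 0 t * (t * dualTau w wt k 0)⁻¹ := ⟨_, rfl⟩
  have hct : S 0 t = c * (t * dualTau w wt k 0) := by
    rw [hc]; linear_combination - S 0 t * hinv
  have hfree1 : Free 1 (S 0 t) := (hfree 1).S (by decide)
  have hfV : Free 1 (t * dualTau w wt k 0) := (hfree 1).mul (free_dualTau (by decide))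
  have hcfree : Free 1 c := by
    have h1 : dParam 1 (S 0 t) = 0 := hfree1
    rw [hct, Derivation.leibniz, show dParam 1 (t * dualTau w wt k 0) = 0 from hfV, smul_zero,
      zero_add, smul_eq_mul] at h1
    exact (mul_eq_zero.1 h1).resolve_left hne
  have hcd : ∀ n, dTime n c = 0 := by
    intro n
    have h1 := congrArg (dTime n) hct
    have h2 := S_tauForm_sub hw hwt h hθ n
    have h3 := pderiv_log' hV (Sum.inl n)
    change dTime n (logDual w wt k 0) * _ = dTime n (dualTau w wt k 0) at h3
    rw [dTime_S, hd, map_mul, hct, Derivation.leibniz, Derivation.leibniz, hd] at h1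
    simp only [smul_eq_mul] at h1
    refine (mul_eq_zero.1 (?_ : t * dualTau w wt k 0 * dTime n c = 0)).resolve_left hne
    linear_combination - h1 + c * t * dualTau w wt k 0 * h2 + c * t * h3
  have hS1 := S_of_dTime_eq_zero hcfree hcd
  rw [hct, map_mul, map_mul, hS1]
  ring

/-- The differential Fay identity for the tau function of a solution of the bilinear identity. -/
theorem exists_tau_fay (hw : w 0 = 1) (hwt : wt 0 = 1) (h : BilinearIdentity w wt)
    (hθ : theta w = C k * pderiv ℂ 0 (phi w)) :
    ∃ τ : TimeSeries, IsUnit τ ∧ phi w = phiOfTau τ ∧ DifferentialFay k τ := by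
  obtain ⟨τ, hτ, hd⟩ := exists_tau hw hwt h hθ
  have hinv : τ * τ⁻¹ = 1 := MvPowerSeries.mul_inv_cancel _ (by rw [hτ]; exact one_ne_zero)
  have hC2 : (C 2 : MiwaSeries) * C (1 / 2) = 1 := by rw [← map_mul]; norm_num
  have hphi : phi w = phiOfTau τ := by
    have h1 : C 2 * pderiv ℂ 0 τ = phi w * τ := by
      apply shiftHom_empty_injective
      rw [map_mul, map_mul, algHom_C, ← dTime_shiftHom, hd, tauForm_zero hw hwt h]
      linear_combination shiftHom ∅ (phi w) * shiftHom ∅ τ * hC2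
    rw [phiOfTau, h1, mul_assoc, hinv, mul_one]
  refine ⟨τ, (MvPowerSeries.isUnit_iff_constantCoeff).2 (by rw [hτ]; exact isUnit_one), hphi, ?_⟩
  have hs0 : shift ∅ τ = shiftHom ∅ τ := shift_eq _ _
  have hs1 : shift {0} τ = S 0 (shiftHom ∅ τ) := by
    rw [shift_eq, S_shiftHom (by simp), insert_empty_eq]
  have hs2 : shift {1} τ = S 1 (shiftHom ∅ τ) := by
    rw [shift_eq, S_shiftHom (by simp), insert_empty_eq]
  have hs3 : shift {0, 1} τ = S 1 (S 0 (shiftHom ∅ τ)) := by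
    rw [shift_eq, S_shiftHom (by simp), S_shiftHom (by simp), insert_empty_eq, Finset.pair_comm]
  have hphi3 : shiftHom {0, 1} (phi w) = S 1 (S 0 (shiftHom ∅ (phi w))) := by
    rw [S_shiftHom (by simp), S_shiftHom (by simp), insert_empty_eq, Finset.pair_comm]
  obtain ⟨t, ht⟩ : ∃ t, t = shiftHom ∅ τ := ⟨_, rfl⟩
  rw [← ht] at hd hs0 hs1 hs2 hs3
  have ht1 : constantCoeff t = 1 := by rw [ht, constantCoeff_shiftHom, hτ]
  have htfree : ∀ i, Free i t := fun i => by rw [ht]; exact free_shiftHom (by simp) τ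
  have hsh := tau_shift hw hwt h hθ ht1 htfree hd
  have hco := dualTau_cocycle hw hwt h hθ
  have hW := wave_mul_S_dualTau_zero (k := k) hw hwt h
  have hU := wave_mul_S_dualTau_one (k := k) hw hwt h
  have H := fayRelations hw hwt h hθ
  have hE := H.first
  have hd0 := hd 0
  rw [tauForm_zero hw hwt h] at hd0
  have hd3 : dTime 0 (S 1 (S 0 t)) =
      C (1 / 2) * shiftHom {0, 1} (phi w) * S 1 (S 0 t) := by
    rw [dTime_S, dTime_S, hd0, hphi3]
    simp only [map_mul, algHom_C]
  have hR : mu * F (phi w) {1} 0 + lam * F (phi w) ∅ 1 =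
      lam + mu - C (1 / 2) * lam * mu * (shiftHom {0, 1} (phi w) - shiftHom ∅ (phi w)) := by
    rw [F_eq, F_eq, insert_empty_eq]
    change mu * (1 - _ * lam * _) + lam * (1 - _ * mu * _) = _
    ring
  have hV0 := ne_zero_of_constantCoeff_eq_one (constantCoeff_dualTau (w := w) (k := k) hwt 0)
  have hV1 := ne_zero_of_constantCoeff_eq_one (constantCoeff_dualTau (w := w) (k := k) hwt 1)
  rw [DifferentialFay, fayLHS, fayRHS, ← hphi, hs0, hs1, hs2, hs3, dOne_eq, dOne_eq, hd0, hd3]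
  simp only [power_eq]
  rw [hR] at hE
  generalize evShift 0 {0, 1} w * evShift 0 ∅ wt = W at *
  generalize evShift 1 {0, 1} w * evShift 1 ∅ wt = U at *
  generalize pow' (F (phi w) {0} 1) (k + 1 / 2) = p1 at *
  generalize pow' (F (phi w) ∅ 1) (-k + 1 / 2) = p2 at *
  generalize pow' (F (phi w) {1} 0) (k + 1 / 2) = q1 at *
  generalize pow' (F (phi w) ∅ 0) (-k + 1 / 2) = q2 at *
  generalize S 1 (S 0 t) = t3 at *
  generalize S 0 t = t1 at *
  generalize S 1 t = t2 at *
  -- `e0` and `e1` turn `first`, multiplied by `τ τ_{2[λ]+2[μ]}`, into the Fay identity; the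
  -- derivative terms come from `R` and `φ τ/2 = τ_{t₁}`.
  have e0 : t * t3 * W = t1 * t2 * (q1 * q2) := by
    refine mul_right_cancel₀ hV0 ?_
    linear_combination W * hsh + t1 * t2 * hW
  have e1 : t * t3 * U = t1 * t2 * (p1 * p2) := by
    refine mul_right_cancel₀ (mul_ne_zero hV0 hV1) ?_
    linear_combination U * dualTau w wt k 1 * hsh + t1 * t2 * dualTau w wt k 0 * hU
      - U * t1 * t2 * hco
  linear_combination (lam + mu) * (mu * e0 - lam * e1) - t * t3 * hE

end TauFay

/-! ### Bilinearity for `k = ± 1 / 2` -/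

theorem shiftHom_phiOfTau_mul {τ : TimeSeries} (hτ : IsUnit τ) (L : Finset (Fin 2)) :
    shiftHom L (phiOfTau τ) * shiftHom L τ = 2 * dTime 0 (shiftHom L τ) := by
  have h0 : constantCoeff τ ≠ 0 := by
    have := (MvPowerSeries.isUnit_iff_constantCoeff).1 hτ
    exact this.ne_zero
  have hinv : τ⁻¹ * τ = 1 := MvPowerSeries.inv_mul_cancel _ h0
  rw [← map_mul, phiOfTau, mul_assoc, hinv, mul_one, map_mul, algHom_C, dTime_shiftHom, map_ofNat]

theorem F_phiOfTau_mul {τ : TimeSeries} (hτ : IsUnit τ) (L : Finset (Fin 2)) (i : Fin 2) :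
    F (phiOfTau τ) L i * (shiftHom L τ * shiftHom (insert i L) τ) =
      shiftHom L τ * shiftHom (insert i L) τ - par i *
        (dTime 0 (shiftHom (insert i L) τ) * shiftHom L τ -
          shiftHom (insert i L) τ * dTime 0 (shiftHom L τ)) := by
  have h1 := shiftHom_phiOfTau_mul hτ L
  have h2 := shiftHom_phiOfTau_mul hτ (insert i L)
  rw [F_eq]
  linear_combination - C (1 / 2) * par i * (shiftHom L τ * h2 - shiftHom (insert i L) τ * h1)
    - par i * (dTime 0 (shiftHom (insert i L) τ) * shiftHom L τ -
          shiftHom (insert i L) τ * dTime 0 (shiftHom L τ)) * C_half_mul_two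

/-- The hypothesis holds both for `x, y = F_{2[λ]}(μ), F_{2[μ]}(λ)` and for `F(μ), F(λ)`, because
`φ_{2[λ]+2[μ]}`, respectively `φ`, cancels. Hence `k = 1/2` and `k = -1/2` give the same left side.
-/
theorem tau_mul_F_sub {τ : TimeSeries} (hτ : IsUnit τ) {x y : MiwaSeries}
    (h : lam * x - mu * y = lam - mu + C (1 / 2) * lam * mu *
      (shiftHom {0} (phiOfTau τ) - shiftHom {1} (phiOfTau τ))) :
    shiftHom {0} τ * shiftHom {1} τ * (lam * x - mu * y) =
      (lam - mu) * (shiftHom {0} τ * shiftHom {1} τ) + lam * mu *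
        (dTime 0 (shiftHom {0} τ) * shiftHom {1} τ - shiftHom {0} τ * dTime 0 (shiftHom {1} τ)) := by
  have h1 := shiftHom_phiOfTau_mul hτ {0}
  have h2 := shiftHom_phiOfTau_mul hτ {1}
  rw [h]
  linear_combination C (1 / 2) * lam * mu * (shiftHom {1} τ * h1 - shiftHom {0} τ * h2) +
    lam * mu * (dTime 0 (shiftHom {0} τ) * shiftHom {1} τ -
      shiftHom {0} τ * dTime 0 (shiftHom {1} τ)) * C_half_mul_two

theorem fayLHS_of_bkp {k : ℂ} (hk : k = 1 / 2 ∨ k = -(1 / 2)) {τ : TimeSeries} (hτ : IsUnit τ) :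
    fayLHS k τ = (lam + mu) * ((lam - mu) * (shiftHom {0} τ * shiftHom {1} τ) + lam * mu *
        (dTime 0 (shiftHom {0} τ) * shiftHom {1} τ -
          shiftHom {0} τ * dTime 0 (shiftHom {1} τ))) := by
  have hF := constantCoeff_F (phiOfTau τ)
  rw [fayLHS, shift_eq, shift_eq]
  simp only [power_eq]
  rcases hk with rfl | rfl
  · rw [show (1 / 2 + 1 / 2 : ℂ) = 1 by norm_num, show (-(1 / 2) + 1 / 2 : ℂ) = 0 by norm_num,
      pow'_one (hF _ _), pow'_one (hF _ _), pow'_zero (hF _ _), pow'_zero (hF _ _)]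
    have := tau_mul_F_sub hτ (x := F (phiOfTau τ) {0} 1) (y := F (phiOfTau τ) {1} 0) (by
      rw [F_eq, F_eq, Finset.pair_comm]
      change lam * (1 - _ * mu * _) - mu * (1 - _ * lam * _) = _
      ring)
    linear_combination (lam + mu) * this
  · rw [show (-(1 / 2) + 1 / 2 : ℂ) = 0 by norm_num, show (- -(1 / 2) + 1 / 2 : ℂ) = 1 by norm_num,
      pow'_one (hF _ _), pow'_one (hF _ _), pow'_zero (hF _ _), pow'_zero (hF _ _)]
    have := tau_mul_F_sub hτ (x := F (phiOfTau τ) ∅ 1) (y := F (phiOfTau τ) ∅ 0) (by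
      rw [F_eq, F_eq, insert_empty_eq, insert_empty_eq]
      change lam * (1 - _ * mu * _) - mu * (1 - _ * lam * _) = _
      ring)
    linear_combination (lam + mu) * this

/-- The bilinear map `(σ, τ) ↦ Φ(σ) Ψ(τ)`. -/
def prodBilin (Φ Ψ : TimeSeries →ₗ[ℂ] MiwaSeries) :
    TimeSeries →ₗ[ℂ] TimeSeries →ₗ[ℂ] MiwaSeries :=
  (LinearMap.mul ℂ MiwaSeries).compl₁₂ Φ Ψ

theorem prodBilin_apply (Φ Ψ : TimeSeries →ₗ[ℂ] MiwaSeries) (σ τ : TimeSeries) :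
    prodBilin Φ Ψ σ τ = Φ σ * Ψ τ := rfl

/-- Miwa shift, multiplied by `c`. -/
def mulShift (c : MiwaSeries) (L : Finset (Fin 2)) : TimeSeries →ₗ[ℂ] MiwaSeries :=
  (LinearMap.mulLeft ℂ c).comp (shiftHom L).toLinearMap

theorem mulShift_apply (c : MiwaSeries) (L : Finset (Fin 2)) (τ : TimeSeries) :
    mulShift c L τ = c * shiftHom L τ := rfl

/-- Derivative of the Miwa shift, multiplied by `c`. -/
def mulDShift (c : MiwaSeries) (L : Finset (Fin 2)) : TimeSeries →ₗ[ℂ] MiwaSeries :=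
  (LinearMap.mulLeft ℂ c).comp ((dTime 0 : MiwaSeries →ₗ[ℂ] MiwaSeries).comp
    (shiftHom L).toLinearMap)

theorem mulDShift_apply (c : MiwaSeries) (L : Finset (Fin 2)) (τ : TimeSeries) :
    mulDShift c L τ = c * dTime 0 (shiftHom L τ) := rfl

/-- `fayRHS` as a bilinear map. -/
def fayRHSBilin : TimeSeries →ₗ[ℂ] TimeSeries →ₗ[ℂ] MiwaSeries :=
  prodBilin (mulShift ((lam - mu) * (lam + mu)) ∅) (mulShift 1 {0, 1}) -
    (prodBilin (mulDShift ((lam - mu) * (lam * mu)) {0, 1}) (mulShift 1 ∅) -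
      prodBilin (mulShift ((lam - mu) * (lam * mu)) {0, 1}) (mulDShift 1 ∅))

theorem fayRHSBilin_apply (τ : TimeSeries) : fayRHSBilin τ τ = fayRHS τ := by
  simp only [fayRHSBilin, LinearMap.sub_apply, prodBilin_apply, mulShift_apply, mulDShift_apply,
    fayRHS, shift_eq, dOne_eq]
  ring

theorem isBilinearIn_of_bkp {k : ℂ} (hk : k = 1 / 2 ∨ k = -(1 / 2)) :
    IsBilinearIn (fun τ => fayLHS k τ - fayRHS τ) := by
  refine ⟨prodBilin (mulShift ((lam + mu) * (lam - mu)) {0}) (mulShift 1 {1}) +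
    (prodBilin (mulDShift ((lam + mu) * (lam * mu)) {0}) (mulShift 1 {1}) -
      prodBilin (mulShift ((lam + mu) * (lam * mu)) {0}) (mulDShift 1 {1})) - fayRHSBilin,
    fun τ hτ => ?_⟩
  change fayLHS k τ - fayRHS τ = _
  rw [fayLHS_of_bkp hk hτ, LinearMap.sub_apply, LinearMap.sub_apply, fayRHSBilin_apply]
  simp only [LinearMap.add_apply, LinearMap.sub_apply, prodBilin_apply, mulShift_apply,
    mulDShift_apply]
  ring

theorem differentialFay_iff_bkpFay {k : ℂ} (hk : k = 1 / 2 ∨ k = -(1 / 2)) {τ : TimeSeries}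
    (hτ : IsUnit τ) : DifferentialFay k τ ↔ BKPFay τ := by
  rw [DifferentialFay, fayLHS_of_bkp hk hτ, fayRHS, BKPFay]
  simp only [shift_eq, dOne_eq]
  constructor <;> intro h <;> linear_combination -h

/-! ### Failure of bilinearity for `k = 0` -/

/-- The specialisation `t = 0`, `μ = -λ`. -/
def specHom : MiwaSeries →ₐ[ℂ] MiwaSeries :=
  substAlgHom (hasSubst_sumElim (a := fun _ : ℕ => (0 : MiwaSeries)) (b := ![lam, -lam])
    HasSubst.zero (hasSubst_of_constantCoeff_zero fun i => by fin_cases i <;> simp [lam]))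

theorem specHom_time (n : ℕ) : specHom (X (Sum.inl n)) = 0 := by
  rw [specHom, substAlgHom_X, Sum.elim_inl]

theorem specHom_par (i : Fin 2) : specHom (par i) = ![lam, -lam] i := by
  rw [specHom, par, substAlgHom_X, Sum.elim_inr]

theorem specHom_lam : specHom lam = lam := specHom_par 0

theorem specHom_mu : specHom mu = -lam := specHom_par 1

theorem constantCoeff_specHom (a : MiwaSeries) :
    constantCoeff (specHom a) = constantCoeff a := by
  have h : constantCoeff (specHom (a - C (constantCoeff a))) = 0 := by
    rw [specHom, coe_substAlgHom]
    refine constantCoeff_subst_eq_zero (hasSubst_sumElim HasSubst.zero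
      (hasSubst_of_constantCoeff_zero fun i => by fin_cases i <;> simp [lam])) (fun s => ?_)
      (by simp)
    rcases s with n | j
    · simp
    · fin_cases j <;> simp [lam]
  rw [map_sub, map_sub, algHom_C, sub_eq_zero] at h
  simpa using h

/-- The tau functions `1 + a t₁`. -/
def linTau (a : ℂ) : TimeSeries := 1 + a • X 0

theorem constantCoeff_linTau (a : ℂ) : constantCoeff (linTau a) = 1 := by
  simp [linTau]

theorem isUnit_linTau (a : ℂ) : IsUnit (linTau a) :=
  (MvPowerSeries.isUnit_iff_constantCoeff).2 (by rw [constantCoeff_linTau]; exact isUnit_one)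

theorem shiftHom_linTau (a : ℂ) (L : Finset (Fin 2)) :
    shiftHom L (linTau a) = 1 + C a * miwaArg L 0 := by
  rw [linTau, map_add, map_one, map_smul, shiftHom_X, smul_eq_C_mul]

theorem dTime_shiftHom_linTau (a : ℂ) (L : Finset (Fin 2)) :
    dTime 0 (shiftHom L (linTau a)) = C a := by
  rw [shiftHom_linTau, map_add, Derivation.map_one_eq_zero, Derivation.leibniz, dTime_miwaArg,
    pderiv_C]
  simp

theorem specHom_shiftHom_linTau (a : ℂ) (L : Finset (Fin 2)) :
    specHom (shiftHom L (linTau a)) = 1 + C a * ∑ i ∈ L, 2 * specHom (par i) := by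
  have : (C (2 / (2 * ((0 : ℕ) : ℂ) + 1)) : MiwaSeries) = 2 := by
    rw [← map_ofNat C 2]; simp
  rw [shiftHom_linTau, miwaArg]
  simp only [map_add, map_mul, map_one, algHom_C, map_sum, specHom_time, zero_add, this, mul_zero,
    pow_one, map_ofNat]

theorem specHom_F_linTau (a : ℂ) (L : Finset (Fin 2)) (i : Fin 2) :
    specHom (F (phiOfTau (linTau a)) L i) *
        (specHom (shiftHom L (linTau a)) * specHom (shiftHom (insert i L) (linTau a))) =
      specHom (shiftHom L (linTau a)) * specHom (shiftHom (insert i L) (linTau a)) -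
        ![lam, -lam] i * (C a * specHom (shiftHom L (linTau a)) -
          specHom (shiftHom (insert i L) (linTau a)) * C a) := by
  have := congrArg specHom (F_phiOfTau_mul (isUnit_linTau a) L i)
  simpa only [dTime_shiftHom_linTau, map_mul, map_sub, algHom_C, specHom_par] using this

theorem eq_of_sq_eq_sq {a b : MiwaSeries} (ha : constantCoeff a = 1) (hb : constantCoeff b = 1)
    (h : a ^ 2 = b ^ 2) : a = b := by
  rcases sq_eq_sq_iff_eq_or_eq_neg.1 h with h | h
  · exact h
  · have := congrArg constantCoeff h
    rw [map_neg, ha, hb] at this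
    norm_num at this

/-- `fayLHS 0 (linTau a)`, divided by `λ + μ`. -/
def fayDiff (a : ℂ) : MiwaSeries :=
  shiftHom {0} (linTau a) * shiftHom {1} (linTau a) *
    (lam * pow' (F (phiOfTau (linTau a)) {0} 1) (1 / 2) *
        pow' (F (phiOfTau (linTau a)) ∅ 1) (1 / 2) -
      mu * pow' (F (phiOfTau (linTau a)) {1} 0) (1 / 2) *
        pow' (F (phiOfTau (linTau a)) ∅ 0) (1 / 2))

theorem fayLHS_linTau (a : ℂ) : fayLHS 0 (linTau a) = (lam + mu) * fayDiff a := by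
  rw [fayLHS, fayDiff]
  simp only [shift_eq, power_eq, zero_add, neg_zero]
  ring

theorem pow'_half_sq {f : MiwaSeries} (h : constantCoeff f = 1) : pow' f (1 / 2) ^ 2 = f := by
  rw [sq, ← pow'_add h, show (1 / 2 + 1 / 2 : ℂ) = 1 by norm_num, pow'_one h]

/-- The specialisation of `fayDiff`, and its square. -/
theorem specHom_fayDiff (a : ℂ) : ∃ s : MiwaSeries, constantCoeff s = 1 ∧
    specHom (fayDiff a) = 2 * lam * s ∧
    s ^ 2 = (1 - 4 * (C a * lam) ^ 2) * (1 + 4 * (C a * lam) ^ 4) := by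
  have hF := constantCoeff_F (phiOfTau (linTau a))
  have t0 : specHom (shiftHom ∅ (linTau a)) = 1 := by
    rw [specHom_shiftHom_linTau]; simp
  have t1 : specHom (shiftHom {0} (linTau a)) = 1 + 2 * (C a * lam) := by
    rw [specHom_shiftHom_linTau, Finset.sum_singleton, specHom_par]
    change 1 + C a * (2 * lam) = _
    ring
  have t2 : specHom (shiftHom {1} (linTau a)) = 1 - 2 * (C a * lam) := by
    rw [specHom_shiftHom_linTau, Finset.sum_singleton, specHom_par]
    change 1 + C a * (2 * -lam) = _
    ring
  have t3 : specHom (shiftHom {0, 1} (linTau a)) = 1 := by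
    rw [specHom_shiftHom_linTau, Finset.sum_pair (by decide), specHom_par, specHom_par]
    change 1 + C a * (2 * lam + 2 * -lam) = _
    ring
  set x : MiwaSeries := C a * lam with hx
  have g1 := specHom_F_linTau a ∅ 1
  have g2 := specHom_F_linTau a {0} 1
  have f1 := specHom_F_linTau a ∅ 0
  have f2 := specHom_F_linTau a {1} 0
  rw [insert_empty_eq, t0, t2] at g1
  rw [Finset.pair_comm, t3, t1] at g2
  rw [insert_empty_eq, t0, t1] at f1
  rw [t3, t2] at f2
  rw [fayDiff]
  set G1 := F (phiOfTau (linTau a)) ∅ 1 with hG1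
  set G2 := F (phiOfTau (linTau a)) {0} 1 with hG2
  set F1 := F (phiOfTau (linTau a)) ∅ 0 with hF1
  set F2 := F (phiOfTau (linTau a)) {1} 0 with hF2
  change specHom G1 * _ = _ - -lam * _ at g1
  change specHom G2 * _ = _ - -lam * _ at g2
  change specHom F1 * _ = _ - lam * _ at f1
  change specHom F2 * _ = _ - lam * _ at f2
  have e1 : specHom G1 * (1 - 2 * x) = 1 - 2 * x + 2 * x ^ 2 := by
    rw [hx] at g1 ⊢; linear_combination g1
  have e2 : specHom G2 * (1 + 2 * x) = 1 + 2 * x + 2 * x ^ 2 := by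
    rw [hx] at g2 ⊢; linear_combination g2
  have e3 : specHom F1 * (1 + 2 * x) = 1 + 2 * x + 2 * x ^ 2 := by
    rw [hx] at f1 ⊢; linear_combination f1
  have e4 : specHom F2 * (1 - 2 * x) = 1 - 2 * x + 2 * x ^ 2 := by
    rw [hx] at f2 ⊢; linear_combination f2
  have hx0 : constantCoeff x = 0 := by rw [hx]; simp [lam]
  have hm : (1 - 2 * x) ≠ 0 := fun h => by
    have := congrArg constantCoeff h
    simp [hx0] at this
  have hp : (1 + 2 * x) ≠ 0 := fun h => by
    have := congrArg constantCoeff h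
    simp [hx0] at this
  -- At `μ = -λ` the double shift is trivial, so the four values of `F` coincide in pairs and both
  -- half-power products specialise to the same series.
  have h1 : specHom F2 = specHom G1 := mul_right_cancel₀ hm (e4.trans e1.symm)
  have h2 : specHom F1 = specHom G2 := mul_right_cancel₀ hp (e3.trans e2.symm)
  have key : specHom (pow' F2 (1 / 2) * pow' F1 (1 / 2)) =
      specHom (pow' G2 (1 / 2) * pow' G1 (1 / 2)) := by
    apply eq_of_sq_eq_sq
    · rw [constantCoeff_specHom, map_mul, constantCoeff_pow' (hF _ _), constantCoeff_pow' (hF _ _),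
        mul_one]
    · rw [constantCoeff_specHom, map_mul, constantCoeff_pow' (hF _ _), constantCoeff_pow' (hF _ _),
        mul_one]
    · rw [← map_pow, ← map_pow, mul_pow, mul_pow, pow'_half_sq (hF _ _), pow'_half_sq (hF _ _),
        pow'_half_sq (hF _ _), pow'_half_sq (hF _ _), map_mul, map_mul, h1, h2, mul_comm]
  have hsq : specHom (pow' G2 (1 / 2) * pow' G1 (1 / 2)) ^ 2 = specHom G2 * specHom G1 := by
    rw [← map_pow, mul_pow, pow'_half_sq (hF _ _), pow'_half_sq (hF _ _), map_mul]
  refine ⟨(1 - 4 * x ^ 2) * specHom (pow' G2 (1 / 2) * pow' G1 (1 / 2)), ?_, ?_, ?_⟩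
  · rw [map_mul, constantCoeff_specHom, map_mul, constantCoeff_pow' (hF _ _),
      constantCoeff_pow' (hF _ _)]
    simp [hx0]
  · rw [mul_assoc lam, mul_assoc mu]
    rw [map_mul, map_mul, map_sub, map_mul specHom lam, map_mul specHom mu, key, specHom_lam,
      specHom_mu, t1, t2]
    ring
  · rw [mul_pow, hsq]
    linear_combination (1 - 4 * x ^ 2) * (1 - 2 * x) * specHom G1 * e2 +
      (1 - 4 * x ^ 2) * (1 + 2 * x + 2 * x ^ 2) * e1

/-- A bilinear expression is at most quadratic in `a` along `τ = 1 + a t₁`. The specialisation kills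
`λ + μ`, so this factor is cancelled before specialising. -/
theorem not_isBilinearIn_zero : ¬ IsBilinearIn (fun τ => fayLHS 0 τ - fayRHS τ) := by
  rintro ⟨B, hB⟩
  have hQ : ∀ a, (lam + mu) * fayDiff a = (B + fayRHSBilin) 1 1 +
      a • ((B + fayRHSBilin) 1 (X 0) + (B + fayRHSBilin) (X 0) 1) +
      (a * a) • (B + fayRHSBilin) (X 0) (X 0) := fun a => by
    have h := hB (linTau a) (isUnit_linTau a)
    have : fayLHS 0 (linTau a) = (B + fayRHSBilin) (linTau a) (linTau a) := by
      rw [LinearMap.add_apply, LinearMap.add_apply, fayRHSBilin_apply, ← h, sub_add_cancel]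
    rw [← fayLHS_linTau, this, linTau]
    generalize B + fayRHSBilin = Q
    simp only [map_add, LinearMap.add_apply, map_smul, LinearMap.smul_apply]
    module
  -- The third difference over `a = -1, 0, 1, 2` annihilates quadratic functions of `a`.
  have hD : fayDiff 2 - 3 * fayDiff 1 + 3 * fayDiff 0 - fayDiff (-1) = 0 := by
    refine (mul_eq_zero.1 ?_).resolve_left lam_add_mu_ne_zero
    have : (lam + mu) * (fayDiff 2 - 3 * fayDiff 1 + 3 * fayDiff 0 - fayDiff (-1)) =
        (lam + mu) * fayDiff 2 - (3 : ℂ) • ((lam + mu) * fayDiff 1) +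
          (3 : ℂ) • ((lam + mu) * fayDiff 0) - (lam + mu) * fayDiff (-1) := by
      rw [smul_eq_C_mul, smul_eq_C_mul, map_ofNat]
      ring
    rw [this, hQ, hQ, hQ, hQ]
    module
  obtain ⟨s2, -, d2, q2⟩ := specHom_fayDiff 2
  obtain ⟨s1, c1, d1, q1⟩ := specHom_fayDiff 1
  obtain ⟨s0, c0, d0, q0⟩ := specHom_fayDiff 0
  obtain ⟨r1, b1, dr, qr⟩ := specHom_fayDiff (-1)
  rw [map_ofNat] at q2
  rw [map_one, one_mul] at q1
  rw [map_zero, zero_mul] at q0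
  rw [map_neg, map_one, neg_one_mul] at qr
  -- The square is even in `a` and equals `1` at `a = 0`, so the third difference reduces to `s2 = 4
  -- s1 - 3`.
  have hr : r1 = s1 := eq_of_sq_eq_sq b1 c1 (by rw [qr, q1]; ring)
  have h0 : s0 = 1 := eq_of_sq_eq_sq c0 (map_one _) (by rw [q0]; ring)
  have hl : lam ≠ 0 := fun h => by
    have := congrArg (coeff (single (Sum.inr 0) 1)) h
    simp [lam, coeff_X] at this
  have hs : s2 = 4 * s1 - 3 := by
    have h := congrArg specHom hD
    rw [map_sub, map_add, map_sub, map_mul, map_mul, map_ofNat, d2, d1, d0, dr, hr, h0,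
      map_zero] at h
    have h' : 2 * lam * (s2 - (4 * s1 - 3)) = 0 := by linear_combination h
    exact sub_eq_zero.1 ((mul_eq_zero.1 h').resolve_left (mul_ne_zero two_ne_zero hl))
  rw [hs] at q2
  -- Squaring `s2 = 4 s1 - 3` makes `s1` a polynomial in `λ`; comparing its square with the known
  -- one gives a nonzero polynomial that would have to vanish.
  have h24 : 24 * s1 = 16 * ((1 - 4 * lam ^ 2) * (1 + 4 * lam ^ 4)) + 9 -
      (1 - 4 * (2 * lam) ^ 2) * (1 + 4 * (2 * lam) ^ 4) := by
    linear_combination 16 * q1 - q2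
  have hfin : 576 * lam ^ 6 * (80 - 128 * lam ^ 2 + 1024 * lam ^ 6) = 0 := by
    linear_combination 576 * q1 - (24 * s1 + (16 * ((1 - 4 * lam ^ 2) * (1 + 4 * lam ^ 4)) + 9 -
      (1 - 4 * (2 * lam) ^ 2) * (1 + 4 * (2 * lam) ^ 4))) * h24
  have := congrArg constantCoeff ((mul_eq_zero.1 hfin).resolve_left
    (mul_ne_zero (OfNat.ofNat_ne_zero _) (pow_ne_zero _ hl)))
  simp only [map_add, map_sub, map_mul, map_pow, map_ofNat, map_zero, lam, constantCoeff_X] at this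
  norm_num at this


end OddKP

end

theorem proposition3p1 :
    (∀ (k : ℂ) (w wt : ℕ → OddKP.TimeSeries), w 0 = 1 → wt 0 = 1 →
      OddKP.BilinearIdentity w wt →
      OddKP.theta w = MvPowerSeries.C k * MvPowerSeries.pderiv ℂ 0 (OddKP.phi w) →
      ∃ τ : OddKP.TimeSeries, IsUnit τ ∧ OddKP.phi w = OddKP.phiOfTau τ ∧
        OddKP.DifferentialFay k τ) ∧
    (∀ k : ℂ, k = 1 / 2 ∨ k = -(1 / 2) →
      OddKP.IsBilinearIn (fun τ => OddKP.fayLHS k τ - OddKP.fayRHS τ) ∧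
      ∀ τ : OddKP.TimeSeries, IsUnit τ → (OddKP.DifferentialFay k τ ↔ OddKP.BKPFay τ)) ∧
    ¬ OddKP.IsBilinearIn (fun τ => OddKP.fayLHS 0 τ - OddKP.fayRHS τ) :=
  ⟨fun _ _ _ hw hwt h hθ => OddKP.exists_tau_fay hw hwt h hθ,
    fun _ hk => ⟨OddKP.isBilinearIn_of_bkp hk, fun _ hτ => OddKP.differentialFay_iff_bkpFay hk hτ⟩,
    OddKP.not_isBilinearIn_zero⟩
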